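/- \textbf{Setting.} Let $\Omega\subset\mathbb R^2$ be a bounded polygonal domain (without slits) and let $a(v,w)=\int_\Omega D^2v:D^2w\,dx$. Functions on $\Omega$ that vanish to first order on $\partial\Omega$ are extended by zero. \emph{Partition of unity spaces.} Fix $\sigma>0$. A flat-top partition of unity discretization of mesh size $h$ consists of open rectangles (patches) $\Omega_1,\dots,\Omega_n$ covering $\bar\Omega$, with $\operatorname{diam}\Omega_i\le\sigma h$ and no point in more than $\sigma$ patches; nonnegative functions $\phi_i\in W^2_\infty(\mathbb R^2)$ with $\operatorname{supp}\phi_i\subset\Omega_i$, $\sum_i\phi_i=1$ on $\Omega$, $|\phi_i|_{W^m_\infty(\mathbb R^2)}\le\sigma(\operatorname{diam}\Omega_i)^{-m}$ for $0\le m\le2$, and $\phi_i=1$ on a closed rectangle $\Omega_i^{\rm flat}\subset\Omega_i$, parallel to $\Omega_i$, with sides at least $h/\sigma$; spaces $V_i$ of polynomials, biquadratic in the coordinates along the sides of $\Omega_i$, that vanish together with their gradient on $\partial\Omega\cap\Omega_i$, where $V_i$ contains all polynomials of degree at most one if $\Omega_i\subset\Omega$; and finite sets of nodes $\mathcal N_i\subset\Omega\cap\Omega_i^{\rm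 flat}$ whose point values are degrees of freedom for $V_i$ (each assignment of values is attained by exactly one member of $V_i$), with $\|q\|_{L_\infty(\Omega_i)}\le\sigma$ whenever $q\in V_i$ and $|q|\le1$ on $\mathcal N_i$. Put $V_h=\sum_i\phi_iV_i$, $\mathcal N_h=\bigcup_i\mathcal N_i$, and $\Pi_h\zeta=\sum_i(\Pi_i\zeta)\phi_i$, where $\Pi_i$ is nodal interpolation in $V_i$. Let $V_H$ be a space of the same kind, with the same $\sigma$, of mesh size $H$. \emph{Truncation.} For a nonempty $\widetilde{\mathcal N}_h\subset\mathcal N_h$ let $\tilde T_h:V_h\to V_h$ keep the nodal values at $\widetilde{\mathcal N}_h$ and replace those at $\mathcal N_h\setminus\widetilde{\mathcal N}_h$ by $0$; let $\widetilde V_h=\tilde T_hV_h$ and define $\tilde A_h:\widetilde V_h\to\widetilde V_h'$ by $\langle\tilde A_hv,w\rangle=a(v,w)$. \emph{Decomposition.} Let $D_1,\dots,D_J$ be open sets without slits (that is, $\Omega\cap\operatorname{int}\overline{D_j}=D_j$) with $\bigcup_jD_j=\Omega$, $H/\sigma\le\operatorname{diam}D_j\le\sigma H$, every point of $\Omega$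 in at most $N_c$ of them, and $\partial D_j\subset\partial\Omega\cup\bigcup_i\partial\Omega_i$ (with the patches of $V_h$). Let $\psi_1,\dots,\psi_J\in W^2_\infty(\mathbb R^2)$ be nonnegative, with $\sum_j\psi_j=1$ on $\bar\Omega$, $\psi_j=0$ on $\Omega\setminus\overline{D_j}$ and $|\psi_j|_{W^k_\infty(\Omega)}\le C_\dagger\delta^{-k}$ for $k=0,1,2$, where the overlap $\delta$ satisfies $0<h\le\delta\le\sigma H$. Let $\widetilde V_j$ ($1\le j\le J$) be the space of all $v\in\widetilde V_h$ that vanish at the nodes outside $D_j$, let $\widetilde V_0=\tilde T_h\Pi_hV_H$, let $I_j:\widetilde V_j\to\widetilde V_h$ be the injection and $A_j:\widetilde V_j\to\widetilde V_j'$, $\langle A_jv,w\rangle=a(v,w)$, for $0\le j\le J$. \textbf{Theorem.} The operators $A_0,\dots,A_J$ are invertible, and with $B_{\rm TL}=\sum_{j=0}^JI_jA_j^{-1}I_j^t$ the largest and the smallest eigenvalue of $B_{\rm TL}\tilde A_h$ exist, are positive and satisfy $$\kappa(B_{\rm TL}\tilde A_h)=\frac{\lambda_{\max}(B_{\rm TL}\tilde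 A_h)}{\lambda_{\min}(B_{\rm TL}\tilde A_h)}\le C\min\big((H/h)^4,\delta^{-4}\big),$$ where the constant $C>0$ depends only on $\Omega$, $\sigma$, $N_c$ and $C_\dagger$; in particular it is independent of $H$, $h$, $J$, $\delta$ and $\widetilde{\mathcal N}_h$. -/

import Mathlib

open MeasureTheory Set
open scoped ContDiff

noncomputable section

/-- The Euclidean plane `ℝ²`. -/
abbrev Plane := EuclideanSpace ℝ (Fin 2)

/-- A bounded polygonal domain: a bounded connected set which is the interior of a finite union of
closed convex polygons (each one a finite intersection of closed half planes).  In particular it is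
open, and slits are excluded. -/
def IsPolygonalDomain (Ω : Set Plane) : Prop :=
  IsConnected Ω ∧ Bornology.IsBounded Ω ∧
    ∃ P : Finset (Finset (Plane × ℝ)), (∀ p ∈ P, ∀ l ∈ p, l.1 ≠ 0) ∧
      Ω = interior (⋃ p ∈ P, {x : Plane | ∀ l ∈ p, inner ℝ l.1 x ≤ l.2})

/-- `g` is the weak partial derivative `∂f/∂xᵢ` on the open set `U`. -/
def IsWeakPartial (U : Set Plane) (i : Fin 2) (f g : Plane → ℝ) : Prop :=
  LocallyIntegrableOn f U ∧ LocallyIntegrableOn g U ∧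
    ∀ η : Plane → ℝ, ContDiff ℝ ∞ η → HasCompactSupport η → tsupport η ⊆ U →
      ∫ x in U, f x * fderiv ℝ η x (EuclideanSpace.single i 1) = -∫ x in U, g x * η x

open Classical in
/-- A representative of the weak partial derivative `∂f/∂xᵢ` on `U` (unique up to null sets), and
`0` if there is none. -/
def weakPartial (U : Set Plane) (i : Fin 2) (f : Plane → ℝ) : Plane → ℝ :=
  if hf : ∃ g, IsWeakPartial U i f g then hf.choose else 0

/-- The plate energy form `a(v,w) = ∫_Ω D²v : D²w dx`. -/
def plateForm (Ω : Set Plane) (v w : Plane → ℝ) : ℝ :=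
  ∫ x in Ω, ∑ i : Fin 2, ∑ j : Fin 2,
    weakPartial Ω i (weakPartial Ω j v) x * weakPartial Ω i (weakPartial Ω j w) x

/-- `f ∈ W²_∞(ℝ²)`: `f` (its continuous representative) is bounded and `C¹`, with a bounded and
Lipschitz gradient. -/
def MemW2Inf (f : Plane → ℝ) : Prop :=
  ContDiff ℝ 1 f ∧ (∃ M : ℝ, ∀ x, |f x| ≤ M) ∧ (∃ M : ℝ, ∀ x, ‖fderiv ℝ f x‖ ≤ M) ∧
    ∃ K : NNReal, LipschitzWith K (fderiv ℝ f)

/-- `|f|_{W^k_∞(U)} ≤ M`, for `f ∈ W²_∞(ℝ²)` and `k ≤ 2` (the derivatives of order two exist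
almost everywhere by Rademacher's theorem). -/
def SeminormLE (U : Set Plane) (k : ℕ) (f : Plane → ℝ) (M : ℝ) : Prop :=
  ∀ᵐ x ∂(volume.restrict U), ‖iteratedFDeriv ℝ k f x‖ ≤ M

/-- The polynomials that are biquadratic in the Cartesian coordinates given by `F`. -/
def biquadratic (F : Plane ≃ₗᵢ[ℝ] Plane) : Submodule ℝ (Plane → ℝ) :=
  Submodule.span ℝ (Set.range fun m : Fin 3 × Fin 3 =>
    fun x : Plane => (F x 0) ^ (m.1 : ℕ) * (F x 1) ^ (m.2 : ℕ))

/-- The open rectangle with sides parallel to the axes of the coordinates given by `F`. -/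
def openRect (F : Plane ≃ₗᵢ[ℝ] Plane) (lo hi : Fin 2 → ℝ) : Set Plane :=
  {x | ∀ k, lo k < F x k ∧ F x k < hi k}

/-- The closed rectangle with sides parallel to the axes of the coordinates given by `F`. -/
def closedRect (F : Plane ≃ₗᵢ[ℝ] Plane) (lo hi : Fin 2 → ℝ) : Set Plane :=
  {x | ∀ k, lo k ≤ F x k ∧ F x k ≤ hi k}

/-- A flat-top partition of unity discretization of mesh size `h` for the clamped plate on `Ω`;
the number `σ` bounds all the regularity constants. -/
structure PUM (Ω : Set Plane) (σ h : ℝ) where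
  /-- The number of patches. -/
  n : ℕ
  /-- Cartesian coordinates along the sides of the patch `Ωᵢ`. -/
  frame : Fin n → (Plane ≃ₗᵢ[ℝ] Plane)
  /-- The bounds of the patch `Ωᵢ`, an open rectangle. -/
  lo : Fin n → Fin 2 → ℝ
  hi : Fin n → Fin 2 → ℝ
  /-- The bounds of the flat-top rectangle of `Ωᵢ`. -/
  flatLo : Fin n → Fin 2 → ℝ
  flatHi : Fin n → Fin 2 → ℝ
  /-- The partition of unity. -/
  φ : Fin n → Plane → ℝ
  /-- The local spaces. -/
  V : Fin n → Submodule ℝ (Plane → ℝ)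
  /-- The nodes of the local spaces. -/
  nodes : Fin n → Finset Plane
  cover : closure Ω ⊆ ⋃ i, openRect (frame i) (lo i) (hi i)
  diam_le : ∀ i, Metric.diam (openRect (frame i) (lo i) (hi i)) ≤ σ * h
  overlap : ∀ x, (Set.ncard {i | x ∈ openRect (frame i) (lo i) (hi i)} : ℝ) ≤ σ
  φ_mem : ∀ i, MemW2Inf (φ i)
  φ_nonneg : ∀ i x, 0 ≤ φ i x
  φ_support : ∀ i, tsupport (φ i) ⊆ openRect (frame i) (lo i) (hi i)
  φ_sum : ∀ x ∈ Ω, ∑ i, φ i x = 1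
  φ_bound : ∀ i, ∀ m ≤ 2, SeminormLE Set.univ m (φ i)
    (σ / Metric.diam (openRect (frame i) (lo i) (hi i)) ^ m)
  flat_width : ∀ i k, h / σ ≤ flatHi i k - flatLo i k
  φ_flat : ∀ i, ∀ x ∈ closedRect (frame i) (flatLo i) (flatHi i), φ i x = 1
  V_biquadratic : ∀ i, V i ≤ biquadratic (frame i)
  /-- The members of the local spaces satisfy the clamped boundary conditions. -/
  V_clamped : ∀ i, ∀ q ∈ V i, ∀ x ∈ frontier Ω ∩ openRect (frame i) (lo i) (hi i),
    q x = 0 ∧ fderiv ℝ q x = 0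
  /-- On the interior patches the local space contains the polynomials of degree at most one. -/
  V_interior : ∀ i, openRect (frame i) (lo i) (hi i) ⊆ Ω →
    ∀ (c : ℝ) (b : Plane), (fun x => c + inner ℝ b x) ∈ V i
  nodes_mem : ∀ i, ∀ p ∈ nodes i, p ∈ Ω ∧ p ∈ closedRect (frame i) (flatLo i) (flatHi i)
  /-- The values at the nodes are degrees of freedom of the local space. -/
  unisolvent : ∀ i, ∀ c : Plane → ℝ, ∃! q : Plane → ℝ, q ∈ V i ∧ ∀ p ∈ nodes i, q p = c p
  /-- The nodes are well placed: the nodal values control the polynomial on the patch. -/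
  nodes_stable : ∀ i, ∀ q ∈ V i, (∀ p ∈ nodes i, |q p| ≤ 1) →
    ∀ x ∈ openRect (frame i) (lo i) (hi i), |q x| ≤ σ

namespace PUM

variable {Ω : Set Plane} {σ h : ℝ} (S : PUM Ω σ h)

/-- The patch `Ωᵢ`. -/
def patch (i : Fin S.n) : Set Plane := openRect (S.frame i) (S.lo i) (S.hi i)

/-- The set of all nodes. -/
def allNodes : Set Plane := {p | ∃ i, p ∈ S.nodes i}

/-- The map `q ↦ φᵢ q`, where `φᵢ q` is regarded as a function on `Ω`.  Functions on `Ω` are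
extended by zero to the plane throughout. -/
def lift (i : Fin S.n) : (Plane → ℝ) →ₗ[ℝ] (Plane → ℝ) where
  toFun q := Ω.indicator (fun x => S.φ i x * q x)
  map_add' q r := by
    funext x
    by_cases hx : x ∈ Ω <;> simp [hx, mul_add]
  map_smul' c q := by
    funext x
    by_cases hx : x ∈ Ω <;> simp [hx, mul_left_comm]

/-- The generalized finite element space `∑ᵢ φᵢ Vᵢ`. -/
def space : Submodule ℝ (Plane → ℝ) := ⨆ i, (S.V i).map (S.lift i)

/-- The local nodal interpolation operator. -/
def localInterp (i : Fin S.n) : (Plane → ℝ) →ₗ[ℝ] (Plane → ℝ) where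
  toFun ζ := (S.unisolvent i ζ).choose
  map_add' ζ ξ := by
    have h₁ := (S.unisolvent i ζ).choose_spec.1
    have h₂ := (S.unisolvent i ξ).choose_spec.1
    refine ((S.unisolvent i (ζ + ξ)).choose_spec.2 _ ⟨(S.V i).add_mem h₁.1 h₂.1, ?_⟩).symm
    intro p hp
    simp only [Pi.add_apply]
    rw [h₁.2 p hp, h₂.2 p hp]
  map_smul' c ζ := by
    have h₁ := (S.unisolvent i ζ).choose_spec.1
    refine ((S.unisolvent i (c • ζ)).choose_spec.2 _ ⟨(S.V i).smul_mem c h₁.1, ?_⟩).symm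
    intro p hp
    simp only [Pi.smul_apply]
    rw [h₁.2 p hp]

/-- The interpolation operator `ζ ↦ ∑ᵢ φᵢ (Πᵢ ζ)`, which only uses the nodal values of `ζ`. -/
def interp : (Plane → ℝ) →ₗ[ℝ] (Plane → ℝ) := ∑ i, S.lift i ∘ₗ S.localInterp i

theorem interp_mem (ζ : Plane → ℝ) : S.interp ζ ∈ S.space := by
  unfold interp space
  rw [LinearMap.sum_apply]
  refine Submodule.sum_mem _ fun i _ => Submodule.mem_iSup_of_mem i ?_
  exact Submodule.mem_map_of_mem (S.unisolvent i ζ).choose_spec.1.1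

/-- Replacing the values of a function off the set `N` by zero. -/
def cutoff (N : Set Plane) : (Plane → ℝ) →ₗ[ℝ] (Plane → ℝ) where
  toFun v := N.indicator v
  map_add' v w := Set.indicator_add _ _ _
  map_smul' c v := by
    funext x
    by_cases hx : x ∈ N <;> simp [hx]

/-- The truncation operator: the member of the finite element space whose nodal values are those
of `v` at the nodes in `N`, and zero at all the other nodes. -/
def trunc (N : Set Plane) : (Plane → ℝ) →ₗ[ℝ] (Plane → ℝ) := S.interp ∘ₗ cutoff N

/-- The truncated space `Ṽ_h`. -/
def truncSpace (N : Set Plane) : Submodule ℝ (Plane → ℝ) := S.space.map (S.trunc N)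

/-- The subdomain space `Ṽ_j` of the subdomain `D`: the members of `Ṽ_h` that vanish at all the
nodes outside `D`. -/
def subSpace (N D : Set Plane) : Submodule ℝ (Plane → ℝ) where
  carrier := {v | v ∈ S.truncSpace N ∧ ∀ p ∈ S.allNodes, p ∉ D → v p = 0}
  zero_mem' := ⟨Submodule.zero_mem _, fun _ _ _ => rfl⟩
  add_mem' := fun {v w} hv hw => ⟨Submodule.add_mem _ hv.1 hw.1, fun p hp hD => by
    simp [hv.2 p hp hD, hw.2 p hp hD]⟩
  smul_mem' := fun c v hv => ⟨Submodule.smul_mem _ c hv.1, fun p hp hD => by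
    simp [hv.2 p hp hD]⟩

theorem subSpace_le (N D : Set Plane) : S.subSpace N D ≤ S.truncSpace N := fun _ hv => hv.1

/-- The coarse space `Ṽ_0 = T̃_h Π_h V_H`. -/
def coarseSpace {H : ℝ} (SH : PUM Ω σ H) (N : Set Plane) : Submodule ℝ (Plane → ℝ) :=
  (SH.space.map S.interp).map (S.trunc N)

theorem coarseSpace_le {H : ℝ} (SH : PUM Ω σ H) (N : Set Plane) :
    S.coarseSpace SH N ≤ S.truncSpace N := by
  refine Submodule.map_mono ?_
  rintro _ ⟨ζ, _, rfl⟩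
  exact S.interp_mem ζ

end PUM

/-- An overlapping decomposition of `Ω` into subdomains of diameter comparable to `H`, with overlap
`δ`, aligned with the patches of the discretization `S` of mesh size `h`. -/
structure Decomposition {Ω : Set Plane} {σ h : ℝ} (S : PUM Ω σ h) (Nc : ℕ) (Cdag H δ : ℝ) where
  /-- The number of subdomains. -/
  J : ℕ
  /-- The subdomains. -/
  D : Fin J → Set Plane
  /-- The partition of unity subordinate to the subdomains. -/
  ψ : Fin J → Plane → ℝ
  isOpen : ∀ j, IsOpen (D j)
  cover : ⋃ j, D j = Ω
  /-- The subdomains have no slits. -/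
  no_slit : ∀ j, interior (closure (D j)) ∩ Ω ⊆ D j
  aligned : ∀ j, frontier (D j) ⊆ frontier Ω ∪ ⋃ i, frontier (S.patch i)
  diam_ge : ∀ j, H / σ ≤ Metric.diam (D j)
  diam_le : ∀ j, Metric.diam (D j) ≤ σ * H
  overlap : ∀ x ∈ Ω, Set.ncard {j | x ∈ D j} ≤ Nc
  ψ_mem : ∀ j, MemW2Inf (ψ j)
  ψ_sum : ∀ x ∈ closure Ω, ∑ j, ψ j x = 1
  ψ_nonneg : ∀ j x, 0 ≤ ψ j x
  ψ_support : ∀ j, ∀ x ∈ Ω \ closure (D j), ψ j x = 0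
  ψ_bound : ∀ j, ∀ k ≤ 2, SeminormLE Ω k (ψ j) (Cdag / δ ^ k)

/-- The additive Schwarz operator `∑ₐ Iₐ Aₐ⁻¹ Iₐᵗ : W' → W` of subspaces `Wₐ` of `W`, where
`Iₐ : Wₐ → W` is the natural injection. -/
def additiveSchwarz {ι : Type} [Fintype ι] {W : Submodule ℝ (Plane → ℝ)}
    {Wsub : ι → Submodule ℝ (Plane → ℝ)} (hW : ∀ a, Wsub a ≤ W)
    (A : ∀ a, Wsub a ≃ₗ[ℝ] Module.Dual ℝ (Wsub a)) : Module.Dual ℝ W →ₗ[ℝ] W :=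
  ∑ a, Submodule.inclusion (hW a) ∘ₗ (A a).symm.toLinearMap ∘ₗ
    (Submodule.inclusion (hW a)).dualMap

namespace Decomposition

variable {Ω : Set Plane} {σ h : ℝ} {S : PUM Ω σ h} {Nc : ℕ} {Cdag H δ : ℝ}

/-- The subspaces of the two-level method: the coarse space (index `none`) and the subdomain
spaces. -/
def levelSpace (𝒟 : Decomposition S Nc Cdag H δ) (SH : PUM Ω σ H) (N : Set Plane) :
    Option (Fin 𝒟.J) → Submodule ℝ (Plane → ℝ)
  | none => S.coarseSpace SH N
  | some j => S.subSpace N (𝒟.D j)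

theorem levelSpace_le (𝒟 : Decomposition S Nc Cdag H δ) (SH : PUM Ω σ H) (N : Set Plane) :
    ∀ a, 𝒟.levelSpace SH N a ≤ S.truncSpace N
  | none => S.coarseSpace_le SH N
  | some j => S.subSpace_le N (𝒟.D j)

end Decomposition

end

/-! The preconditioned operator is the sum of the `a`-orthogonal projections onto the coarse space
and the subdomain spaces. It is symmetric for `a`, and two inequalities confine its spectrum
(`additiveSchwarz_eigenvalue_bounds`). If the energy of a sum is at most `M` times the sum of the
energies, then the eigenvalues are at most `M`. If every `v` splits into members of the subspaces
with total energy at most `K a(v,v)`, then the eigenvalues are at least `1/K`.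

The constant `M` comes from finite overlap: near a given point only boundedly many subdomain
functions are nonzero (`energy_sum_le`).

For `K` two splittings compete. Both use the components `Π_h(ψ_j w)`, which lie in the subdomain
spaces because `Π_h` sees only nodal values. (1) Without a coarse part, `w = v`. Here `Π_h` is
stable in the energy norm (`exists_energy_interp_le`), the product rule costs at most two
derivatives of `ψ_j`, and Poincaré inequalities bound `v` and its gradient by the energy. The result
is `δ⁻⁴`. (2) With `v₀` the truncation of a coarse approximant `ζ`, and `w = v - v₀`. Truncation
leaves no smoothness to exploit, so only nodal values are used. The inverse estimate
`energy_interp_le_nodalSq` bounds the energy of an interpolant by `h⁻²` times the sum of its squared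
nodal values. At the nodes `v - v₀` is no larger than `v - ζ`, since `v` vanishes at the discarded
nodes. The squared error of `ζ` is at most a multiple of `H²` times a local energy, and each point
is counted by about `(H/h)²` nodes. The result is `(H/h)⁴`.

The analytic basis is as follows. The clamped condition makes the zero extension of a discrete
function a `W²_∞` function on the plane. Averaged Taylor polynomials show that on a ball of radius
`R` such a function is uniformly within a multiple of `R ‖D²u‖_{L₂}` of an affine function
(`exists_affine_approx`). Near the boundary the exterior cone condition makes the function itself
that small (`sq_le_near_frontier`). Local interpolants are therefore compared with affine functions
in the interior and with zero near the boundary. -/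

/-! ### Operator and Frobenius norms of the Hessian -/

/-- The second derivative of `u`. -/
noncomputable def hessian (u : Plane → ℝ) (x : Plane) : Plane →L[ℝ] Plane →L[ℝ] ℝ :=
  fderiv ℝ (fderiv ℝ u) x

/-- The coordinate directions of the plane. -/
noncomputable abbrev dir (i : Fin 2) : Plane := EuclideanSpace.single i 1

/-- The squared Frobenius norm of the Hessian. -/
noncomputable def hessSq (u : Plane → ℝ) (x : Plane) : ℝ :=
  ∑ i : Fin 2, ∑ j : Fin 2, (hessian u x (dir i) (dir j)) ^ 2

theorem hessSq_nonneg (u : Plane → ℝ) (x : Plane) : 0 ≤ hessSq u x :=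
  Finset.sum_nonneg fun _ _ => Finset.sum_nonneg fun _ _ => sq_nonneg _

theorem plane_eq_sum_dir (v : Plane) : v = v 0 • dir 0 + v 1 • dir 1 := by
  ext i
  fin_cases i <;> simp

theorem bilin_sq_le (L : Plane →L[ℝ] Plane →L[ℝ] ℝ) (v w : Plane) :
    (L v w) ^ 2 ≤ (∑ i : Fin 2, ∑ j : Fin 2, (L (dir i) (dir j)) ^ 2) * (‖v‖ ^ 2 * ‖w‖ ^ 2) := by
  have hv : ‖v‖ ^ 2 = v 0 ^ 2 + v 1 ^ 2 := by
    rw [EuclideanSpace.norm_sq_eq]; simp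
  have hw : ‖w‖ ^ 2 = w 0 ^ 2 + w 1 ^ 2 := by
    rw [EuclideanSpace.norm_sq_eq]; simp
  have hL : L v w = v 0 * w 0 * L (dir 0) (dir 0) + v 0 * w 1 * L (dir 0) (dir 1)
      + v 1 * w 0 * L (dir 1) (dir 0) + v 1 * w 1 * L (dir 1) (dir 1) := by
    conv_lhs => rw [plane_eq_sum_dir v, plane_eq_sum_dir w]
    simp only [map_add, map_smul, _root_.add_apply, _root_.smul_apply,
      smul_eq_mul]
    ring
  rw [hL, hv, hw]
  simp only [Fin.sum_univ_two]
  generalize L (dir 0) (dir 0) = a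
  generalize L (dir 0) (dir 1) = b
  generalize L (dir 1) (dir 0) = c
  generalize L (dir 1) (dir 1) = d
  generalize v 0 = p
  generalize v 1 = q
  generalize w 0 = r
  generalize w 1 = s
  -- Lagrange's identity: the six squares are the defect in the Cauchy–Schwarz inequality for `(pr,
  -- ps, qr, qs)` and `(a, b, c, d)`.
  nlinarith [sq_nonneg (p * r * b - p * s * a), sq_nonneg (p * r * c - q * r * a),
    sq_nonneg (p * r * d - q * s * a), sq_nonneg (p * s * c - q * r * b),
    sq_nonneg (p * s * d - q * s * b), sq_nonneg (q * r * d - q * s * c)]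

theorem norm_hessian_sq_le (u : Plane → ℝ) (x : Plane) : ‖hessian u x‖ ^ 2 ≤ hessSq u x := by
  have h : ‖hessian u x‖ ≤ √(hessSq u x) := by
    refine ContinuousLinearMap.opNorm_le_bound₂ _ (Real.sqrt_nonneg _) fun v w => ?_
    rw [Real.norm_eq_abs]
    refine abs_le_of_sq_le_sq ?_ (by positivity)
    have := bilin_sq_le (hessian u x) v w
    rw [mul_pow, mul_pow, Real.sq_sqrt (hessSq_nonneg u x), mul_assoc]
    exact this
  calc ‖hessian u x‖ ^ 2 ≤ √(hessSq u x) ^ 2 := by gcongr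
    _ = hessSq u x := Real.sq_sqrt (hessSq_nonneg u x)

theorem hessSq_le_norm_sq (u : Plane → ℝ) (x : Plane) : hessSq u x ≤ 4 * ‖hessian u x‖ ^ 2 := by
  have h : ∀ i j, (hessian u x (dir i) (dir j)) ^ 2 ≤ ‖hessian u x‖ ^ 2 := by
    intro i j
    rw [← sq_abs]
    have := (hessian u x).le_opNorm₂ (dir i) (dir j)
    simp only [PiLp.norm_single, norm_one, mul_one, Real.norm_eq_abs] at this
    gcongr
  unfold hessSq
  simp only [Fin.sum_univ_two]
  linarith [h 0 0, h 0 1, h 1 0, h 1 1]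

/-! ### Pointwise calculus of the Hessian -/

/-- `u` is differentiable, and twice differentiable at `x`. -/
def TwiceDiffAt (u : Plane → ℝ) (x : Plane) : Prop :=
  Differentiable ℝ u ∧ DifferentiableAt ℝ (fderiv ℝ u) x

theorem two_le_infty : (1 + 1 : WithTop ℕ∞) ≤ ∞ := by
  rw [one_add_one_eq_two]
  exact WithTop.coe_le_coe.2 (le_top : (2 : ℕ∞) ≤ ⊤)

theorem TwiceDiffAt.of_contDiff {u : Plane → ℝ} (hu : ContDiff ℝ ∞ u) (x : Plane) :
    TwiceDiffAt u x :=
  ⟨hu.differentiable (by simp),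
    ((hu.fderiv_right (m := 1) two_le_infty).differentiable (by simp)) x⟩

theorem fderiv_add_fun {u w : Plane → ℝ} (hu : Differentiable ℝ u) (hw : Differentiable ℝ w) :
    fderiv ℝ (u + w) = fderiv ℝ u + fderiv ℝ w := by
  funext x
  exact fderiv_add (hu x) (hw x)

theorem TwiceDiffAt.add {u w : Plane → ℝ} {x : Plane} (hu : TwiceDiffAt u x)
    (hw : TwiceDiffAt w x) : TwiceDiffAt (u + w) x := by
  refine ⟨hu.1.add hw.1, ?_⟩
  rw [fderiv_add_fun hu.1 hw.1]
  exact hu.2.add hw.2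

theorem hessian_add {u w : Plane → ℝ} {x : Plane} (hu : TwiceDiffAt u x)
    (hw : TwiceDiffAt w x) : hessian (u + w) x = hessian u x + hessian w x := by
  unfold hessian
  rw [fderiv_add_fun hu.1 hw.1]
  exact fderiv_add hu.2 hw.2

theorem fderiv_smul_fun (c : ℝ) {u : Plane → ℝ} (hu : Differentiable ℝ u) :
    fderiv ℝ (c • u) = c • fderiv ℝ u := by
  funext x
  exact fderiv_const_smul (hu x) c

theorem hessian_smul (c : ℝ) {u : Plane → ℝ} {x : Plane} (hu : TwiceDiffAt u x) :
    hessian (c • u) x = c • hessian u x := by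
  unfold hessian
  rw [fderiv_smul_fun c hu.1]
  exact fderiv_const_smul hu.2 c

theorem TwiceDiffAt.zero (x : Plane) : TwiceDiffAt 0 x := TwiceDiffAt.of_contDiff contDiff_const x

@[simp] theorem hessian_zero (x : Plane) : hessian 0 x = 0 := by
  have h : fderiv ℝ (0 : Plane → ℝ) = fun _ => 0 := by
    funext y; exact fderiv_const_apply (0 : ℝ)
  unfold hessian
  rw [h]; exact fderiv_const_apply _

theorem TwiceDiffAt.sum {ι : Type*} (s : Finset ι) {u : ι → Plane → ℝ} {x : Plane}
    (hu : ∀ i ∈ s, TwiceDiffAt (u i) x) :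
    TwiceDiffAt (∑ i ∈ s, u i) x ∧ hessian (∑ i ∈ s, u i) x = ∑ i ∈ s, hessian (u i) x := by
  classical
  induction s using Finset.induction_on with
  | empty => simpa using TwiceDiffAt.zero x
  | insert a s ha ih =>
    have ih' := ih fun i hi => hu i (Finset.mem_insert_of_mem hi)
    have ha' := hu a (Finset.mem_insert_self _ _)
    rw [Finset.sum_insert ha, Finset.sum_insert ha]
    exact ⟨ha'.add ih'.1, by rw [hessian_add ha' ih'.1, ih'.2]⟩

theorem fderiv_mul_fun {u w : Plane → ℝ} (hu : Differentiable ℝ u) (hw : Differentiable ℝ w) :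
    fderiv ℝ (fun y => u y * w y) = fun y => u y • fderiv ℝ w y + w y • fderiv ℝ u y := by
  funext x
  exact fderiv_fun_mul (hu x) (hw x)

theorem TwiceDiffAt.mul {u w : Plane → ℝ} {x : Plane} (hu : TwiceDiffAt u x)
    (hw : TwiceDiffAt w x) : TwiceDiffAt (fun y => u y * w y) x := by
  refine ⟨hu.1.mul hw.1, ?_⟩
  rw [fderiv_mul_fun hu.1 hw.1]
  exact ((hu.1 x).smul hw.2).add ((hw.1 x).smul hu.2)

theorem norm_hessian_mul_le {u w : Plane → ℝ} {x : Plane} (hu : TwiceDiffAt u x)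
    (hw : TwiceDiffAt w x) : ‖hessian (fun y => u y * w y) x‖ ≤
      |u x| * ‖hessian w x‖ + 2 * (‖fderiv ℝ u x‖ * ‖fderiv ℝ w x‖) + |w x| * ‖hessian u x‖ := by
  have h : hessian (fun y => u y * w y) x =
      (u x • hessian w x + (fderiv ℝ u x).smulRight (fderiv ℝ w x)) +
      (w x • hessian u x + (fderiv ℝ w x).smulRight (fderiv ℝ u x)) := by
    unfold hessian
    rw [fderiv_mul_fun hu.1 hw.1]
    exact (((hu.1 x).hasFDerivAt.smul hw.2.hasFDerivAt).add
      ((hw.1 x).hasFDerivAt.smul hu.2.hasFDerivAt)).fderiv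
  rw [h]
  have h0 := norm_add_le (u x • hessian w x + (fderiv ℝ u x).smulRight (fderiv ℝ w x))
    (w x • hessian u x + (fderiv ℝ w x).smulRight (fderiv ℝ u x))
  have h1 := norm_add_le (u x • hessian w x) ((fderiv ℝ u x).smulRight (fderiv ℝ w x))
  have h2 := norm_add_le (w x • hessian u x) ((fderiv ℝ w x).smulRight (fderiv ℝ u x))
  have h3 := ContinuousLinearMap.opNorm_smul_le (u x) (hessian w x)
  have h4 := ContinuousLinearMap.opNorm_smul_le (w x) (hessian u x)
  rw [ContinuousLinearMap.norm_smulRight_apply] at h1 h2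
  rw [Real.norm_eq_abs] at h3 h4
  linarith [mul_comm ‖fderiv ℝ u x‖ ‖fderiv ℝ w x‖]

theorem hessian_congr {u w : Plane → ℝ} {x : Plane} (h : u =ᶠ[nhds x] w) :
    hessian u x = hessian w x := h.fderiv.fderiv_eq

theorem hessSq_congr {u w : Plane → ℝ} {x : Plane} (h : u =ᶠ[nhds x] w) :
    hessSq u x = hessSq w x := by
  unfold hessSq; rw [hessian_congr h]

theorem hessSq_zero (x : Plane) : hessSq 0 x = 0 := by simp [hessSq]

theorem measurable_hessian_apply (u : Plane → ℝ) (v w : Plane) :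
    Measurable fun x => hessian u x v w := by
  have h : Measurable fun x => hessian u x := measurable_fderiv ℝ (fderiv ℝ u)
  exact ((ContinuousLinearMap.apply ℝ ℝ w).continuous.measurable.comp
    ((ContinuousLinearMap.apply ℝ (Plane →L[ℝ] ℝ) v).continuous.measurable.comp h))

theorem measurable_hessSq (u : Plane → ℝ) : Measurable (hessSq u) :=
  Finset.measurable_sum _ fun _ _ => Finset.measurable_sum _ fun _ _ =>
    (measurable_hessian_apply u _ _).pow_const 2

/-- A segment is connected, so it cannot be split between the disjoint open sets `Ω` and the
complement of its closure. -/
theorem exists_mem_segment_frontier {Ω : Set Plane} (hΩ : IsOpen Ω) {x y : Plane} (hx : x ∈ Ω)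
    (hy : y ∉ Ω) : ∃ z ∈ segment ℝ x y, z ∈ frontier Ω := by
  by_contra! hne
  have hcov : segment ℝ x y ⊆ Ω ∪ (closure Ω)ᶜ := by
    intro z hz
    by_cases hz' : z ∈ Ω
    · exact Or.inl hz'
    · refine Or.inr fun hc => hne z hz ⟨hc, by rwa [hΩ.interior_eq]⟩
  have hy' : y ∈ (closure Ω)ᶜ := (hcov (right_mem_segment ℝ x y)).resolve_left hy
  obtain ⟨z, -, hz1, hz2⟩ := (convex_segment x y).isPreconnected _ _ hΩ
    isClosed_closure.isOpen_compl hcov ⟨x, left_mem_segment ℝ x y, hx⟩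
    ⟨y, right_mem_segment ℝ x y, hy'⟩
  exact hz2 (subset_closure hz1)

/-! ### The algebra `W²_∞` -/

namespace MemW2Inf

variable {u w : Plane → ℝ}

theorem differentiable (hu : MemW2Inf u) : Differentiable ℝ u := hu.1.differentiable (by simp)

theorem continuous (hu : MemW2Inf u) : Continuous u := hu.1.continuous

/-- Rademacher's theorem for the Lipschitz gradient. Hessian identities for `W²_∞` functions are
therefore used almost everywhere only. -/
theorem ae_twiceDiffAt (hu : MemW2Inf u) : ∀ᵐ x, TwiceDiffAt u x := by
  obtain ⟨K, hK⟩ := hu.2.2.2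
  filter_upwards [hK.ae_differentiableAt (μ := volume)] with x hx
  exact ⟨hu.differentiable, hx⟩

theorem exists_norm_hessian_le (hu : MemW2Inf u) : ∃ M : ℝ, 0 ≤ M ∧ ∀ x, ‖hessian u x‖ ≤ M := by
  obtain ⟨K, hK⟩ := hu.2.2.2
  exact ⟨K, K.2, fun x => norm_fderiv_le_of_lipschitz ℝ hK⟩

theorem exists_lipschitz (hu : MemW2Inf u) : ∃ K : NNReal, LipschitzWith K u := by
  obtain ⟨M, hM⟩ := hu.2.2.1
  refine ⟨Real.toNNReal M, lipschitzWith_of_nnnorm_fderiv_le hu.differentiable fun x => ?_⟩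
  rw [← NNReal.coe_le_coe, coe_nnnorm]
  exact (hM x).trans (Real.le_coe_toNNReal M)

theorem add (hu : MemW2Inf u) (hw : MemW2Inf w) : MemW2Inf (u + w) := by
  obtain ⟨M₁, h₁⟩ := hu.2.1
  obtain ⟨M₂, h₂⟩ := hw.2.1
  obtain ⟨M₃, h₃⟩ := hu.2.2.1
  obtain ⟨M₄, h₄⟩ := hw.2.2.1
  obtain ⟨K₁, k₁⟩ := hu.2.2.2
  obtain ⟨K₂, k₂⟩ := hw.2.2.2
  refine ⟨hu.1.add hw.1, ⟨M₁ + M₂, fun x => (abs_add_le _ _).trans (add_le_add (h₁ x) (h₂ x))⟩,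
    ⟨M₃ + M₄, fun x => ?_⟩, ⟨K₁ + K₂, ?_⟩⟩
  · rw [fderiv_add_fun hu.differentiable hw.differentiable]
    exact (norm_add_le _ _).trans (add_le_add (h₃ x) (h₄ x))
  · rw [fderiv_add_fun hu.differentiable hw.differentiable]
    exact k₁.add k₂

theorem smul (c : ℝ) (hu : MemW2Inf u) : MemW2Inf (c • u) := by
  obtain ⟨M₁, h₁⟩ := hu.2.1
  obtain ⟨M₃, h₃⟩ := hu.2.2.1
  obtain ⟨K₁, k₁⟩ := hu.2.2.2
  refine ⟨hu.1.const_smul c, ⟨|c| * M₁, fun x => ?_⟩, ⟨|c| * M₃, fun x => ?_⟩, ⟨‖c‖₊ * K₁, ?_⟩⟩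
  · rw [Pi.smul_apply, smul_eq_mul, abs_mul]
    exact mul_le_mul_of_nonneg_left (h₁ x) (abs_nonneg c)
  · rw [fderiv_smul_fun c hu.differentiable, Pi.smul_apply, norm_smul, Real.norm_eq_abs]
    exact mul_le_mul_of_nonneg_left (h₃ x) (abs_nonneg c)
  · rw [fderiv_smul_fun c hu.differentiable]
    exact (lipschitzWith_smul c).comp k₁

theorem zero : MemW2Inf 0 := by
  have h : fderiv ℝ (0 : Plane → ℝ) = fun _ => 0 := by
    funext y; exact fderiv_const_apply (0 : ℝ)
  refine ⟨contDiff_const, ⟨0, by simp⟩, ⟨0, by simp [h]⟩, ⟨0, ?_⟩⟩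
  rw [h]
  exact LipschitzWith.const 0

theorem sum {ι : Type*} (s : Finset ι) {f : ι → Plane → ℝ} (hf : ∀ i ∈ s, MemW2Inf (f i)) :
    MemW2Inf (∑ i ∈ s, f i) := by
  classical
  induction s using Finset.induction_on with
  | empty => simpa using zero
  | insert a s ha ih =>
    rw [Finset.sum_insert ha]
    exact (hf a (Finset.mem_insert_self _ _)).add
      (ih fun i hi => hf i (Finset.mem_insert_of_mem hi))

theorem mul (hu : MemW2Inf u) (hw : MemW2Inf w) : MemW2Inf (fun x => u x * w x) := by
  obtain ⟨M₁, h₁⟩ := hu.2.1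
  obtain ⟨M₂, h₂⟩ := hw.2.1
  obtain ⟨M₃, h₃⟩ := hu.2.2.1
  obtain ⟨M₄, h₄⟩ := hw.2.2.1
  obtain ⟨K₁, k₁⟩ := hu.2.2.2
  obtain ⟨K₂, k₂⟩ := hw.2.2.2
  obtain ⟨L₁, l₁⟩ := hu.exists_lipschitz
  obtain ⟨L₂, l₂⟩ := hw.exists_lipschitz
  have n₁ : 0 ≤ M₁ := (abs_nonneg _).trans (h₁ 0)
  have n₂ : 0 ≤ M₂ := (abs_nonneg _).trans (h₂ 0)
  have hsm : ∀ (f g : Plane → ℝ) (A B : ℝ) (L K : NNReal), (∀ x, |f x| ≤ A) →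
      (∀ x, ‖fderiv ℝ g x‖ ≤ B) → LipschitzWith L f → LipschitzWith K (fderiv ℝ g) →
      LipschitzWith (Real.toNNReal (A * K + B * L)) (fun y => f y • fderiv ℝ g y) := by
    intro f g A B L K hA hB hL hK
    refine LipschitzWith.of_dist_le_mul fun x y => ?_
    have e : f x • fderiv ℝ g x - f y • fderiv ℝ g y =
        f x • (fderiv ℝ g x - fderiv ℝ g y) + (f x - f y) • fderiv ℝ g y := by
      rw [smul_sub, sub_smul]; abel
    have d1 := hL.dist_le_mul x y
    have d2 := hK.dist_le_mul x y
    rw [Real.dist_eq] at d1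
    rw [dist_eq_norm] at d2
    rw [dist_eq_norm, e]
    refine (norm_add_le _ _).trans ?_
    rw [norm_smul, norm_smul, Real.norm_eq_abs, Real.norm_eq_abs]
    have i1 : |f x| * ‖fderiv ℝ g x - fderiv ℝ g y‖ ≤ A * (K * dist x y) :=
      mul_le_mul (hA x) d2 (norm_nonneg _) ((abs_nonneg _).trans (hA x))
    have i2 : |f x - f y| * ‖fderiv ℝ g y‖ ≤ (L * dist x y) * B :=
      mul_le_mul d1 (hB y) (norm_nonneg _) (by positivity)
    have i3 : (A * K + B * L) * dist x y ≤ (Real.toNNReal (A * K + B * L)) * dist x y :=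
      mul_le_mul_of_nonneg_right (Real.le_coe_toNNReal _) dist_nonneg
    nlinarith
  refine ⟨hu.1.mul hw.1, ⟨M₁ * M₂, fun x => ?_⟩, ⟨M₁ * M₄ + M₂ * M₃, fun x => ?_⟩, ?_⟩
  · rw [abs_mul]
    exact mul_le_mul (h₁ x) (h₂ x) (abs_nonneg _) n₁
  · rw [fderiv_mul_fun hu.differentiable hw.differentiable]
    refine (norm_add_le _ _).trans ?_
    rw [norm_smul, norm_smul]
    exact add_le_add (mul_le_mul (h₁ x) (h₄ x) (norm_nonneg _) n₁)
      (mul_le_mul (h₂ x) (h₃ x) (norm_nonneg _) n₂)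
  · rw [fderiv_mul_fun hu.differentiable hw.differentiable]
    exact ⟨_, (hsm u w M₁ M₄ L₁ K₂ h₁ h₄ l₁ k₂).add (hsm w u M₂ M₃ L₂ K₁ h₂ h₃ l₂ k₁)⟩

theorem of_contDiff_hasCompactSupport (hu : ContDiff ℝ ∞ u) (hc : HasCompactSupport u) :
    MemW2Inf u := by
  have h1 : ContDiff ℝ 1 (fderiv ℝ u) := hu.fderiv_right two_le_infty
  obtain ⟨M₁, h₁⟩ := hu.continuous.bounded_above_of_compact_support hc
  obtain ⟨M₂, h₂⟩ := h1.continuous.bounded_above_of_compact_support (hc.fderiv (𝕜 := ℝ))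
  obtain ⟨K, hK⟩ := h1.lipschitzWith_of_hasCompactSupport (hc.fderiv (𝕜 := ℝ)) (by simp)
  exact ⟨hu.of_le (by simp), ⟨M₁, h₁⟩, ⟨M₂, h₂⟩, ⟨K, hK⟩⟩

/-- A function of class `W²_∞` with compact support may be multiplied by any smooth function. -/
theorem mul_contDiff (hu : MemW2Inf u) (hc : HasCompactSupport u) (hw : ContDiff ℝ ∞ w) :
    MemW2Inf (fun x => u x * w x) := by
  obtain ⟨R, hR, hsub⟩ : ∃ R : ℝ, 0 < R ∧ tsupport u ⊆ Metric.closedBall 0 R :=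
    hc.isCompact.isBounded.subset_closedBall_lt 0 0
  -- The bump is one on the support of `u`, so replacing `w` by `χ w` changes nothing in the product
  -- and makes the second factor compactly supported.
  let χ : ContDiffBump (0 : Plane) := ⟨R, R + 1, hR, by linarith⟩
  have h : (fun x => u x * w x) = fun x => u x * (χ x * w x) := by
    funext x
    by_cases hx : x ∈ tsupport u
    · rw [χ.one_of_mem_closedBall (hsub hx), one_mul]
    · rw [image_eq_zero_of_notMem_tsupport hx, zero_mul, zero_mul]
  rw [h]
  exact hu.mul (of_contDiff_hasCompactSupport (χ.contDiff.mul hw) χ.hasCompactSupport.mul_right)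

/-- The zero extension of a function whose value and gradient vanish on the boundary. -/
theorem indicator {Ω : Set Plane} (hΩ : IsOpen Ω) (hu : MemW2Inf u)
    (h0 : ∀ x ∈ frontier Ω, u x = 0 ∧ fderiv ℝ u x = 0) : MemW2Inf (Ω.indicator u) := by
  obtain ⟨M₁, h₁⟩ := hu.2.1
  obtain ⟨M₃, h₃⟩ := hu.2.2.1
  obtain ⟨K, hK⟩ := hu.2.2.2
  have hder : ∀ x, HasFDerivAt (Ω.indicator u) (Ω.indicator (fderiv ℝ u) x) x := by
    intro x
    by_cases hx : x ∈ Ω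
    · rw [indicator_of_mem hx]
      refine (hu.differentiable x).hasFDerivAt.congr_of_eventuallyEq ?_
      filter_upwards [hΩ.mem_nhds hx] with y hy using indicator_of_mem hy u
    rw [indicator_of_notMem hx]
    by_cases hx' : x ∈ closure Ω
    · have hf := h0 x ⟨hx', by rwa [hΩ.interior_eq]⟩
      have hd := (hu.differentiable x).hasFDerivAt
      rw [hf.2] at hd
      -- At a boundary point the extension is dominated by `|u|`, which is of smaller order than the
      -- increment because value and gradient of `u` vanish there.
      rw [hasFDerivAt_iff_isLittleO_nhds_zero] at hd ⊢
      refine Asymptotics.IsBigO.trans_isLittleO ?_ hd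
      refine Asymptotics.IsBigO.of_bound 1 (Filter.Eventually.of_forall fun y => ?_)
      simp only [indicator_of_notMem hx, hf.1, _root_.zero_apply, sub_zero, one_mul]
      by_cases hy : x + y ∈ Ω
      · rw [indicator_of_mem hy]
      · rw [indicator_of_notMem hy, norm_zero]; exact norm_nonneg _
    · refine (hasFDerivAt_const (0 : ℝ) x).congr_of_eventuallyEq ?_
      filter_upwards [isClosed_closure.isOpen_compl.mem_nhds hx'] with y hy
      exact indicator_of_notMem (fun h => hy (subset_closure h)) u
  have hfd : fderiv ℝ (Ω.indicator u) = Ω.indicator (fderiv ℝ u) := funext fun x => (hder x).fderiv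
  -- Between a point inside and one outside, the gradient is compared with its zero value at a
  -- boundary point of the segment, so the Lipschitz constant is not increased.
  have hcross : ∀ x y, x ∈ Ω → y ∉ Ω → ‖fderiv ℝ u x‖ ≤ K * dist x y := by
    intro x y hx hy
    obtain ⟨z, hz, hzf⟩ := exists_mem_segment_frontier hΩ hx hy
    have h1 := hK.dist_le_mul x z
    rw [(h0 z hzf).2, dist_zero_right] at h1
    refine h1.trans (mul_le_mul_of_nonneg_left ?_ K.2)
    have := dist_add_dist_of_mem_segment hz
    linarith [dist_nonneg (x := z) (y := y)]
  have hLip : LipschitzWith K (fderiv ℝ (Ω.indicator u)) := by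
    refine LipschitzWith.of_dist_le_mul fun x y => ?_
    rw [hfd]
    by_cases hx : x ∈ Ω <;> by_cases hy : y ∈ Ω <;> simp only [hx, hy, indicator_of_mem,
      indicator_of_notMem, not_false_eq_true]
    · exact hK.dist_le_mul x y
    · rw [dist_zero_right]; exact hcross x y hx hy
    · rw [dist_zero_left, dist_comm]; exact hcross y x hy hx
    · rw [dist_self]; positivity
  refine ⟨?_, ⟨M₁, fun x => ?_⟩, ⟨M₃, fun x => ?_⟩, ⟨K, hLip⟩⟩
  · rw [contDiff_one_iff_fderiv]
    exact ⟨fun x => (hder x).differentiableAt, hLip.continuous⟩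
  · by_cases hx : x ∈ Ω
    · rw [indicator_of_mem hx]; exact h₁ x
    · rw [indicator_of_notMem hx, abs_zero]; exact (abs_nonneg _).trans (h₁ x)
  · rw [hfd]
    by_cases hx : x ∈ Ω
    · rw [indicator_of_mem hx]; exact h₃ x
    · rw [indicator_of_notMem hx, norm_zero]; exact (norm_nonneg _).trans (h₃ x)

end MemW2Inf

/-! ### Weak derivatives of Lipschitz functions -/

theorem integrable_mul_of_compactSupport {U : Set Plane} {g η : Plane → ℝ}
    (hg : LocallyIntegrableOn g U) (hη : Continuous η) (hc : HasCompactSupport η)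
    (hs : tsupport η ⊆ U) : Integrable fun x => g x * η x := by
  have h1 : IntegrableOn g (tsupport η) := hg.integrableOn_compact_subset hs hc.isCompact
  obtain ⟨M, hM⟩ := hη.bounded_above_of_compact_support hc
  have h2 : IntegrableOn (fun x => g x * η x) (tsupport η) :=
    Integrable.mul_bdd h1 hη.aestronglyMeasurable (Filter.Eventually.of_forall hM)
  refine (integrableOn_iff_integrable_of_support_subset fun x hx => ?_).1 h2
  by_contra h
  exact hx (by simp [image_eq_zero_of_notMem_tsupport h])

/-- The fundamental lemma of the calculus of variations, applied to `g - g'`. -/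
theorem IsWeakPartial.ae_unique {U : Set Plane} (hU : IsOpen U) {i : Fin 2} {f g g' : Plane → ℝ}
    (hg : IsWeakPartial U i f g) (hg' : IsWeakPartial U i f g') : g =ᵐ[volume.restrict U] g' := by
  have h := hU.ae_eq_zero_of_integral_contDiff_smul_eq_zero (hg.2.1.sub hg'.2.1) (μ := volume) ?_
  · rw [Filter.EventuallyEq, ae_restrict_iff' hU.measurableSet]
    filter_upwards [h] with x hx hxU
    exact sub_eq_zero.1 (hx hxU)
  intro η hη hc hs
  have e1 := hg.2.2 η hη hc hs
  have e2 := hg'.2.2 η hη hc hs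
  have i1 := integrable_mul_of_compactSupport hg.2.1 hη.continuous hc hs
  have i2 := integrable_mul_of_compactSupport hg'.2.1 hη.continuous hc hs
  have hz : ∀ x ∉ U, η x = 0 := fun x hx => image_eq_zero_of_notMem_tsupport fun h => hx (hs h)
  rw [e1, neg_inj, setIntegral_eq_integral_of_forall_compl_eq_zero (fun x hx => by simp [hz x hx]),
    setIntegral_eq_integral_of_forall_compl_eq_zero (fun x hx => by simp [hz x hx])] at e2
  calc ∫ x, η x • (g - g') x = ∫ x, (g x * η x - g' x * η x) := by
        congr 1; funext x; simp only [Pi.sub_apply, smul_eq_mul]; ring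
    _ = 0 := by rw [integral_sub i1 i2, e2, sub_self]

theorem IsWeakPartial.congr {U : Set Plane} {i : Fin 2} {f f' g : Plane → ℝ}
    (h : f =ᵐ[volume.restrict U] f') (hg : IsWeakPartial U i f g) : IsWeakPartial U i f' g := by
  refine ⟨hg.1.congr h, hg.2.1, fun η hη hc hs => ?_⟩
  rw [← hg.2.2 η hη hc hs]
  refine integral_congr_ae ?_
  filter_upwards [h] with x hx
  rw [hx]

theorem weakPartial_ae_eq {U : Set Plane} (hU : IsOpen U) {i : Fin 2} {f g : Plane → ℝ}
    (hg : IsWeakPartial U i f g) : weakPartial U i f =ᵐ[volume.restrict U] g := by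
  have hex : ∃ g, IsWeakPartial U i f g := ⟨g, hg⟩
  rw [weakPartial, dif_pos hex]
  exact hex.choose_spec.ae_unique hU hg

/-- Rademacher's theorem together with integration by parts for Lipschitz functions. The test
function is supported in `U`, so integrals over `U` and over the plane agree. -/
theorem LipschitzWith.isWeakPartial {U : Set Plane} {i : Fin 2} {f : Plane → ℝ}
    {K : NNReal} (hf : LipschitzWith K f) :
    IsWeakPartial U i f fun x => fderiv ℝ f x (dir i) := by
  have hae : (fun x => lineDeriv ℝ f x (dir i)) =ᵐ[volume] fun x => fderiv ℝ f x (dir i) := by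
    filter_upwards [hf.ae_differentiableAt (μ := volume)] with x hx
    exact hx.lineDeriv_eq_fderiv
  refine ⟨(hf.continuous.locallyIntegrable).locallyIntegrableOn U,
    ((hf.locallyIntegrable_lineDeriv (μ := volume) (dir i)).locallyIntegrableOn U).congr
      (ae_restrict_of_ae hae), fun η hη hc hs => ?_⟩
  obtain ⟨D, hD⟩ := ContDiff.lipschitzWith_of_hasCompactSupport hc hη (by simp)
  have key := hf.integral_lineDeriv_mul_eq (μ := volume) hD hc (dir i)
  have hz : ∀ x ∉ U, η x = 0 := fun x hx => image_eq_zero_of_notMem_tsupport fun h => hx (hs h)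
  have hz' : ∀ x ∉ U, fderiv ℝ η x = 0 := fun x hx => by
    by_contra hne
    exact hx (hs (support_fderiv_subset ℝ hne))
  rw [setIntegral_eq_integral_of_forall_compl_eq_zero (fun x hx => by simp [hz' x hx]),
    setIntegral_eq_integral_of_forall_compl_eq_zero (fun x hx => by simp [hz x hx])]
  have e1 : ∫ x, lineDeriv ℝ f x (dir i) * η x = ∫ x, fderiv ℝ f x (dir i) * η x :=
    integral_congr_ae (by filter_upwards [hae] with x hx; rw [hx])
  rw [← e1, key, ← integral_neg]
  congr 1
  funext x
  rw [((hη.differentiable (by simp)) x).lineDeriv_eq_fderiv, map_neg]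
  ring

/-! ### The plate form in terms of classical second derivatives -/

/-- The Frobenius inner product of the Hessians of `v` and `w`. -/
noncomputable def hessInner (v w : Plane → ℝ) (x : Plane) : ℝ :=
  ∑ i : Fin 2, ∑ j : Fin 2, hessian v x (dir i) (dir j) * hessian w x (dir i) (dir j)

theorem hessInner_self (v : Plane → ℝ) (x : Plane) : hessInner v v x = hessSq v x := by
  simp only [hessInner, hessSq, sq]

theorem MemW2Inf.lipschitz_partial {v : Plane → ℝ} (hv : MemW2Inf v) (e : Plane) :
    ∃ K : NNReal, LipschitzWith K fun x => fderiv ℝ v x e := by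
  obtain ⟨K, hK⟩ := hv.2.2.2
  exact ⟨_, (ContinuousLinearMap.apply ℝ ℝ e).lipschitz.comp hK⟩

theorem fderiv_partial_eq_hessian {v : Plane → ℝ} {x : Plane} (hx : TwiceDiffAt v x)
    (e e' : Plane) : fderiv ℝ (fun y => fderiv ℝ v y e) x e' = hessian v x e' e := by
  have := ((ContinuousLinearMap.apply ℝ ℝ e).hasFDerivAt.comp x hx.2.hasFDerivAt).fderiv
  have h2 : (fun y => fderiv ℝ v y e) = (ContinuousLinearMap.apply ℝ ℝ e) ∘ fderiv ℝ v := rfl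
  rw [h2, this]
  rfl

/-- The inner weak derivative is an arbitrary representative. It is first exchanged almost
everywhere for the classical one, which is Lipschitz and can be differentiated again. -/
theorem MemW2Inf.weakPartial_weakPartial {Ω : Set Plane} (hΩ : IsOpen Ω) {v : Plane → ℝ}
    (hv : MemW2Inf v) (i j : Fin 2) : weakPartial Ω i (weakPartial Ω j v)
      =ᵐ[volume.restrict Ω] fun x => hessian v x (dir i) (dir j) := by
  obtain ⟨K, hK⟩ := hv.exists_lipschitz
  obtain ⟨K', hK'⟩ := hv.lipschitz_partial (dir j)
  have h1 := weakPartial_ae_eq hΩ (hK.isWeakPartial (U := Ω) (i := j))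
  have h2 := weakPartial_ae_eq hΩ ((hK'.isWeakPartial (U := Ω) (i := i)).congr h1.symm)
  filter_upwards [h2, ae_restrict_of_ae hv.ae_twiceDiffAt] with x hx hx'
  rw [hx, fderiv_partial_eq_hessian hx']

theorem plateForm_eq {Ω : Set Plane} (hΩ : IsOpen Ω) {v w : Plane → ℝ} (hv : MemW2Inf v)
    (hw : MemW2Inf w) : plateForm Ω v w = ∫ x in Ω, hessInner v w x := by
  refine integral_congr_ae ?_
  have h1 : ∀ᵐ x ∂volume.restrict Ω, ∀ i j, weakPartial Ω i (weakPartial Ω j v) x =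
      hessian v x (dir i) (dir j) :=
    ae_all_iff.2 fun i => ae_all_iff.2 fun j => hv.weakPartial_weakPartial hΩ i j
  have h2 : ∀ᵐ x ∂volume.restrict Ω, ∀ i j, weakPartial Ω i (weakPartial Ω j w) x =
      hessian w x (dir i) (dir j) :=
    ae_all_iff.2 fun i => ae_all_iff.2 fun j => hw.weakPartial_weakPartial hΩ i j
  filter_upwards [h1, h2] with x hx hx'
  simp only [hx, hx', hessInner]

theorem measurable_hessInner (v w : Plane → ℝ) : Measurable (hessInner v w) :=
  Finset.measurable_sum _ fun _ _ => Finset.measurable_sum _ fun _ _ =>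
    (measurable_hessian_apply v _ _).mul (measurable_hessian_apply w _ _)

theorem abs_hessian_dir_le (v : Plane → ℝ) (x : Plane) (i j : Fin 2) :
    |hessian v x (dir i) (dir j)| ≤ ‖hessian v x‖ := by
  have := (hessian v x).le_opNorm₂ (dir i) (dir j)
  simpa only [PiLp.norm_single, norm_one, mul_one, Real.norm_eq_abs] using this

theorem MemW2Inf.integrableOn_hessInner {v w : Plane → ℝ} (hv : MemW2Inf v) (hw : MemW2Inf w)
    {U : Set Plane} (hU : volume U < ⊤) : IntegrableOn (hessInner v w) U := by
  obtain ⟨M, hM0, hM⟩ := hv.exists_norm_hessian_le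
  obtain ⟨M', hM0', hM'⟩ := hw.exists_norm_hessian_le
  refine Measure.integrableOn_of_bounded (M := 4 * (M * M')) hU.ne
    (measurable_hessInner v w).aestronglyMeasurable (Filter.Eventually.of_forall fun x => ?_)
  rw [Real.norm_eq_abs, hessInner]
  have h : ∀ i j, |hessian v x (dir i) (dir j) * hessian w x (dir i) (dir j)| ≤ M * M' := by
    intro i j
    rw [abs_mul]
    exact mul_le_mul ((abs_hessian_dir_le v x i j).trans (hM x))
      ((abs_hessian_dir_le w x i j).trans (hM' x)) (abs_nonneg _) hM0
  simp only [Fin.sum_univ_two]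
  rw [abs_le]
  constructor <;> linarith [abs_le.1 (h 0 0), abs_le.1 (h 0 1), abs_le.1 (h 1 0), abs_le.1 (h 1 1)]

theorem MemW2Inf.integrableOn_hessSq {v : Plane → ℝ} (hv : MemW2Inf v)
    {U : Set Plane} (hU : volume U < ⊤) : IntegrableOn (hessSq v) U := by
  have := hv.integrableOn_hessInner hv hU
  rwa [show hessInner v v = hessSq v from funext (hessInner_self v)] at this

theorem plateForm_comm (Ω : Set Plane) (v w : Plane → ℝ) : plateForm Ω v w = plateForm Ω w v := by
  simp only [plateForm, mul_comm]

theorem plateForm_self {Ω : Set Plane} (hΩ : IsOpen Ω) {v : Plane → ℝ} (hv : MemW2Inf v) :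
    plateForm Ω v v = ∫ x in Ω, hessSq v x := by
  rw [plateForm_eq hΩ hv hv]
  simp only [hessInner_self]

theorem plateForm_add_left {Ω : Set Plane} (hΩ : IsOpen Ω) (hfin : volume Ω < ⊤)
    {u v w : Plane → ℝ} (hu : MemW2Inf u) (hv : MemW2Inf v) (hw : MemW2Inf w) :
    plateForm Ω (u + v) w = plateForm Ω u w + plateForm Ω v w := by
  rw [plateForm_eq hΩ (hu.add hv) hw, plateForm_eq hΩ hu hw, plateForm_eq hΩ hv hw,
    ← integral_add (hu.integrableOn_hessInner hw hfin) (hv.integrableOn_hessInner hw hfin)]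
  refine integral_congr_ae (ae_restrict_of_ae ?_)
  filter_upwards [hu.ae_twiceDiffAt, hv.ae_twiceDiffAt] with x hx hx'
  simp only [hessInner, hessian_add hx hx', _root_.add_apply, add_mul, Finset.sum_add_distrib]

theorem plateForm_smul_left {Ω : Set Plane} (hΩ : IsOpen Ω) (c : ℝ)
    {u w : Plane → ℝ} (hu : MemW2Inf u) (hw : MemW2Inf w) :
    plateForm Ω (c • u) w = c * plateForm Ω u w := by
  rw [plateForm_eq hΩ (hu.smul c) hw, plateForm_eq hΩ hu hw, ← integral_const_mul]
  refine integral_congr_ae (ae_restrict_of_ae ?_)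
  filter_upwards [hu.ae_twiceDiffAt] with x hx
  simp only [hessInner, hessian_smul c hx, _root_.smul_apply, smul_eq_mul, mul_assoc,
    Finset.mul_sum]

/-! ### Affine approximation on balls -/

theorem norm_hessian_nonneg (u : Plane → ℝ) (x : Plane) : 0 ≤ ‖hessian u x‖ :=
  (hessian u x).opNorm_nonneg

theorem sq_integral_le {α : Type*} [MeasurableSpace α] {μ : Measure α} [IsFiniteMeasure μ]
    {f : α → ℝ} (hf : Integrable f μ) (hf2 : Integrable (fun x => f x ^ 2) μ) :
    (∫ x, f x ∂μ) ^ 2 ≤ μ.real univ * ∫ x, f x ^ 2 ∂μ := by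
  set m := μ.real univ with hm
  set A := ∫ x, f x ∂μ with hA
  have hm0 : 0 ≤ m := measureReal_nonneg
  -- Nonnegativity of the variance of `f`, scaled by `m` so that no division by the possibly zero
  -- mass is needed.
  have h0 : 0 ≤ ∫ x, (m * f x - A) ^ 2 ∂μ := integral_nonneg fun x => sq_nonneg _
  have h1 : ∫ x, (m * f x - A) ^ 2 ∂μ = m * (m * (∫ x, f x ^ 2 ∂μ) - A ^ 2) := by
    have e : (fun x => (m * f x - A) ^ 2) = fun x => m ^ 2 * f x ^ 2 - 2 * m * A * f x + A ^ 2 := by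
      funext x; ring
    have i1 : Integrable (fun x => m ^ 2 * f x ^ 2) μ := hf2.const_mul _
    have i2 : Integrable (fun x => 2 * m * A * f x) μ := hf.const_mul _
    have i3 : Integrable (fun x => m ^ 2 * f x ^ 2 - 2 * m * A * f x) μ := i1.sub i2
    rw [e, integral_add i3 (integrable_const _), integral_sub i1 i2, integral_const_mul, integral_const_mul,
      integral_const, smul_eq_mul, ← hm, ← hA]
    ring
  rcases hm0.eq_or_lt with h | h
  · have hz : μ = 0 := by
      rw [← Measure.measure_univ_eq_zero]
      exact (measureReal_eq_zero_iff (measure_ne_top μ univ)).1 (hm.symm.trans h.symm)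
    have : A = 0 := by rw [hA, hz, integral_zero_measure]
    rw [this, ← h]; simp
  · rw [h1] at h0
    nlinarith [nonneg_of_mul_nonneg_right h0 h]

/-- Homotheties map null sets to null sets. This provides second derivatives at `x + s (y - x)` for
almost every `y`. -/
theorem ae_comp_homothety {P : Plane → Prop} (hP : ∀ᵐ z, P z) (x : Plane) {s : ℝ} (hs : s ≠ 0) :
    ∀ᵐ y : Plane, P (x + s • (y - x)) := by
  rw [ae_iff] at hP ⊢
  have e : {y : Plane | ¬ P (x + s • (y - x))} = AffineMap.homothety x s⁻¹ '' {z | ¬ P z} := by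
    ext y
    simp only [mem_ofPred_eq, mem_image, AffineMap.homothety_apply, vsub_eq_sub, vadd_eq_add]
    constructor
    · intro h
      refine ⟨x + s • (y - x), h, ?_⟩
      rw [add_sub_cancel_left, smul_smul, inv_mul_cancel₀ hs, one_smul, sub_add_cancel]
    · rintro ⟨z, hz, rfl⟩
      rw [add_sub_cancel_right, smul_smul, mul_inv_cancel₀ hs, one_smul, add_sub_cancel]
      exact hz
  rw [e, Measure.addHaar_image_homothety, hP, mul_zero]

theorem integral_comp_homothety (f : Plane → ℝ) (x : Plane) (s : ℝ) :
    ∫ y : Plane, f (x + s • (y - x)) = (s ^ 2)⁻¹ * ∫ y, f y := by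
  have h1 := integral_sub_right_eq_self (μ := volume) (fun y : Plane => f (x + s • y)) x
  have h2 := Measure.integral_comp_smul (volume : Measure Plane) (fun y => f (x + y)) s
  have h3 := integral_add_left_eq_self (μ := volume) f x
  rw [h1, h2, h3, finrank_euclideanSpace_fin, smul_eq_mul, abs_of_nonneg (by positivity)]

theorem integrable_comp_homothety {f : Plane → ℝ} (hf : Integrable f) (x : Plane) {s : ℝ}
    (hs : s ≠ 0) : Integrable fun y : Plane => f (x + s • (y - x)) :=
  (((hf.comp_add_left x).comp_smul hs).comp_sub_right x)

theorem volume_ball_real (c : Plane) {R : ℝ} (hR : 0 ≤ R) :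
    volume.real (Metric.ball c R) = Real.pi * R ^ 2 := by
  rw [measureReal_def, EuclideanSpace.volume_ball_fin_two, ENNReal.toReal_mul, ENNReal.toReal_pow,
    ENNReal.toReal_ofReal hR, ENNReal.toReal_ofReal Real.pi_pos.le, mul_comm]

theorem homothety_mem_ball {c x y : Plane} {R s : ℝ} (hx : x ∈ Metric.ball c R)
    (hy : y ∈ Metric.ball c R) (hs : s ∈ Icc (0 : ℝ) 1) : x + s • (y - x) ∈ Metric.ball c R :=
  (convex_ball c R).add_smul_sub_mem hx hy hs

/-- Cauchy–Schwarz produces the root of the volume. In the plane the substitution `z = x + s (y -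
x)` produces `s⁻²` under the other root, which the factor `s` cancels exactly, so the bound is
uniform as `s → 0`. The contracted ball stays in the ball by convexity. -/
theorem integral_norm_hessian_homothety_le {u : Plane → ℝ} (hu : MemW2Inf u) {c x : Plane}
    {R s : ℝ} (hx : x ∈ Metric.ball c R) (hs : 0 < s) (hs1 : s ≤ 1) :
    s * ∫ y in Metric.ball c R, ‖hessian u (x + s • (y - x))‖ ≤
      √(volume.real (Metric.ball c R)) * √(∫ y in Metric.ball c R, hessSq u y) := by
  obtain ⟨M, hM0, hM⟩ := hu.exists_norm_hessian_le
  have hfin : volume (Metric.ball c R) < ⊤ := measure_ball_lt_top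
  have : IsFiniteMeasure (volume.restrict (Metric.ball c R)) := ⟨by simpa using hfin⟩
  have hmeas : Measurable fun y : Plane => ‖hessian u (x + s • (y - x))‖ :=
    ((measurable_fderiv ℝ (fderiv ℝ u)).comp (by fun_prop)).norm
  have i1 : IntegrableOn (fun y : Plane => ‖hessian u (x + s • (y - x))‖) (Metric.ball c R) :=
    Measure.integrableOn_of_bounded (M := M) hfin.ne hmeas.aestronglyMeasurable
      (Filter.Eventually.of_forall fun y => by
          rw [Real.norm_of_nonneg (norm_hessian_nonneg u _)]; exact hM _)
  have i2 : IntegrableOn (fun y : Plane => ‖hessian u (x + s • (y - x))‖ ^ 2)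
      (Metric.ball c R) :=
    Measure.integrableOn_of_bounded (M := M ^ 2) hfin.ne (hmeas.pow_const 2).aestronglyMeasurable
      (Filter.Eventually.of_forall fun y => by
        rw [Real.norm_of_nonneg (by positivity)]; exact pow_le_pow_left₀ (norm_hessian_nonneg u _) (hM _) 2)
  have hcs := sq_integral_le i1 i2
  have hint : Integrable ((Metric.ball c R).indicator (hessSq u)) :=
    (integrable_indicator_iff measurableSet_ball).2 (hu.integrableOn_hessSq hfin)
  have hle : ∫ y in Metric.ball c R, ‖hessian u (x + s • (y - x))‖ ^ 2 ≤
      (s ^ 2)⁻¹ * ∫ y in Metric.ball c R, hessSq u y := by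
    rw [← integral_indicator (f := hessSq u) measurableSet_ball, ← integral_comp_homothety _ x s]
    rw [← integral_indicator measurableSet_ball]
    refine integral_mono ((integrable_indicator_iff measurableSet_ball).2 i2)
      (integrable_comp_homothety hint x hs.ne') fun y => ?_
    by_cases hy : y ∈ Metric.ball c R
    · simp only [indicator_of_mem hy,
        indicator_of_mem (homothety_mem_ball hx hy ⟨hs.le, hs1⟩)]
      exact norm_hessian_sq_le _ _
    · simp only [indicator_of_notMem hy]
      exact indicator_nonneg (fun z _ => hessSq_nonneg u z) _
  rw [← Real.sqrt_mul measureReal_nonneg]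
  refine Real.le_sqrt_of_sq_le ?_
  rw [measureReal_restrict_apply_univ] at hcs
  calc (s * ∫ y in Metric.ball c R, ‖hessian u (x + s • (y - x))‖) ^ 2
      ≤ s ^ 2 * (volume.real (Metric.ball c R) * ((s ^ 2)⁻¹ * ∫ y in Metric.ball c R,
          hessSq u y)) := by
        rw [mul_pow]
        refine mul_le_mul_of_nonneg_left (hcs.trans ?_) (by positivity)
        exact mul_le_mul_of_nonneg_left hle measureReal_nonneg
    _ = _ := by field_simp

/-- The affine Taylor polynomial of `u` at `x + s (y - x)`, evaluated at `x`. -/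
noncomputable def taylorValue (u : Plane → ℝ) (x : Plane) (s : ℝ) (y : Plane) : ℝ :=
  u (x + s • (y - x)) - s * fderiv ℝ u (x + s • (y - x)) (y - x)

/-- The two first-order terms cancel, leaving only the Hessian with a factor `s`. -/
theorem hasDerivAt_taylorValue {u : Plane → ℝ} {x y : Plane} {s : ℝ}
    (h : TwiceDiffAt u (x + s • (y - x))) :
    HasDerivAt (fun t => taylorValue u x t y)
      (-(s * hessian u (x + s • (y - x)) (y - x) (y - x))) s := by
  have hz : HasDerivAt (fun t : ℝ => x + t • (y - x)) (y - x) s := by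
    simpa using ((hasDerivAt_id s).smul_const (y - x)).const_add x
  have h1 := (h.1 _).hasFDerivAt.comp_hasDerivAt s hz
  have h2 := h.2.hasFDerivAt.comp_hasDerivAt s hz
  have h3 := (ContinuousLinearMap.apply ℝ ℝ (y - x)).hasFDerivAt.comp_hasDerivAt s h2
  have h4 := h1.sub ((hasDerivAt_id s).mul h3)
  refine h4.congr_deriv ?_
  simp only [hessian, Function.comp_apply, ContinuousLinearMap.apply_apply, id_eq, one_mul]
  ring

/-- A Lipschitz constant in `t` that is uniform in `x` and `y` is the domination needed to
differentiate the average under the integral sign. -/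
theorem MemW2Inf.exists_lipschitzOn_taylorValue {u : Plane → ℝ} (hu : MemW2Inf u) (d S : ℝ) :
    ∃ b : ℝ, ∀ x y : Plane, dist y x ≤ d →
      LipschitzOnWith (Real.nnabs b) (fun t => taylorValue u x t y) (Icc (-S) S) := by
  obtain ⟨M, hM⟩ := hu.2.2.1
  obtain ⟨K, hK⟩ := hu.2.2.2
  obtain ⟨L, hL⟩ := hu.exists_lipschitz
  have hM0 : 0 ≤ M := (norm_nonneg _).trans (hM 0)
  refine ⟨L * d + (M * d + S * (K * d) * d), fun x y hxy => ?_⟩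
  refine LipschitzOnWith.of_dist_le_mul fun s hs t ht => ?_
  have hd0 : 0 ≤ d := dist_nonneg.trans hxy
  have hS0 : 0 ≤ S := by linarith [hs.1, hs.2]
  have hn : ‖y - x‖ ≤ d := by rwa [← dist_eq_norm]
  have hz : dist (x + s • (y - x)) (x + t • (y - x)) ≤ d * dist s t := by
    rw [dist_add_left, dist_eq_norm, ← sub_smul, norm_smul, Real.dist_eq, Real.norm_eq_abs, mul_comm]
    exact mul_le_mul_of_nonneg_right hn (abs_nonneg _)
  have d1 : |u (x + s • (y - x)) - u (x + t • (y - x))| ≤ L * (d * dist s t) := by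
    rw [← Real.dist_eq]
    exact (hL.dist_le_mul _ _).trans (mul_le_mul_of_nonneg_left hz L.2)
  have d2 : ‖fderiv ℝ u (x + s • (y - x)) - fderiv ℝ u (x + t • (y - x))‖ ≤ K * (d * dist s t) := by
    rw [← dist_eq_norm]
    exact (hK.dist_le_mul _ _).trans (mul_le_mul_of_nonneg_left hz K.2)
  have d3 : |(fderiv ℝ u (x + s • (y - x)) - fderiv ℝ u (x + t • (y - x))) (y - x)| ≤
      K * (d * dist s t) * d :=
    (ContinuousLinearMap.le_opNorm _ _).trans (mul_le_mul d2 hn (norm_nonneg _) (by positivity))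
  have d4 : |fderiv ℝ u (x + s • (y - x)) (y - x)| ≤ M * d :=
    (ContinuousLinearMap.le_opNorm _ _).trans (mul_le_mul (hM _) hn (norm_nonneg _) hM0)
  rw [_root_.sub_apply] at d3
  have e : taylorValue u x s y - taylorValue u x t y =
      (u (x + s • (y - x)) - u (x + t • (y - x))) -
      ((s - t) * fderiv ℝ u (x + s • (y - x)) (y - x) +
        t * (fderiv ℝ u (x + s • (y - x)) (y - x) - fderiv ℝ u (x + t • (y - x)) (y - x))) := by
    unfold taylorValue; ring
  have ht' : |t| ≤ S := abs_le.2 ht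
  rw [Real.dist_eq, e, Real.coe_nnabs]
  have f1 := abs_sub (u (x + s • (y - x)) - u (x + t • (y - x)))
    ((s - t) * fderiv ℝ u (x + s • (y - x)) (y - x) +
        t * (fderiv ℝ u (x + s • (y - x)) (y - x) - fderiv ℝ u (x + t • (y - x)) (y - x)))
  have f2 := abs_add_le ((s - t) * fderiv ℝ u (x + s • (y - x)) (y - x))
    (t * (fderiv ℝ u (x + s • (y - x)) (y - x) - fderiv ℝ u (x + t • (y - x)) (y - x)))
  rw [abs_mul, abs_mul] at f2
  have f3 : |s - t| * |fderiv ℝ u (x + s • (y - x)) (y - x)| ≤ dist s t * (M * d) := by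
    rw [← Real.dist_eq]; exact mul_le_mul_of_nonneg_left d4 dist_nonneg
  have f4 := mul_le_mul ht' d3 (abs_nonneg _) hS0
  have hb0 : 0 ≤ L * d + (M * d + S * (K * d) * d) := by positivity
  rw [abs_of_nonneg hb0]
  linarith

theorem MemW2Inf.continuous_taylorValue {u : Plane → ℝ} (hu : MemW2Inf u) (x : Plane) (s : ℝ) :
    Continuous fun y => taylorValue u x s y := by
  have h1 : Continuous fun y : Plane => x + s • (y - x) := by fun_prop
  exact (hu.continuous.comp h1).sub (continuous_const.mul
    (((hu.1.continuous_fderiv (by simp)).comp h1).clm_apply (by fun_prop)))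

/-- Averaged Taylor polynomials approximate a function of class `W²_∞`, with an error controlled
by the `L₂` norm of the second derivatives. -/
theorem abs_sub_integral_taylorValue_le {u : Plane → ℝ} (hu : MemW2Inf u) {c x : Plane}
    {R : ℝ} (hR : 0 < R) (hx : x ∈ Metric.ball c R) :
    |(∫ y in Metric.ball c R, taylorValue u x 1 y) - volume.real (Metric.ball c R) * u x| ≤
      (2 * R) ^ 2 * (√(volume.real (Metric.ball c R)) *
        √(∫ y in Metric.ball c R, hessSq u y)) := by
  set B := Metric.ball c R with hB
  have hfin : volume B < ⊤ := measure_ball_lt_top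
  have hfm : IsFiniteMeasure (volume.restrict B) := ⟨by simpa using hfin⟩
  obtain ⟨b, hb⟩ := hu.exists_lipschitzOn_taylorValue (2 * R) 2
  have hdist : ∀ y ∈ B, dist y x ≤ 2 * R := fun y hy => by
    have h1 := Metric.mem_ball.1 hy
    have h2 := Metric.mem_ball'.1 hx
    linarith [dist_triangle y c x]
  have hmem : ∀ᵐ y ∂volume.restrict B, y ∈ B := ae_restrict_mem measurableSet_ball
  have hmeas : ∀ s, AEStronglyMeasurable (fun y => taylorValue u x s y) (volume.restrict B) :=
    fun s => (hu.continuous_taylorValue x s).aestronglyMeasurable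
  have h0 : ∀ y, taylorValue u x 0 y = u x := fun y => by simp [taylorValue]
  have hbd : ∀ s ∈ Icc (-2 : ℝ) 2, ∀ y ∈ B, ‖taylorValue u x s y‖ ≤ |u x| + |b| * 2 := by
    intro s hs y hy
    have := (hb x y (hdist y hy)).dist_le_mul s hs 0 (by norm_num)
    rw [Real.dist_eq, Real.dist_eq, h0, Real.coe_nnabs, sub_zero] at this
    have h2 : |b| * |s| ≤ |b| * 2 := mul_le_mul_of_nonneg_left (abs_le.2 hs) (abs_nonneg b)
    rw [Real.norm_eq_abs]
    have h3 := abs_add_le (taylorValue u x s y - u x) (u x)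
    rw [sub_add_cancel] at h3
    linarith
  have hintg : ∀ s ∈ Icc (-2 : ℝ) 2, IntegrableOn (fun y => taylorValue u x s y) B := fun s hs =>
    Integrable.of_bound (hmeas s) _ (hmem.mono fun y hy => hbd s hs y hy)
  -- `G` runs from the volume times `u x` at `s = 0` to the integral of the Taylor polynomials at `s
  -- = 1`. The claim is a bound for `G 1 - G 0`.
  set G : ℝ → ℝ := fun s => ∫ y in B, taylorValue u x s y with hG
  have hcont : ContinuousOn G (Icc 0 1) := by
    refine continuousOn_of_dominated (bound := fun _ => |u x| + |b| * 2) (fun s _ => hmeas s)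
      (fun s hs => hmem.mono fun y hy => hbd s ⟨by linarith [hs.1], by linarith [hs.2]⟩ y hy)
      (integrable_const _) (hmem.mono fun y hy => ?_)
    exact (hb x y (hdist y hy)).continuousOn.mono fun s hs =>
      ⟨by linarith [hs.1], by linarith [hs.2]⟩
  have hder : ∀ s ∈ Ioc (0 : ℝ) 1, HasDerivAt G
      (∫ y in B, -(s * hessian u (x + s • (y - x)) (y - x) (y - x))) s := by
    intro s hs
    have hmz : Measurable fun y : Plane => hessian u (x + s • (y - x)) :=
      (measurable_fderiv ℝ (fderiv ℝ u)).comp (by fun_prop)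
    refine (hasDerivAt_integral_of_dominated_loc_of_lip (s := Icc (-2 : ℝ) 2)
      (bound := fun _ => b) (Icc_mem_nhds (by linarith [hs.1]) (by linarith [hs.2]))
      (Filter.Eventually.of_forall hmeas)
      (hintg s ⟨by linarith [hs.1], by linarith [hs.2]⟩) ?_ (hmem.mono fun y hy =>
        hb x y (hdist y hy)) (integrable_const _) ?_).2
    · refine Measurable.aestronglyMeasurable (Measurable.neg (Measurable.const_mul ?_ s))
      have h1 : Measurable fun y : Plane => (hessian u (x + s • (y - x)), (y - x)) :=
        hmz.prodMk (by fun_prop)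
      have hc1 : Continuous fun p : (Plane →L[ℝ] Plane →L[ℝ] ℝ) × Plane => p.1 p.2 p.2 :=
        (continuous_fst.clm_apply continuous_snd).clm_apply continuous_snd
      exact hc1.measurable.comp h1
    · filter_upwards [ae_restrict_of_ae (ae_comp_homothety hu.ae_twiceDiffAt x hs.1.ne')]
        with y hy using hasDerivAt_taylorValue hy
  set D := (2 * R) ^ 2 * (√(volume.real B) * √(∫ y in B, hessSq u y)) with hD
  have hbound : ∀ s ∈ Ioc (0 : ℝ) 1,
      ‖∫ y in B, -(s * hessian u (x + s • (y - x)) (y - x) (y - x))‖ ≤ D := by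
    intro s hs
    obtain ⟨M, hM0, hM⟩ := hu.exists_norm_hessian_le
    have i1 : IntegrableOn (fun y : Plane => ‖hessian u (x + s • (y - x))‖) B :=
      Measure.integrableOn_of_bounded (M := M) hfin.ne
        ((measurable_fderiv ℝ (fderiv ℝ u)).comp (by fun_prop)).norm.aestronglyMeasurable
        (Filter.Eventually.of_forall fun y => by
          rw [Real.norm_of_nonneg (norm_hessian_nonneg u _)]; exact hM _)
    calc ‖∫ y in B, -(s * hessian u (x + s • (y - x)) (y - x) (y - x))‖
        ≤ ∫ y in B, (2 * R) ^ 2 * s * ‖hessian u (x + s • (y - x))‖ := by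
          refine norm_integral_le_of_norm_le (i1.const_mul _) (hmem.mono fun y hy => ?_)
          rw [norm_neg, norm_mul, Real.norm_of_nonneg hs.1.le]
          have h1 := (hessian u (x + s • (y - x))).le_opNorm₂ (y - x) (y - x)
          have h2 : ‖y - x‖ ≤ 2 * R := by rw [← dist_eq_norm]; exact hdist y hy
          have h3 : ‖hessian u (x + s • (y - x))‖ * ‖y - x‖ * ‖y - x‖ ≤
              ‖hessian u (x + s • (y - x))‖ * (2 * R) * (2 * R) := by gcongr
          have h4 := mul_le_mul_of_nonneg_left (h1.trans h3) hs.1.le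
          linarith
      _ = (2 * R) ^ 2 * (s * ∫ y in B, ‖hessian u (x + s • (y - x))‖) := by
          rw [integral_const_mul, mul_assoc]
      _ ≤ D := mul_le_mul_of_nonneg_left
          (integral_norm_hessian_homothety_le hu hx hs.1 hs.2) (by positivity)
  -- Differentiability of `G` is known for `s > 0` only. The reversal `s = 1 - t` moves the
  -- exceptional point to the right end, where the mean value inequality asks for continuity alone.
  have hmv := norm_image_sub_le_of_norm_deriv_right_le_segment (f := fun t => G (1 - t))
    (f' := fun t => -(∫ y in B, -((1 - t) * hessian u (x + (1 - t) • (y - x)) (y - x) (y - x))))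
    (a := 0) (b := 1) (C := D) ?_ ?_ ?_ 1 (by norm_num)
  · rw [sub_self, sub_zero, mul_one, Real.norm_eq_abs] at hmv
    have hG0 : G 0 = volume.real B * u x := by
      simp only [hG, h0]
      rw [setIntegral_const, smul_eq_mul]
    rw [hG0, abs_sub_comm] at hmv
    exact hmv
  · exact hcont.comp (by fun_prop) fun t ht => ⟨by linarith [ht.2], by linarith [ht.1]⟩
  · intro t ht
    have h1 := (hder (1 - t) ⟨by linarith [ht.2], by linarith [ht.1]⟩).scomp t
      ((hasDerivAt_id t).const_sub 1)
    simpa [Function.comp_def] using h1.hasDerivWithinAt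
  · intro t ht
    rw [norm_neg]
    exact hbound (1 - t) ⟨by linarith [ht.2], by linarith [ht.1]⟩

/-- The affine function is the mean over `y` in the ball of the Taylor polynomials of `u` at `y`.
The constant arises from `(2R)⁴ / (π R²) ≤ 16 R²`. -/
theorem exists_affine_approx {u : Plane → ℝ} (hu : MemW2Inf u) (c : Plane) {R : ℝ} (hR : 0 < R) :
    ∃ (a : ℝ) (b : Plane), ∀ x ∈ Metric.ball c R,
      (u x - (a + inner ℝ b x)) ^ 2 ≤ 16 * R ^ 2 * ∫ y in Metric.ball c R, hessSq u y := by
  set B := Metric.ball c R with hB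
  have hfin : volume B < ⊤ := measure_ball_lt_top
  have hfm : IsFiniteMeasure (volume.restrict B) := ⟨by simpa using hfin⟩
  have hV := volume_ball_real c hR.le
  rw [← hB] at hV
  have hV0 : 0 < volume.real B := by rw [hV]; positivity
  have hcd : Continuous (fderiv ℝ u) := hu.1.continuous_fderiv (by simp)
  have hbs : ∀ {F : Type} [NormedAddCommGroup F] {f : Plane → F}, Continuous f →
      IntegrableOn f B := fun hf =>
    (hf.locallyIntegrable.integrableOn_isCompact (isCompact_closedBall c R)).mono_set
      Metric.ball_subset_closedBall
  have i1 : IntegrableOn (fun y => u y - fderiv ℝ u y y) B :=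
    hbs (hu.continuous.sub (hcd.clm_apply continuous_id))
  have i2 : IntegrableOn (fderiv ℝ u) B := hbs hcd
  refine ⟨(volume.real B)⁻¹ * ∫ y in B, (u y - fderiv ℝ u y y),
    (InnerProductSpace.toDual ℝ Plane).symm ((volume.real B)⁻¹ • ∫ y in B, fderiv ℝ u y),
    fun x hx => ?_⟩
  rw [InnerProductSpace.toDual_symm_apply, _root_.smul_apply, smul_eq_mul,
    ContinuousLinearMap.integral_apply i2, ← mul_add, ← integral_add i1
      (i2.apply_continuousLinearMap x)]
  have e : ∀ y, u y - fderiv ℝ u y y + fderiv ℝ u y x = taylorValue u x 1 y := by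
    intro y
    simp only [taylorValue, one_smul, add_sub_cancel, map_sub, one_mul]
    ring
  simp only [e]
  have key := abs_sub_integral_taylorValue_le hu hR hx
  rw [← hB] at key
  set I := ∫ y in B, taylorValue u x 1 y
  set E := ∫ y in B, hessSq u y with hE
  have hE0 : 0 ≤ E := integral_nonneg fun y => hessSq_nonneg u y
  have k2 : (I - volume.real B * u x) ^ 2 ≤ (2 * R) ^ 4 * (volume.real B * E) := by
    rw [← sq_abs]
    refine (pow_le_pow_left₀ (abs_nonneg _) key 2).trans_eq ?_
    rw [mul_pow, mul_pow (√_), Real.sq_sqrt hV0.le, Real.sq_sqrt hE0]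
    ring
  have k3 : (u x - (volume.real B)⁻¹ * I) ^ 2 =
      ((volume.real B)⁻¹) ^ 2 * (I - volume.real B * u x) ^ 2 := by
    field_simp
    ring
  rw [k3]
  calc ((volume.real B)⁻¹) ^ 2 * (I - volume.real B * u x) ^ 2
      ≤ ((volume.real B)⁻¹) ^ 2 * ((2 * R) ^ 4 * (volume.real B * E)) := by gcongr
    _ = 16 * R ^ 2 * E * (R ^ 2 * (volume.real B)⁻¹) := by field_simp; ring
    _ ≤ 16 * R ^ 2 * E * 1 := by
        refine mul_le_mul_of_nonneg_left ?_ (by positivity)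
        rw [hV, ← div_eq_mul_inv, div_le_one (by positivity)]
        nlinarith [Real.pi_gt_three, sq_nonneg R]
    _ = _ := mul_one _

/-! ### Poincaré inequalities for functions vanishing off a polygonal domain -/

/-- Where `u` vanishes the approximating affine function is as small as the approximation error `M`.
Its values at `y` and at a point of the small ball on the way to `x` determine its value at `x`, and
this extrapolation costs the factor `4 / κ`. -/
theorem sq_le_of_vanishing_on_ball {u : Plane → ℝ} (hu : MemW2Inf u) {c y : Plane} {R κ : ℝ}
    (hR : 0 < R) (hκ : 0 < κ) (hκ1 : κ ≤ 1) (hsub : Metric.ball y (κ * R) ⊆ Metric.ball c R)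
    (h0 : ∀ z ∈ Metric.ball y (κ * R), u z = 0) {x : Plane} (hx : x ∈ Metric.ball c R) :
    u x ^ 2 ≤ 16 * (1 + 4 / κ) ^ 2 * R ^ 2 * ∫ z in Metric.ball c R, hessSq u z := by
  obtain ⟨a, b, hab⟩ := exists_affine_approx hu c hR
  set E := ∫ z in Metric.ball c R, hessSq u z with hE
  have hE0 : 0 ≤ E := integral_nonneg fun z => hessSq_nonneg u z
  set M := 4 * R * √E with hM
  have hM0 : 0 ≤ M := by positivity
  have hM2 : M ^ 2 = 16 * R ^ 2 * E := by rw [hM, mul_pow, Real.sq_sqrt hE0]; ring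
  have hab' : ∀ z ∈ Metric.ball c R, |u z - (a + inner ℝ b z)| ≤ M := fun z hz =>
    abs_le_of_sq_le_sq (by rw [hM2]; exact hab z hz) hM0
  have hball : ∀ z ∈ Metric.ball y (κ * R), |a + inner ℝ b z| ≤ M := fun z hz => by
    have := hab' z (hsub hz)
    rwa [h0 z hz, zero_sub, abs_neg] at this
  have hyB : y ∈ Metric.ball y (κ * R) := Metric.mem_ball_self (by positivity)
  have hyx : dist x y < 2 * R := by
    have h1 := Metric.mem_ball.1 hx
    have h2 := Metric.mem_ball'.1 (hsub hyB)
    linarith [dist_triangle x c y]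
  have hz : y + (κ / 2) • (x - y) ∈ Metric.ball y (κ * R) := by
    rw [mem_ball_iff_norm, add_sub_cancel_left, norm_smul, Real.norm_of_nonneg (by positivity),
      ← dist_eq_norm]
    nlinarith
  have e : a + inner ℝ b (y + (κ / 2) • (x - y)) =
      (1 - κ / 2) * (a + inner ℝ b y) + κ / 2 * (a + inner ℝ b x) := by
    rw [inner_add_right, inner_smul_right, inner_sub_right]; ring
  have h1 := hball _ hz
  have h2 := hball _ hyB
  rw [e] at h1
  have h3 : |a + inner ℝ b x| ≤ 4 / κ * M := by
    have h4 : κ / 2 * |a + inner ℝ b x| ≤ 2 * M := by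
      have h5 : κ / 2 * (a + inner ℝ b x) =
          ((1 - κ / 2) * (a + inner ℝ b y) + κ / 2 * (a + inner ℝ b x)) -
          (1 - κ / 2) * (a + inner ℝ b y) := by ring
      have h6 : κ / 2 * |a + inner ℝ b x| = |κ / 2 * (a + inner ℝ b x)| := by
        rw [abs_mul, abs_of_pos (show 0 < κ / 2 by positivity)]
      rw [h6, h5]
      refine (abs_sub _ _).trans ?_
      rw [abs_mul (1 - κ / 2), abs_of_nonneg (by linarith : 0 ≤ 1 - κ / 2)]
      nlinarith [abs_nonneg (a + inner ℝ b y)]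
    rw [div_mul_eq_mul_div, le_div_iff₀ hκ]
    linarith
  have h6 : |u x| ≤ (1 + 4 / κ) * M := by
    have := abs_add_le (u x - (a + inner ℝ b x)) (a + inner ℝ b x)
    rw [sub_add_cancel] at this
    linarith [hab' x hx]
  calc u x ^ 2 = |u x| ^ 2 := (sq_abs _).symm
    _ ≤ ((1 + 4 / κ) * M) ^ 2 := by gcongr
    _ = _ := by rw [mul_pow, hM2]; ring

namespace IsPolygonalDomain

variable {Ω : Set Plane}

theorem isOpen (hΩ : IsPolygonalDomain Ω) : IsOpen Ω := by
  obtain ⟨-, -, P, -, rfl⟩ := hΩ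
  exact isOpen_interior

theorem isBounded (hΩ : IsPolygonalDomain Ω) : Bornology.IsBounded Ω := hΩ.2.1

theorem nonempty (hΩ : IsPolygonalDomain Ω) : Ω.Nonempty := hΩ.1.nonempty

theorem volume_lt_top (hΩ : IsPolygonalDomain Ω) : volume Ω < ⊤ := hΩ.isBounded.measure_lt_top

/-- The complement of a polygonal domain is a finite union of closures of convex open sets. -/
theorem exists_exterior (hΩ : IsPolygonalDomain Ω) : ∃ (ι : Type) (_ : Finite ι)
    (Q : ι → Set Plane), (∀ f, IsOpen (Q f)) ∧ (∀ f, Convex ℝ (Q f)) ∧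
      (∀ f, Disjoint (Q f) Ω) ∧ ∀ x ∉ Ω, ∃ f, x ∈ closure (Q f) := by
  obtain ⟨-, -, P, -, rfl⟩ := hΩ
  -- A point lies outside all the polygons exactly when each polygon has a half plane that the point
  -- violates. The index `f` records one such choice for every polygon.
  refine ⟨∀ p : P, {l // l ∈ p.1}, inferInstance,
    fun f => ⋂ p : P, {x | (f p).1.2 < inner ℝ (f p).1.1 x}, fun f => ?_, fun f => ?_,
    fun f => ?_, fun x hx => ?_⟩
  · exact isOpen_iInter_of_finite fun p => isOpen_lt continuous_const
      (continuous_const.inner continuous_id)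
  · exact convex_iInter fun p => convex_halfSpace_gt (innerSL ℝ (f p).1.1).isLinear _
  · refine Disjoint.mono_right interior_subset ?_
    rw [Set.disjoint_left]
    intro x hx hx'
    simp only [mem_iUnion] at hx'
    obtain ⟨p, hp, hxp⟩ := hx'
    have h1 := mem_iInter.1 hx ⟨p, hp⟩
    exact absurd (hxp _ (f ⟨p, hp⟩).2) (not_le.2 h1)
  -- The complement of an interior is the closure of the complement, and closure commutes with the
  -- finite union over the choices.
  · rw [← mem_iUnion, ← closure_iUnion_of_finite]
    rw [← mem_compl_iff, ← closure_compl] at hx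
    refine closure_mono ?_ hx
    intro z hz
    have hz' : ∀ p : P, ∃ l : {l // l ∈ p.1}, l.1.2 < inner ℝ l.1.1 z := by
      intro p
      by_contra! hcon
      exact hz (mem_iUnion₂.2 ⟨p.1, p.2, fun l hl => hcon ⟨l, hl⟩⟩)
    choose f hf using hz'
    exact mem_iUnion.2 ⟨f, mem_iInter.2 hf⟩

/-- The boundary is covered by the boundaries of finitely many convex exterior sets, and these are
null. -/
theorem volume_frontier (hΩ : IsPolygonalDomain Ω) : volume (frontier Ω) = 0 := by
  obtain ⟨ι, _, Q, hQo, hQc, hQd, hQ⟩ := hΩ.exists_exterior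
  refine measure_mono_null (t := ⋃ f, frontier (Q f)) ?_
    (measure_iUnion_null fun f => (hQc f).addHaar_frontier volume)
  intro x hx
  have hxΩ : x ∉ Ω := by rw [frontier, hΩ.isOpen.interior_eq] at hx; exact hx.2
  obtain ⟨f, hf⟩ := hQ x hxΩ
  refine mem_iUnion.2 ⟨f, hf, ?_⟩
  rw [(hQo f).interior_eq]
  intro hxf
  exact ((hQd f).closure_right (hQo f)).le_bot ⟨hxf, hx.1⟩

/-- A polygonal domain satisfies an exterior cone condition. -/
theorem exists_exterior_ball (hΩ : IsPolygonalDomain Ω) (R₁ : ℝ) : ∃ κ : ℝ, 0 < κ ∧ κ ≤ 1 ∧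
    ∀ x ∈ frontier Ω, ∀ r, 0 < r → r ≤ R₁ → ∃ y, Metric.ball y (κ * r) ⊆ Metric.ball x r ∧
      ∀ z ∈ Metric.ball y (κ * r), z ∉ Ω := by
  obtain ⟨ι, _, Q, hQo, hQc, hQd, hQ⟩ := hΩ.exists_exterior
  obtain ⟨L, hL0, hL⟩ := (hΩ.isBounded.closure.subset frontier_subset_closure).subset_closedBall_lt
    0 (0 : Plane)
  have hf : ∀ f, ∃ κ : ℝ, 0 < κ ∧ ∀ x ∈ frontier Ω, x ∈ closure (Q f) → ∀ r, 0 < r → r ≤ R₁ →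
      ∃ y, Metric.ball y (κ * r) ⊆ Metric.ball x r ∧ Metric.ball y (κ * r) ⊆ Q f := by
    intro f
    rcases (Q f).eq_empty_or_nonempty with he | ⟨z, hz⟩
    · exact ⟨1, one_pos, fun x _ hx => by simp [he] at hx⟩
    obtain ⟨ρ, hρ, hρQ⟩ := Metric.isOpen_iff.1 (hQo f) z hz
    -- The ball of radius `ρ` about `z` in `Q f` is shrunk towards `x` with ratio `t = r / m`.
    -- Convexity keeps it in `Q f`. The summand `|R₁|` gives `t ≤ 1`, and the others put the
    -- shrunken ball, of radius `tρ`, inside the ball of radius `r` about `x`.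
    set m := L + ‖z‖ + ρ + |R₁| with hm
    have hm0 : 0 < m := by positivity
    refine ⟨ρ / m, by positivity, fun x hx hxQ r hr hrR => ?_⟩
    set t := r / m with ht
    have ht0 : 0 < t := by positivity
    have ht1 : t ≤ 1 := by
      rw [ht, div_le_one hm0]
      linarith [le_abs_self R₁, norm_nonneg z]
    have hκt : ρ / m * r = t * ρ := by rw [ht]; ring
    have hxL : ‖x‖ ≤ L := by simpa using hL hx
    refine ⟨x + t • (z - x), ?_, ?_⟩
    · intro w hw
      rw [hκt, mem_ball_iff_norm] at hw
      rw [mem_ball_iff_norm]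
      have e : w - x = (w - (x + t • (z - x))) + t • (z - x) := by abel
      rw [e]
      refine (norm_add_le _ _).trans_lt ?_
      have h1 : ‖t • (z - x)‖ ≤ t * (‖z‖ + L) := by
        rw [norm_smul, Real.norm_of_nonneg ht0.le]
        exact mul_le_mul_of_nonneg_left ((norm_sub_le _ _).trans (by linarith)) ht0.le
      have h2 : t * m = r := by rw [ht]; field_simp
      have h3 : t * (‖z‖ + L + ρ) ≤ t * m :=
        mul_le_mul_of_nonneg_left (by rw [hm]; linarith [abs_nonneg R₁]) ht0.le
      linarith
    · intro w hw
      rw [hκt, mem_ball_iff_norm] at hw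
      have hw' : z + t⁻¹ • (w - (x + t • (z - x))) ∈ interior (Q f) := by
        rw [(hQo f).interior_eq]
        refine hρQ ?_
        rw [mem_ball_iff_norm, add_sub_cancel_left, norm_smul,
          Real.norm_of_nonneg (by positivity), inv_mul_lt_iff₀ ht0]
        exact hw
      have h1 := (hQc f).combo_closure_interior_mem_interior hxQ hw' (sub_nonneg.2 ht1) ht0
        (sub_add_cancel 1 t)
      have e : (1 - t) • x + t • (z + t⁻¹ • (w - (x + t • (z - x)))) = w := by
        rw [smul_add, smul_smul, mul_inv_cancel₀ ht0.ne', one_smul, sub_smul, one_smul, smul_sub]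
        abel
      rw [e] at h1
      exact interior_subset h1
  choose κ hκ0 hκ using hf
  rcases isEmpty_or_nonempty ι with he | hne
  · refine ⟨1, one_pos, le_rfl, fun x hx => ?_⟩
    have hxΩ : x ∉ Ω := by rw [frontier, hΩ.isOpen.interior_eq] at hx; exact hx.2
    obtain ⟨f, -⟩ := hQ x hxΩ
    exact he.elim f
  obtain ⟨f₀, hf₀⟩ := Finite.exists_min κ
  refine ⟨min (κ f₀) 1, lt_min (hκ0 f₀) one_pos, min_le_right _ _, fun x hx r hr hrR => ?_⟩
  have hxΩ : x ∉ Ω := by rw [frontier, hΩ.isOpen.interior_eq] at hx; exact hx.2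
  obtain ⟨f, hf⟩ := hQ x hxΩ
  obtain ⟨y, hy1, hy2⟩ := hκ f x hx hf r hr hrR
  have hsub : Metric.ball y (min (κ f₀) 1 * r) ⊆ Metric.ball y (κ f * r) :=
    Metric.ball_subset_ball (mul_le_mul_of_nonneg_right ((min_le_left _ _).trans (hf₀ f)) hr.le)
  exact ⟨y, hsub.trans hy1, fun z hz hzΩ => (hQd f).le_bot ⟨hy2 (hsub hz), hzΩ⟩⟩

/-- A ball about a boundary point contains an exterior ball of comparable radius, on which `u`
vanishes. The bound is scale invariant, so one constant serves all radii up to `R₁`. -/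
theorem sq_le_near_frontier (hΩ : IsPolygonalDomain Ω) (R₁ : ℝ) : ∃ C : ℝ, 0 < C ∧
    ∀ u, MemW2Inf u → (∀ x ∉ Ω, u x = 0) → ∀ x₀ ∈ frontier Ω, ∀ r, 0 < r → r ≤ R₁ →
      ∀ x ∈ Metric.ball x₀ r, u x ^ 2 ≤ C * r ^ 2 * ∫ z in Metric.ball x₀ r, hessSq u z := by
  obtain ⟨κ, hκ, hκ1, h⟩ := hΩ.exists_exterior_ball R₁
  refine ⟨16 * (1 + 4 / κ) ^ 2, by positivity, fun u hu hu0 x₀ hx₀ r hr hrR x hx => ?_⟩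
  obtain ⟨y, hy1, hy2⟩ := h x₀ hx₀ r hr hrR
  exact sq_le_of_vanishing_on_ball hu hr hκ hκ1 hy1 (fun z hz => hu0 z (hy2 z hz)) hx

/-- Off the closure `u` vanishes locally, and the boundary is null. Energies over the domain and
over the plane therefore coincide. -/
theorem hessSq_ae_eq_indicator (hΩ : IsPolygonalDomain Ω) {u : Plane → ℝ}
    (hu0 : ∀ x ∉ Ω, u x = 0) : hessSq u =ᵐ[volume] Ω.indicator (hessSq u) := by
  have h : ∀ᵐ x : Plane, x ∉ frontier Ω := measure_eq_zero_iff_ae_notMem.1 hΩ.volume_frontier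
  filter_upwards [h] with x hx
  by_cases hxΩ : x ∈ Ω
  · rw [indicator_of_mem hxΩ]
  rw [indicator_of_notMem hxΩ]
  have hxc : x ∉ closure Ω := fun hc => hx ⟨hc, by rwa [hΩ.isOpen.interior_eq]⟩
  have : u =ᶠ[nhds x] 0 := by
    filter_upwards [isClosed_closure.isOpen_compl.mem_nhds hxc] with y hy
    exact hu0 y fun h => hy (subset_closure h)
  rw [hessSq_congr this, hessSq_zero]

theorem integrable_hessSq (hΩ : IsPolygonalDomain Ω) {u : Plane → ℝ} (hu : MemW2Inf u)
    (hu0 : ∀ x ∉ Ω, u x = 0) : Integrable (hessSq u) := by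
  rw [integrable_congr (hΩ.hessSq_ae_eq_indicator hu0), integrable_indicator_iff
    hΩ.isOpen.measurableSet]
  exact hu.integrableOn_hessSq hΩ.volume_lt_top

theorem integral_hessSq (hΩ : IsPolygonalDomain Ω) {u : Plane → ℝ} (hu0 : ∀ x ∉ Ω, u x = 0) :
    ∫ x, hessSq u x = ∫ x in Ω, hessSq u x := by
  rw [integral_congr_ae (hΩ.hessSq_ae_eq_indicator hu0), integral_indicator hΩ.isOpen.measurableSet]

/-- The boundary estimate is applied to a single ball, centred at a boundary point and large enough
to contain the whole domain. -/
theorem sq_le_energy (hΩ : IsPolygonalDomain Ω) : ∃ C : ℝ, 0 < C ∧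
    ∀ u, MemW2Inf u → (∀ x ∉ Ω, u x = 0) → ∀ x, u x ^ 2 ≤ C * ∫ z in Ω, hessSq u z := by
  obtain ⟨p, hp⟩ := hΩ.nonempty
  have hne : Ω ≠ univ := by
    intro h
    have := hΩ.isBounded
    rw [h] at this
    exact NormedSpace.unbounded_univ ℝ Plane this
  obtain ⟨x₀, hx₀⟩ := nonempty_frontier_iff.2 ⟨⟨p, hp⟩, hne⟩
  obtain ⟨r, hr0, hr⟩ := hΩ.isBounded.subset_ball_lt 0 x₀
  obtain ⟨C, hC, h⟩ := hΩ.sq_le_near_frontier r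
  refine ⟨C * r ^ 2, by positivity, fun u hu hu0 x => ?_⟩
  have hnn : 0 ≤ ∫ z in Ω, hessSq u z := integral_nonneg fun z => hessSq_nonneg u z
  by_cases hx : x ∈ Ω
  · refine (h u hu hu0 x₀ hx₀ r hr0 le_rfl x (hr hx)).trans ?_
    refine mul_le_mul_of_nonneg_left ?_ (by positivity)
    rw [← hΩ.integral_hessSq hu0]
    exact setIntegral_le_integral (hΩ.integrable_hessSq hu hu0)
      (Filter.Eventually.of_forall fun z => hessSq_nonneg u z)
  · rw [hu0 x hx, sq, zero_mul]; positivity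

theorem hasCompactSupport (hΩ : IsPolygonalDomain Ω) {u : Plane → ℝ} (hu0 : ∀ x ∉ Ω, u x = 0) :
    HasCompactSupport u :=
  HasCompactSupport.of_support_subset_isCompact
    (Metric.isCompact_of_isClosed_isBounded isClosed_closure hΩ.isBounded.closure)
    (fun x hx => subset_closure (by by_contra h; exact hx (hu0 x h)))

end IsPolygonalDomain

/-! ### The gradient of a clamped function -/

theorem norm_sq_le_sum_dir (L : Plane →L[ℝ] ℝ) : ‖L‖ ^ 2 ≤ L (dir 0) ^ 2 + L (dir 1) ^ 2 := by
  have h : ‖L‖ ≤ √(L (dir 0) ^ 2 + L (dir 1) ^ 2) := by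
    refine L.opNorm_le_bound (Real.sqrt_nonneg _) fun v => ?_
    rw [Real.norm_eq_abs]
    refine abs_le_of_sq_le_sq ?_ (by positivity)
    rw [mul_pow, Real.sq_sqrt (by positivity), EuclideanSpace.norm_sq_eq]
    conv_lhs => rw [plane_eq_sum_dir v]
    simp only [map_add, map_smul, smul_eq_mul, Fin.sum_univ_two, Real.norm_eq_abs, sq_abs]
    nlinarith [sq_nonneg (v 0 * L (dir 1) - v 1 * L (dir 0))]
  calc ‖L‖ ^ 2 ≤ √(L (dir 0) ^ 2 + L (dir 1) ^ 2) ^ 2 := by gcongr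
    _ = _ := Real.sq_sqrt (by positivity)

theorem hessian_dir_sq_le (u : Plane → ℝ) (x : Plane) (i j : Fin 2) :
    hessian u x (dir i) (dir j) ^ 2 ≤ hessSq u x := by
  have h1 := Finset.single_le_sum (f := fun j => hessian u x (dir i) (dir j) ^ 2)
    (fun j _ => sq_nonneg _) (Finset.mem_univ j)
  have h2 := Finset.single_le_sum
    (f := fun i => ∑ j : Fin 2, hessian u x (dir i) (dir j) ^ 2)
    (fun i _ => Finset.sum_nonneg fun j _ => sq_nonneg _) (Finset.mem_univ i)
  exact h1.trans h2

theorem MemW2Inf.integral_partial_sq_eq {u : Plane → ℝ} (hu : MemW2Inf u)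
    (hc : HasCompactSupport u) (i : Fin 2) :
    ∫ x, fderiv ℝ u x (dir i) ^ 2 = ∫ x, -(hessian u x (dir i) (dir i)) * u x := by
  obtain ⟨K, hK⟩ := hu.exists_lipschitz
  obtain ⟨D, hD⟩ := hu.lipschitz_partial (dir i)
  have hfs : HasCompactSupport (fderiv ℝ u) := hc.fderiv (𝕜 := ℝ)
  have hcsi : HasCompactSupport fun x => fderiv ℝ u x (dir i) :=
    hfs.comp_left (g := fun L : Plane →L[ℝ] ℝ => L (dir i)) rfl
  have key := hK.integral_lineDeriv_mul_eq (μ := volume) hD hcsi (dir i)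
  have e1 : ∀ x, fderiv ℝ u x (dir i) ^ 2 = lineDeriv ℝ u x (dir i) * fderiv ℝ u x (dir i) :=
    fun x => by rw [(hu.differentiable x).lineDeriv_eq_fderiv, sq]
  simp only [e1]
  rw [key]
  refine integral_congr_ae ?_
  filter_upwards [hD.ae_differentiableAt (μ := volume), hu.ae_twiceDiffAt] with x hx hx'
  rw [hx.lineDeriv_eq_fderiv, map_neg, fderiv_partial_eq_hessian hx']

theorem MemW2Inf.integral_fderiv_sq_le_partial {u : Plane → ℝ} (hu : MemW2Inf u)
    (hc : HasCompactSupport u) (U : Set Plane) : ∫ x in U, ‖fderiv ℝ u x‖ ^ 2 ≤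
      (∫ x, fderiv ℝ u x (dir 0) ^ 2) + ∫ x, fderiv ℝ u x (dir 1) ^ 2 := by
  have hcd : Continuous (fderiv ℝ u) := hu.1.continuous_fderiv (by simp)
  have hfs : HasCompactSupport (fderiv ℝ u) := hc.fderiv (𝕜 := ℝ)
  have ip : ∀ i, Integrable fun x => fderiv ℝ u x (dir i) ^ 2 := fun i =>
    Continuous.integrable_of_hasCompactSupport (by fun_prop)
      (hfs.comp_left (g := fun L : Plane →L[ℝ] ℝ => L (dir i) ^ 2) (by simp))
  have in1 : Integrable fun x => ‖fderiv ℝ u x‖ ^ 2 :=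
    Continuous.integrable_of_hasCompactSupport (by fun_prop)
      (hfs.comp_left (g := fun L : Plane →L[ℝ] ℝ => ‖L‖ ^ 2) (by simp))
  have h1 : ∫ x in U, ‖fderiv ℝ u x‖ ^ 2 ≤ ∫ x, ‖fderiv ℝ u x‖ ^ 2 :=
    setIntegral_le_integral in1 (Filter.Eventually.of_forall fun x => sq_nonneg ‖fderiv ℝ u x‖)
  have h2 : ∫ x, ‖fderiv ℝ u x‖ ^ 2 ≤
      ∫ x, (fderiv ℝ u x (dir 0) ^ 2 + fderiv ℝ u x (dir 1) ^ 2) :=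
    integral_mono in1 ((ip 0).add (ip 1)) fun x => norm_sq_le_sum_dir (fderiv ℝ u x)
  rw [integral_add (ip 0) (ip 1)] at h2
  exact h1.trans h2

/-- Integration by parts turns the square of a first derivative into a second derivative times `u`.
Young's inequality splits this product, and the sup bound `sq_le_energy` takes care of `u`. -/
theorem IsPolygonalDomain.integral_fderiv_sq_le {Ω : Set Plane} (hΩ : IsPolygonalDomain Ω) :
    ∃ C : ℝ, 0 < C ∧ ∀ u, MemW2Inf u → (∀ x ∉ Ω, u x = 0) →
      ∫ x in Ω, ‖fderiv ℝ u x‖ ^ 2 ≤ C * ∫ z in Ω, hessSq u z := by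
  obtain ⟨C, hC, hsq⟩ := hΩ.sq_le_energy
  refine ⟨1 + C * volume.real Ω, by positivity, fun u hu hu0 => ?_⟩
  set E := ∫ z in Ω, hessSq u z with hE
  have hcs := hΩ.hasCompactSupport hu0
  have hfm : IsFiniteMeasure (volume.restrict Ω) := ⟨by simpa using hΩ.volume_lt_top⟩
  have iE : IntegrableOn (hessSq u) Ω := hu.integrableOn_hessSq hΩ.volume_lt_top
  have hpart : ∀ i, ∫ x, fderiv ℝ u x (dir i) ^ 2 ≤ 2⁻¹ * E + 2⁻¹ * (C * E) * volume.real Ω := by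
    intro i
    rw [hu.integral_partial_sq_eq hcs i, ← setIntegral_eq_integral_of_forall_compl_eq_zero (s := Ω)
      (fun x hx => by rw [hu0 x hx, mul_zero])]
    obtain ⟨M, hM0, hM⟩ := hu.exists_norm_hessian_le
    obtain ⟨A, hA⟩ := hu.2.1
    have i2 : IntegrableOn (fun x => -(hessian u x (dir i) (dir i)) * u x) Ω := by
      refine Integrable.of_bound ((measurable_hessian_apply u _ _).neg.mul
        hu.continuous.measurable).aestronglyMeasurable (M * A)
        (Filter.Eventually.of_forall fun x => ?_)
      rw [norm_mul, norm_neg, Real.norm_eq_abs, Real.norm_eq_abs]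
      exact mul_le_mul ((abs_hessian_dir_le u x i i).trans (hM x)) (hA x) (abs_nonneg _) hM0
    have i3 : IntegrableOn (fun x => 2⁻¹ * hessSq u x + 2⁻¹ * (C * E)) Ω :=
      (iE.const_mul _).add (integrable_const _)
    have hle : ∀ x, -(hessian u x (dir i) (dir i)) * u x ≤
        2⁻¹ * hessSq u x + 2⁻¹ * (C * E) := fun x => by
      have h1 := hsq u hu hu0 x
      have h2 := hessian_dir_sq_le u x i i
      nlinarith [sq_nonneg (hessian u x (dir i) (dir i) + u x)]
    refine (integral_mono i2 i3 hle).trans_eq ?_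
    rw [integral_add (iE.const_mul _) (integrable_const _), integral_const_mul, ← hE,
      setIntegral_const, smul_eq_mul, mul_comm (volume.real Ω)]
  linarith [hu.integral_fderiv_sq_le_partial hcs Ω, hpart 0, hpart 1]

/-! ### Inverse estimates for biquadratic polynomials -/

/-- The derivative is affine, so its extremes are at the endpoints. There it equals a three-point
difference quotient with weights `3`, `4`, `1`, whose absolute values add up to `8`. -/
theorem quadratic_markov {a b A B C M : ℝ} (hab : a < b)
    (h : ∀ t ∈ Ioo a b, |A + B * t + C * t ^ 2| ≤ M) {t : ℝ} (ht : t ∈ Ioo a b) :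
    |B + 2 * C * t| ≤ 8 * M / (b - a) := by
  have hcl : ∀ t ∈ Icc a b, |A + B * t + C * t ^ 2| ≤ M := by
    intro t ht
    rw [← closure_Ioo hab.ne] at ht
    have hcl : IsClosed {t : ℝ | |A + B * t + C * t ^ 2| ≤ M} :=
      isClosed_le (by fun_prop) continuous_const
    exact closure_minimal (fun t ht => h t ht) hcl ht
  have h1 := abs_le.1 (hcl a ⟨le_rfl, hab.le⟩)
  have h2 := abs_le.1 (hcl b ⟨hab.le, le_rfl⟩)
  have h3 := abs_le.1 (hcl ((a + b) / 2) ⟨by linarith, by linarith⟩)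
  have hba : 0 < b - a := sub_pos.2 hab
  set p := fun t : ℝ => A + B * t + C * t ^ 2 with hp
  have ea : (B + 2 * C * a) * (b - a) = -3 * p a + 4 * p ((a + b) / 2) - p b := by
    simp only [hp]; ring
  have eb : (B + 2 * C * b) * (b - a) = p a - 4 * p ((a + b) / 2) + 3 * p b := by
    simp only [hp]; ring
  have ka : |(B + 2 * C * a) * (b - a)| ≤ 8 * M := by
    rw [ea, abs_le]; constructor <;> simp only [hp] <;> linarith
  have kb : |(B + 2 * C * b) * (b - a)| ≤ 8 * M := by
    rw [eb, abs_le]; constructor <;> simp only [hp] <;> linarith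
  rw [abs_mul, abs_of_pos hba, ← le_div_iff₀ hba] at ka kb
  rw [abs_le] at ka kb ⊢
  rcases le_total 0 C with hC | hC
  · constructor
    · nlinarith [ht.1]
    · nlinarith [ht.2]
  · constructor
    · nlinarith [ht.2]
    · nlinarith [ht.1]

/-- The coordinate functionals of a frame. -/
noncomputable def frameCoord (F : Plane ≃ₗᵢ[ℝ] Plane) (k : Fin 2) : Plane →L[ℝ] ℝ :=
  (EuclideanSpace.proj k : Plane →L[ℝ] ℝ).comp (F.toContinuousLinearEquiv : Plane →L[ℝ] Plane)

theorem frameCoord_apply (F : Plane ≃ₗᵢ[ℝ] Plane) (k : Fin 2) (x : Plane) :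
    frameCoord F k x = F x k := rfl

theorem abs_coord_le_norm (x : Plane) (k : Fin 2) : |x k| ≤ ‖x‖ := by
  simpa using PiLp.norm_apply_le x k

theorem norm_frameCoord_le (F : Plane ≃ₗᵢ[ℝ] Plane) (k : Fin 2) : ‖frameCoord F k‖ ≤ 1 := by
  refine ContinuousLinearMap.opNorm_le_bound _ zero_le_one fun x => ?_
  rw [frameCoord_apply, one_mul, ← F.norm_map x]
  exact abs_coord_le_norm (F x) k

theorem mem_biquadratic_iff {F : Plane ≃ₗᵢ[ℝ] Plane} {q : Plane → ℝ} : q ∈ biquadratic F ↔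
    ∃ c : Fin 3 → Fin 3 → ℝ, ∀ x, q x = ∑ m, ∑ n, c m n * (F x 0 ^ (m : ℕ) * F x 1 ^ (n : ℕ)) := by
  rw [biquadratic, Submodule.mem_span_range_iff_exists_fun]
  constructor
  · rintro ⟨c, rfl⟩
    refine ⟨fun m n => c (m, n), fun x => ?_⟩
    rw [Finset.sum_apply, Fintype.sum_prod_type]
    rfl
  · rintro ⟨c, hc⟩
    refine ⟨fun p => c p.1 p.2, ?_⟩
    funext x
    rw [hc, Finset.sum_apply, Fintype.sum_prod_type]
    rfl

theorem affine_mem_biquadratic (F : Plane ≃ₗᵢ[ℝ] Plane) (a : ℝ) (b : Plane) :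
    (fun x => a + inner ℝ b x) ∈ biquadratic F := by
  rw [mem_biquadratic_iff]
  refine ⟨!![a, F b 1, 0; F b 0, 0, 0; 0, 0, 0], fun x => ?_⟩
  rw [← F.inner_map_map b x, PiLp.inner_apply]
  simp [Fin.sum_univ_three]
  ring

theorem contDiff_of_mem_biquadratic {F : Plane ≃ₗᵢ[ℝ] Plane} {q : Plane → ℝ}
    (hq : q ∈ biquadratic F) : ContDiff ℝ ∞ q := by
  obtain ⟨c, hc⟩ := mem_biquadratic_iff.1 hq
  have : q = fun x => ∑ m : Fin 3, ∑ n : Fin 3,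
      c m n * (frameCoord F 0 x ^ (m : ℕ) * frameCoord F 1 x ^ (n : ℕ)) := funext hc
  rw [this]
  fun_prop

/-- The two partial derivatives of a biquadratic polynomial, with Markov's inequality. -/
theorem exists_partials_of_mem_biquadratic {F : Plane ≃ₗᵢ[ℝ] Plane} {q : Plane → ℝ}
    (hq : q ∈ biquadratic F) : ∃ g : Fin 2 → Plane → ℝ, (∀ k, g k ∈ biquadratic F) ∧
      (∀ x, fderiv ℝ q x = g 0 x • frameCoord F 0 + g 1 x • frameCoord F 1) ∧
      ∀ (lo hi : Fin 2 → ℝ) (s M : ℝ), 0 < s → (∀ k, s ≤ hi k - lo k) →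
        (∀ x ∈ openRect F lo hi, |q x| ≤ M) →
        ∀ k, ∀ x ∈ openRect F lo hi, |g k x| ≤ 8 * M / s := by
  obtain ⟨c, hc⟩ := mem_biquadratic_iff.1 hq
  set g₀ : Plane → ℝ := fun x => ∑ n : Fin 3, (c 1 n + 2 * c 2 n * F x 0) * F x 1 ^ (n : ℕ)
    with hg₀
  set g₁ : Plane → ℝ := fun x => ∑ m : Fin 3, (c m 1 + 2 * c m 2 * F x 1) * F x 0 ^ (m : ℕ)
    with hg₁
  have hM : ∀ (M s w : ℝ), 0 < s → s ≤ w → 0 ≤ M → 8 * M / w ≤ 8 * M / s := fun M s w hs hw hM => by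
    gcongr
  refine ⟨![g₀, g₁], ?_, ?_, ?_⟩
  · intro k
    rw [mem_biquadratic_iff]
    fin_cases k
    · refine ⟨!![c 1 0, c 1 1, c 1 2; 2 * c 2 0, 2 * c 2 1, 2 * c 2 2; 0, 0, 0], fun x => ?_⟩
      simp [hg₀, Fin.sum_univ_three]
      ring
    · refine ⟨!![c 0 1, 2 * c 0 2, 0; c 1 1, 2 * c 1 2, 0; c 2 1, 2 * c 2 2, 0], fun x => ?_⟩
      simp [hg₁, Fin.sum_univ_three]
      ring
  · intro x
    have hq' : q = fun x => ∑ m : Fin 3, ∑ n : Fin 3,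
      c m n * (frameCoord F 0 x ^ (m : ℕ) * frameCoord F 1 x ^ (n : ℕ)) := funext hc
    have h0 : ∀ m : ℕ, HasFDerivAt (fun x => frameCoord F 0 x ^ m)
        ((m * frameCoord F 0 x ^ (m - 1)) • frameCoord F 0) x := fun m => by
      simpa using (frameCoord F 0).hasFDerivAt.pow m
    have h1 : ∀ m : ℕ, HasFDerivAt (fun x => frameCoord F 1 x ^ m)
        ((m * frameCoord F 1 x ^ (m - 1)) • frameCoord F 1) x := fun m => by
      simpa using (frameCoord F 1).hasFDerivAt.pow m
    have hd := HasFDerivAt.fun_sum (u := Finset.univ) fun (m : Fin 3) _ =>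
      HasFDerivAt.fun_sum (u := Finset.univ) fun (n : Fin 3) _ =>
        ((h0 m).mul (h1 n)).const_mul (c m n)
    rw [hq']
    refine (HasFDerivAt.fderiv hd).trans ?_
    ext v
    simp [Fin.sum_univ_three, hg₀, hg₁, frameCoord_apply]
    ring
  · intro lo hi s M hs hw hb k x hx
    have hM0 : 0 ≤ M := (abs_nonneg _).trans (hb x hx)
    have hline : ∀ (k : Fin 2) (t : ℝ) (j : Fin 2), F (x + (t - F x k) • F.symm (dir k)) j =
        if j = k then t else F x j := by
      intro k t j
      rw [map_add, map_smul, F.apply_symm_apply]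
      by_cases hjk : j = k
      · subst hjk; simp
      · simp [hjk]
    have hmem : ∀ (k : Fin 2) (t : ℝ), t ∈ Ioo (lo k) (hi k) →
        x + (t - F x k) • F.symm (dir k) ∈ openRect F lo hi := by
      intro k t ht j
      rw [hline]
      split_ifs with hjk
      · subst hjk; exact ht
      · exact hx j
    fin_cases k
    · have h := quadratic_markov (a := lo 0) (b := hi 0) (M := M)
        (A := ∑ n : Fin 3, c 0 n * F x 1 ^ (n : ℕ)) (B := ∑ n : Fin 3, c 1 n * F x 1 ^ (n : ℕ))
        (C := ∑ n : Fin 3, c 2 n * F x 1 ^ (n : ℕ)) (by linarith [hw 0]) (fun t ht => ?_) (hx 0)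
      · refine Eq.trans_le ?_ (h.trans (hM M s _ hs (hw 0) hM0))
        simp [hg₀, Fin.sum_univ_three]
        ring_nf
      · have := hb _ (hmem 0 t ht)
        rw [hc] at this
        refine Eq.trans_le ?_ this
        simp [Fin.sum_univ_three]
        ring_nf
    · have h := quadratic_markov (a := lo 1) (b := hi 1) (M := M)
        (A := ∑ n : Fin 3, c n 0 * F x 0 ^ (n : ℕ)) (B := ∑ n : Fin 3, c n 1 * F x 0 ^ (n : ℕ))
        (C := ∑ n : Fin 3, c n 2 * F x 0 ^ (n : ℕ)) (by linarith [hw 1]) (fun t ht => ?_) (hx 1)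
      · refine Eq.trans_le ?_ (h.trans (hM M s _ hs (hw 1) hM0))
        simp [hg₁, Fin.sum_univ_three]
        ring_nf
      · have := hb _ (hmem 1 t ht)
        rw [hc] at this
        refine Eq.trans_le ?_ this
        simp [Fin.sum_univ_three]
        ring_nf

theorem norm_smul_frameCoord_le (F : Plane ≃ₗᵢ[ℝ] Plane) (k : Fin 2) (c : ℝ) :
    ‖c • frameCoord F k‖ ≤ |c| := by
  rw [norm_smul, Real.norm_eq_abs]
  exact mul_le_of_le_one_right (abs_nonneg _) (norm_frameCoord_le F k)

theorem norm_fderiv_biquadratic_le {F : Plane ≃ₗᵢ[ℝ] Plane} {q : Plane → ℝ}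
    (hq : q ∈ biquadratic F) {lo hi : Fin 2 → ℝ} {s M : ℝ} (hs : 0 < s)
    (hw : ∀ k, s ≤ hi k - lo k) (hb : ∀ x ∈ openRect F lo hi, |q x| ≤ M) {x : Plane}
    (hx : x ∈ openRect F lo hi) : ‖fderiv ℝ q x‖ ≤ 16 * M / s := by
  obtain ⟨g, -, hg1, hg2⟩ := exists_partials_of_mem_biquadratic hq
  have h0 := hg2 lo hi s M hs hw hb 0 x hx
  have h1 := hg2 lo hi s M hs hw hb 1 x hx
  rw [hg1]
  have h2 := norm_add_le (g 0 x • frameCoord F 0) (g 1 x • frameCoord F 1)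
  have h3 := norm_smul_frameCoord_le F 0 (g 0 x)
  have h4 := norm_smul_frameCoord_le F 1 (g 1 x)
  have h5 : 16 * M / s = 8 * M / s + 8 * M / s := by ring
  linarith

/-- The partial derivatives are again biquadratic and bounded by `8M/s`. The gradient bound applied
to each gives `16 · 8`, and the two directions double this to `256`. -/
theorem norm_hessian_biquadratic_le {F : Plane ≃ₗᵢ[ℝ] Plane} {q : Plane → ℝ}
    (hq : q ∈ biquadratic F) {lo hi : Fin 2 → ℝ} {s M : ℝ} (hs : 0 < s)
    (hw : ∀ k, s ≤ hi k - lo k) (hb : ∀ x ∈ openRect F lo hi, |q x| ≤ M) {x : Plane}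
    (hx : x ∈ openRect F lo hi) : ‖hessian q x‖ ≤ 256 * M / s ^ 2 := by
  obtain ⟨g, hg0, hg1, hg2⟩ := exists_partials_of_mem_biquadratic hq
  have hd : ∀ k, ‖fderiv ℝ (g k) x‖ ≤ 128 * M / s ^ 2 := fun k => by
    refine (norm_fderiv_biquadratic_le (hg0 k) hs hw (hg2 lo hi s M hs hw hb k) hx).trans_eq ?_
    field_simp
    ring
  have hdiff : ∀ k, DifferentiableAt ℝ (g k) x := fun k =>
    (contDiff_of_mem_biquadratic (hg0 k)).differentiable (by simp) x
  have e : hessian q x = (fderiv ℝ (g 0) x).smulRight (frameCoord F 0) +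
      (fderiv ℝ (g 1) x).smulRight (frameCoord F 1) := by
    unfold hessian
    rw [show fderiv ℝ q = fun x => g 0 x • frameCoord F 0 + g 1 x • frameCoord F 1 from funext hg1]
    exact (((hdiff 0).hasFDerivAt.smul_const (frameCoord F 0)).add
      ((hdiff 1).hasFDerivAt.smul_const (frameCoord F 1))).fderiv
  rw [e]
  have h1 := norm_add_le ((fderiv ℝ (g 0) x).smulRight (frameCoord F 0))
    ((fderiv ℝ (g 1) x).smulRight (frameCoord F 1))
  rw [ContinuousLinearMap.norm_smulRight_apply, ContinuousLinearMap.norm_smulRight_apply] at h1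
  have h2 : ∀ k, ‖fderiv ℝ (g k) x‖ * ‖frameCoord F k‖ ≤ 128 * M / s ^ 2 := fun k =>
    (mul_le_of_le_one_right (norm_nonneg _) (norm_frameCoord_le F k)).trans (hd k)
  have h3 : 256 * M / s ^ 2 = 128 * M / s ^ 2 + 128 * M / s ^ 2 := by ring
  linarith [h2 0, h2 1]

/-! ### Basic properties of the partition of unity spaces -/

theorem isOpen_openRect (F : Plane ≃ₗᵢ[ℝ] Plane) (lo hi : Fin 2 → ℝ) :
    IsOpen (openRect F lo hi) := by
  have : openRect F lo hi =
      ⋂ k, ({x : Plane | lo k < frameCoord F k x} ∩ {x : Plane | frameCoord F k x < hi k}) := by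
    ext x; simp [openRect, frameCoord_apply]
  rw [this]
  exact isOpen_iInter_of_finite fun k => (isOpen_lt continuous_const (frameCoord F k).continuous).inter
    (isOpen_lt (frameCoord F k).continuous continuous_const)

theorem convex_openRect (F : Plane ≃ₗᵢ[ℝ] Plane) (lo hi : Fin 2 → ℝ) :
    Convex ℝ (openRect F lo hi) := by
  have : openRect F lo hi =
      ⋂ k, ({x : Plane | lo k < frameCoord F k x} ∩ {x : Plane | frameCoord F k x < hi k}) := by
    ext x; simp [openRect, frameCoord_apply]
  rw [this]
  exact convex_iInter fun k => (convex_halfSpace_gt (frameCoord F k).isLinear _).inter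
    (convex_halfSpace_lt (frameCoord F k).isLinear _)

theorem norm_le_sum_abs_frame (F : Plane ≃ₗᵢ[ℝ] Plane) (x : Plane) : ‖x‖ ≤ |F x 0| + |F x 1| := by
  rw [← F.norm_map x, EuclideanSpace.norm_eq]
  refine Real.sqrt_le_iff.2 ⟨by positivity, ?_⟩
  simp only [Fin.sum_univ_two, Real.norm_eq_abs]
  nlinarith [abs_nonneg (F x 0), abs_nonneg (F x 1)]

theorem isBounded_openRect (F : Plane ≃ₗᵢ[ℝ] Plane) (lo hi : Fin 2 → ℝ) :
    Bornology.IsBounded (openRect F lo hi) := by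
  refine (Metric.isBounded_closedBall (x := (0 : Plane))
    (r := (|lo 0| + |hi 0|) + (|lo 1| + |hi 1|))).subset fun x hx => ?_
  rw [mem_closedBall_zero_iff]
  refine (norm_le_sum_abs_frame F x).trans (add_le_add ?_ ?_)
  · exact abs_le.2 ⟨by linarith [(hx 0).1, neg_abs_le (lo 0), abs_nonneg (hi 0)],
      by linarith [(hx 0).2, le_abs_self (hi 0), abs_nonneg (lo 0)]⟩
  · exact abs_le.2 ⟨by linarith [(hx 1).1, neg_abs_le (lo 1), abs_nonneg (hi 1)],
      by linarith [(hx 1).2, le_abs_self (hi 1), abs_nonneg (lo 1)]⟩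

namespace PUM

variable {Ω : Set Plane} {σ h : ℝ} (S : PUM Ω σ h)

theorem localInterp_mem (i : Fin S.n) (ζ : Plane → ℝ) : S.localInterp i ζ ∈ S.V i :=
  (S.unisolvent i ζ).choose_spec.1.1

theorem localInterp_node (i : Fin S.n) (ζ : Plane → ℝ) {p : Plane} (hp : p ∈ S.nodes i) :
    S.localInterp i ζ p = ζ p :=
  (S.unisolvent i ζ).choose_spec.1.2 p hp

theorem localInterp_eq_of {i : Fin S.n} {ζ q : Plane → ℝ} (hq : q ∈ S.V i)
    (hqp : ∀ p ∈ S.nodes i, q p = ζ p) : S.localInterp i ζ = q :=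
  ((S.unisolvent i ζ).choose_spec.2 q ⟨hq, hqp⟩).symm

theorem localInterp_congr {i : Fin S.n} {ζ ξ : Plane → ℝ} (hp : ∀ p ∈ S.nodes i, ζ p = ξ p) :
    S.localInterp i ζ = S.localInterp i ξ :=
  S.localInterp_eq_of (S.localInterp_mem i ξ) fun p h => by rw [S.localInterp_node i ξ h, hp p h]

theorem interp_congr {ζ ξ : Plane → ℝ} (hp : ∀ p ∈ S.allNodes, ζ p = ξ p) :
    S.interp ζ = S.interp ξ := by
  simp only [interp, LinearMap.sum_apply, LinearMap.comp_apply]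
  refine Finset.sum_congr rfl fun i _ => ?_
  rw [S.localInterp_congr fun p h => hp p ⟨i, h⟩]

theorem interp_eq (ζ : Plane → ℝ) :
    S.interp ζ = ∑ i, Ω.indicator (fun x => S.φ i x * S.localInterp i ζ x) := by
  simp only [interp, LinearMap.sum_apply, LinearMap.comp_apply]
  rfl

theorem interp_apply_of_mem (ζ : Plane → ℝ) {x : Plane} (hx : x ∈ Ω) :
    S.interp ζ x = ∑ i, S.φ i x * S.localInterp i ζ x := by
  rw [interp_eq, Finset.sum_apply]
  exact Finset.sum_congr rfl fun i _ => indicator_of_mem hx _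

theorem interp_apply_of_notMem (ζ : Plane → ℝ) {x : Plane} (hx : x ∉ Ω) : S.interp ζ x = 0 := by
  rw [interp_eq, Finset.sum_apply]
  exact Finset.sum_eq_zero fun i _ => indicator_of_notMem hx _

theorem isOpen_patch (i : Fin S.n) : IsOpen (S.patch i) := isOpen_openRect _ _ _

/-- A point of the domain lies in at least one patch and in at most `σ`. -/
theorem one_le_sigma {Ω : Set Plane} {σ h : ℝ} (S : PUM Ω σ h) (hΩ : Ω.Nonempty) : 1 ≤ σ := by
  obtain ⟨x, hx⟩ := hΩ
  obtain ⟨i, hi⟩ := mem_iUnion.1 (S.cover (subset_closure hx))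
  refine le_trans ?_ (S.overlap x)
  have : 0 < Set.ncard {i | x ∈ openRect (S.frame i) (S.lo i) (S.hi i)} :=
    (Set.ncard_pos (Set.toFinite _)).2 ⟨i, hi⟩
  exact_mod_cast this

theorem flat_subset_patch (i : Fin S.n) :
    closedRect (S.frame i) (S.flatLo i) (S.flatHi i) ⊆ S.patch i := fun x hx =>
  S.φ_support i (subset_tsupport _ (by rw [Function.mem_support, S.φ_flat i x hx]; exact one_ne_zero))

theorem node_mem_patch {i : Fin S.n} {p : Plane} (hp : p ∈ S.nodes i) : p ∈ S.patch i :=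
  S.flat_subset_patch i (S.nodes_mem i p hp).2

theorem φ_le_one (i : Fin S.n) {x : Plane} (hx : x ∈ Ω) : S.φ i x ≤ 1 := by
  rw [← S.φ_sum x hx]
  exact Finset.single_le_sum (fun j _ => S.φ_nonneg j x) (Finset.mem_univ i)

theorem φ_eq_zero_of_notMem {i : Fin S.n} {x : Plane} (hx : x ∉ S.patch i) : S.φ i x = 0 :=
  image_eq_zero_of_notMem_tsupport fun h => hx (S.φ_support i h)

/-- This is the point of the flat tops: `φ i` exhausts the partition of unity at its own nodes, so
the other nonnegative functions vanish there. -/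
theorem φ_node {i : Fin S.n} {p : Plane} (hp : p ∈ S.nodes i) (j : Fin S.n) :
    S.φ j p = if j = i then 1 else 0 := by
  have h1 : S.φ i p = 1 := S.φ_flat i p (S.nodes_mem i p hp).2
  split_ifs with hji
  · rw [hji, h1]
  have h2 := S.φ_sum p (S.nodes_mem i p hp).1
  rw [← Finset.add_sum_erase _ _ (Finset.mem_univ i), h1] at h2
  have h3 : ∑ k ∈ Finset.univ.erase i, S.φ k p = 0 := by linarith
  exact (Finset.sum_eq_zero_iff_of_nonneg fun k _ => S.φ_nonneg k p).1 h3 j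
    (Finset.mem_erase.2 ⟨hji, Finset.mem_univ j⟩)

theorem interp_node (ζ : Plane → ℝ) {p : Plane} (hp : p ∈ S.allNodes) : S.interp ζ p = ζ p := by
  obtain ⟨i, hi⟩ := hp
  rw [S.interp_apply_of_mem ζ (S.nodes_mem i p hi).1]
  simp [S.φ_node hi, S.localInterp_node i ζ hi]

theorem interp_interp (ζ : Plane → ℝ) : S.interp (S.interp ζ) = S.interp ζ :=
  S.interp_congr fun _ hp => S.interp_node ζ hp

/-- By `φ_node`, the nodal values of `φᵢ q` are those of `q` at the nodes of patch `i` and zero at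
those of the other patches. Interpolation thus reproduces each summand and is a projection onto the
space. -/
theorem mem_space_iff {v : Plane → ℝ} : v ∈ S.space ↔ S.interp v = v := by
  refine ⟨fun hv => ?_, fun hv => hv ▸ S.interp_mem v⟩
  have hle : S.space ≤ LinearMap.ker (S.interp - LinearMap.id) := by
    refine iSup_le fun i => ?_
    rintro _ ⟨q, hq, rfl⟩
    rw [LinearMap.mem_ker, LinearMap.sub_apply, LinearMap.id_apply, sub_eq_zero]
    have hnode : ∀ j, ∀ p ∈ S.nodes j, S.lift i q p = if j = i then q p else 0 := by
      intro j p hp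
      change Ω.indicator (fun x => S.φ i x * q x) p = _
      rw [indicator_of_mem (S.nodes_mem j p hp).1, S.φ_node hp i]
      by_cases hji : j = i
      · simp [hji]
      · simp [hji, Ne.symm hji]
    have hloc : ∀ j, S.localInterp j (S.lift i q) = if j = i then q else 0 := by
      intro j
      split_ifs with hji
      · subst hji
        exact S.localInterp_eq_of hq fun p hp => by rw [hnode j p hp, if_pos rfl]
      · exact S.localInterp_eq_of (Submodule.zero_mem _) fun p hp => by
          rw [hnode j p hp, if_neg hji]; rfl
    simp only [interp, LinearMap.sum_apply, LinearMap.comp_apply, hloc]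
    rw [Finset.sum_eq_single i (fun j _ hji => by rw [if_neg hji, map_zero])
      (fun hi => absurd (Finset.mem_univ i) hi), if_pos rfl]
  have := hle hv
  rwa [LinearMap.mem_ker, LinearMap.sub_apply, LinearMap.id_apply, sub_eq_zero] at this

/-- A description by nodal values alone, so that membership is checked node by node from here on. -/
theorem mem_truncSpace_iff {N : Set Plane} {v : Plane → ℝ} :
    v ∈ S.truncSpace N ↔ S.interp v = v ∧ ∀ p ∈ S.allNodes, p ∉ N → v p = 0 := by
  constructor
  · rintro ⟨w, -, rfl⟩
    refine ⟨S.interp_interp _, fun p hp hpN => ?_⟩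
    change S.interp (cutoff N w) p = 0
    rw [S.interp_node _ hp]
    exact indicator_of_notMem hpN _
  · rintro ⟨hv, h0⟩
    refine ⟨v, S.mem_space_iff.2 hv, ?_⟩
    change S.interp (cutoff N v) = v
    refine (S.interp_congr fun p hp => ?_).trans hv
    change N.indicator v p = v p
    by_cases hpN : p ∈ N
    · rw [indicator_of_mem hpN]
    · rw [indicator_of_notMem hpN, h0 p hp hpN]

/-! Metric properties of the patches -/

theorem dist_le_of_mem_patch {i : Fin S.n} {x y : Plane} (hx : x ∈ S.patch i)
    (hy : y ∈ S.patch i) : dist x y ≤ σ * h :=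
  (Metric.dist_le_diam_of_mem (isBounded_openRect _ _ _) hx hy).trans (S.diam_le i)

theorem le_width (hσ : 0 < σ) (hh : 0 < h) (i : Fin S.n) (k : Fin 2) :
    h / σ ≤ S.hi i k - S.lo i k := by
  have hpos : 0 < h / σ := by positivity
  have hw := S.flat_width i
  have h1 : (S.frame i).symm (WithLp.toLp 2 (S.flatLo i)) ∈ S.patch i := by
    refine S.flat_subset_patch i fun k => ?_
    rw [LinearIsometryEquiv.apply_symm_apply]
    exact ⟨le_rfl, by linarith [hw k]⟩
  have h2 : (S.frame i).symm (WithLp.toLp 2 (S.flatHi i)) ∈ S.patch i := by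
    refine S.flat_subset_patch i fun k => ?_
    rw [LinearIsometryEquiv.apply_symm_apply]
    exact ⟨by linarith [hw k], le_rfl⟩
  have h3 := h1 k
  have h4 := h2 k
  rw [LinearIsometryEquiv.apply_symm_apply] at h3 h4
  linarith [hw k, h3.1, h4.2]

theorem le_diam (hσ : 0 < σ) (hh : 0 < h) (i : Fin S.n) : h / σ ≤ Metric.diam (S.patch i) := by
  have hpos : 0 < h / σ := by positivity
  have hw := S.flat_width i
  have h1 : (S.frame i).symm (WithLp.toLp 2 (S.flatLo i)) ∈ S.patch i := by
    refine S.flat_subset_patch i fun k => ?_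
    rw [LinearIsometryEquiv.apply_symm_apply]
    exact ⟨le_rfl, by linarith [hw k]⟩
  have h2 : (S.frame i).symm (WithLp.toLp 2 (S.flatHi i)) ∈ S.patch i := by
    refine S.flat_subset_patch i fun k => ?_
    rw [LinearIsometryEquiv.apply_symm_apply]
    exact ⟨by linarith [hw k], le_rfl⟩
  have h3 := Metric.dist_le_diam_of_mem (isBounded_openRect _ _ _) h2 h1
  rw [LinearIsometryEquiv.dist_map, dist_eq_norm] at h3
  have h4 := abs_coord_le_norm (WithLp.toLp 2 (S.flatHi i) - WithLp.toLp 2 (S.flatLo i)) 0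
  have h5 : (WithLp.toLp 2 (S.flatHi i) - WithLp.toLp 2 (S.flatLo i) : Plane) 0 =
      S.flatHi i 0 - S.flatLo i 0 := rfl
  rw [h5] at h4
  exact (hw 0).trans ((le_abs_self _).trans (h4.trans h3))

/-- Every patch contains a ball of radius comparable to the mesh size. -/
theorem exists_ball_subset_patch (hσ : 0 < σ) (hh : 0 < h) (i : Fin S.n) :
    ∃ c, Metric.ball c (h / (2 * σ)) ⊆ S.patch i := by
  refine ⟨(S.frame i).symm (WithLp.toLp 2 fun k => (S.lo i k + S.hi i k) / 2), fun x hx k => ?_⟩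
  have h1 := abs_coord_le_norm (S.frame i x - WithLp.toLp 2 fun k => (S.lo i k + S.hi i k) / 2) k
  rw [mem_ball_iff_norm, ← (S.frame i).norm_map, map_sub,
    LinearIsometryEquiv.apply_symm_apply] at hx
  have h2 : (S.frame i x - WithLp.toLp 2 fun k => (S.lo i k + S.hi i k) / 2 : Plane) k =
      S.frame i x k - (S.lo i k + S.hi i k) / 2 := rfl
  rw [h2] at h1
  have h3 := abs_lt.1 (h1.trans_lt hx)
  have h4 := S.le_width hσ hh i k
  have h5 : h / (2 * σ) = h / σ / 2 := by field_simp
  constructor <;> linarith [h3.1, h3.2]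

theorem hasCompactSupport_φ (i : Fin S.n) : HasCompactSupport (S.φ i) :=
  Metric.isCompact_of_isClosed_isBounded (isClosed_tsupport _)
    ((isBounded_openRect _ _ _).subset (S.φ_support i))

/-- At a boundary point inside the patch, `q` and its gradient vanish by the clamped condition.
Outside the patch, `φ i` and its gradient vanish. -/
theorem memW2Inf_indicator (hΩ : IsOpen Ω) {i : Fin S.n} {q : Plane → ℝ} (hq : q ∈ S.V i) :
    MemW2Inf (Ω.indicator fun x => S.φ i x * q x) := by
  have hqs := contDiff_of_mem_biquadratic (S.V_biquadratic i hq)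
  refine ((S.φ_mem i).mul_contDiff (S.hasCompactSupport_φ i) hqs).indicator hΩ fun x hx => ?_
  have hφd := (S.φ_mem i).differentiable
  have hqd : Differentiable ℝ q := hqs.differentiable (by simp)
  rw [fderiv_mul_fun hφd hqd]
  by_cases hxp : x ∈ S.patch i
  · obtain ⟨h1, h2⟩ := S.V_clamped i q hq x ⟨hx, hxp⟩
    simp [h1, h2]
  · have hz : x ∉ tsupport (S.φ i) := fun h => hxp (S.φ_support i h)
    have h1 : fderiv ℝ (S.φ i) x = 0 := by
      by_contra hne
      exact hz (support_fderiv_subset ℝ hne)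
    simp [h1, image_eq_zero_of_notMem_tsupport hz]

theorem memW2Inf_interp (hΩ : IsOpen Ω) (ζ : Plane → ℝ) : MemW2Inf (S.interp ζ) := by
  rw [interp_eq]
  exact MemW2Inf.sum _ fun i _ => S.memW2Inf_indicator hΩ (S.localInterp_mem i ζ)

theorem memW2Inf_of_mem_space (hΩ : IsOpen Ω) {v : Plane → ℝ} (hv : v ∈ S.space) : MemW2Inf v := by
  rw [← S.mem_space_iff.1 hv]
  exact S.memW2Inf_interp hΩ v

theorem eq_zero_of_mem_space {v : Plane → ℝ} (hv : v ∈ S.space) {x : Plane} (hx : x ∉ Ω) :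
    v x = 0 := by
  rw [← S.mem_space_iff.1 hv]
  exact S.interp_apply_of_notMem v hx

open Classical in
theorem card_patches_le (x : Plane) :
    ((Finset.univ.filter fun i => x ∈ S.patch i).card : ℝ) ≤ σ := by
  have := S.overlap x
  rwa [Set.ncard_eq_toFinset_card', Set.toFinset_ofPred] at this

/-- The points at which the derivatives of the partition of unity obey their bounds. -/
def RegularPoint (x : Plane) : Prop :=
  ∀ i, TwiceDiffAt (S.φ i) x ∧ ‖fderiv ℝ (S.φ i) x‖ ≤ σ * (σ / h) ∧
    ‖hessian (S.φ i) x‖ ≤ σ * (σ / h) ^ 2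

theorem norm_hessian_eq (u : Plane → ℝ) (x : Plane) :
    ‖iteratedFDeriv ℝ 2 u x‖ = ‖hessian u x‖ := by
  have h := norm_iteratedFDeriv_fderiv (𝕜 := ℝ) (f := u) (x := x) (n := 1)
  rw [norm_iteratedFDeriv_one] at h
  exact h.symm

/-- The diameter of a patch is at least `h / σ`, which converts the given bounds into powers of `σ /
h`. -/
theorem ae_regularPoint (hσ : 0 < σ) (hh : 0 < h) : ∀ᵐ x, S.RegularPoint x := by
  refine ae_all_iff.2 fun i => ?_
  have h1 := S.φ_bound i 1 (by norm_num)
  have h2 := S.φ_bound i 2 le_rfl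
  rw [SeminormLE, Measure.restrict_univ] at h1 h2
  have hd : h / σ ≤ Metric.diam (openRect (S.frame i) (S.lo i) (S.hi i)) := S.le_diam hσ hh i
  set d := Metric.diam (openRect (S.frame i) (S.lo i) (S.hi i))
  have hpos : 0 < h / σ := by positivity
  have hd0 : 0 < d := hpos.trans_le hd
  have hinv : d⁻¹ ≤ σ / h := by
    rw [← inv_div]; exact inv_anti₀ hpos hd
  filter_upwards [(S.φ_mem i).ae_twiceDiffAt, h1, h2] with x hx h1 h2
  refine ⟨hx, ?_, ?_⟩
  · rw [norm_iteratedFDeriv_one, pow_one, div_eq_mul_inv] at h1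
    exact h1.trans (mul_le_mul_of_nonneg_left hinv hσ.le)
  · rw [norm_hessian_eq, div_eq_mul_inv, ← inv_pow] at h2
    exact h2.trans (mul_le_mul_of_nonneg_left (pow_le_pow_left₀ (by positivity) hinv 2) hσ.le)

end PUM

/-! ### Energy estimates for the interpolation operator -/

theorem contDiff_affine (a : ℝ) (b : Plane) : ContDiff ℝ ∞ fun x : Plane => a + inner ℝ b x :=
  contDiff_const.add (innerSL ℝ b).contDiff

theorem hessian_affine (a : ℝ) (b : Plane) (x : Plane) :
    hessian (fun x : Plane => a + inner ℝ b x) x = 0 := by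
  have h : fderiv ℝ (fun x : Plane => a + inner ℝ b x) = fun _ => innerSL ℝ b := by
    funext y
    exact ((innerSL ℝ b).hasFDerivAt.const_add a).fderiv
  unfold hessian
  rw [h]
  exact fderiv_const_apply _

theorem norm_hessian_affine (a : ℝ) (b : Plane) (x : Plane) :
    ‖hessian (fun x : Plane => a + inner ℝ b x) x‖ = 0 := by
  rw [hessian_affine]
  exact ContinuousLinearMap.opNorm_zero

theorem norm_hessian_zero (x : Plane) : ‖hessian 0 x‖ = 0 := by
  rw [hessian_zero]
  exact ContinuousLinearMap.opNorm_zero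

theorem norm_hessian_add_le {u w : Plane → ℝ} {x : Plane} (hu : TwiceDiffAt u x)
    (hw : TwiceDiffAt w x) : ‖hessian (u + w) x‖ ≤ ‖hessian u x‖ + ‖hessian w x‖ := by
  rw [hessian_add hu hw]
  exact ContinuousLinearMap.opNorm_add_le _ _

theorem norm_hessian_sum_le {ι : Type*} (s : Finset ι) {u : ι → Plane → ℝ} {x : Plane}
    (hu : ∀ i ∈ s, TwiceDiffAt (u i) x) :
    ‖hessian (∑ i ∈ s, u i) x‖ ≤ ∑ i ∈ s, ‖hessian (u i) x‖ := by
  classical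
  induction s using Finset.induction_on with
  | empty => rw [Finset.sum_empty, Finset.sum_empty, norm_hessian_zero]
  | insert a s ha ih =>
    have hs : ∀ i ∈ s, TwiceDiffAt (u i) x := fun i hi => hu i (Finset.mem_insert_of_mem hi)
    rw [Finset.sum_insert ha, Finset.sum_insert ha]
    exact (norm_hessian_add_le (hu a (Finset.mem_insert_self _ _))
      (TwiceDiffAt.sum s hs).1).trans (by gcongr; exact ih hs)

namespace PUM

variable {Ω : Set Plane} {σ h : ℝ} (S : PUM Ω σ h)

/-- Rescaled nodal stability. For `t = 0` unisolvence gives `q = 0`. -/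
theorem abs_le_of_abs_nodes_le {i : Fin S.n} {q : Plane → ℝ} (hq : q ∈ S.V i) {t : ℝ}
    (ht : 0 ≤ t) (hn : ∀ p ∈ S.nodes i, |q p| ≤ t) {x : Plane} (hx : x ∈ S.patch i) :
    |q x| ≤ σ * t := by
  rcases ht.eq_or_lt with rfl | ht
  · have h0 : q = 0 := by
      rw [← S.localInterp_eq_of hq (ζ := 0) fun p hp => abs_nonpos_iff.1 (hn p hp), map_zero]
    simp [h0]
  · have h1 := S.nodes_stable i (t⁻¹ • q) ((S.V i).smul_mem _ hq) (fun p hp => ?_) x hx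
    · rw [Pi.smul_apply, smul_eq_mul, abs_mul, abs_of_pos (inv_pos.2 ht), inv_mul_le_iff₀ ht] at h1
      linarith
    · rw [Pi.smul_apply, smul_eq_mul, abs_mul, abs_of_pos (inv_pos.2 ht), inv_mul_le_iff₀ ht,
        mul_one]
      exact hn p hp

/-- The product rule gives `256σ² + 2·16σ³ + σ³`, which is at most `289σ³`. `q` need not lie in the
local space, because an affine function will be subtracted. -/
theorem norm_hessian_mul_φ_le (hσ : 1 ≤ σ) (hh : 0 < h) {x : Plane} (hx : x ∈ Ω)
    (hreg : S.RegularPoint x) {i : Fin S.n} (hxi : x ∈ S.patch i) {q : Plane → ℝ}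
    (hq : q ∈ biquadratic (S.frame i)) {m : ℝ} (hqm : ∀ y ∈ S.patch i, |q y| ≤ m) :
    ‖hessian (fun y => S.φ i y * q y) x‖ ≤ 289 * σ ^ 3 * m / h ^ 2 := by
  have hσ0 : 0 < σ := by linarith
  have hm : 0 ≤ m := (abs_nonneg _).trans (hqm x hxi)
  obtain ⟨ht, h1, h2⟩ := hreg i
  have hs : 0 < h / σ := by positivity
  have hw := S.le_width hσ0 hh i
  have g1 := norm_fderiv_biquadratic_le hq hs hw hqm hxi
  have g2 := norm_hessian_biquadratic_le hq hs hw hqm hxi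
  have hφ : |S.φ i x| ≤ 1 := abs_le.2 ⟨by linarith [S.φ_nonneg i x], S.φ_le_one i hx⟩
  refine (norm_hessian_mul_le ht
    (TwiceDiffAt.of_contDiff (contDiff_of_mem_biquadratic hq) x)).trans ?_
  have k1 : |S.φ i x| * ‖hessian q x‖ ≤ 1 * (256 * m / (h / σ) ^ 2) :=
    mul_le_mul hφ g2 (norm_hessian_nonneg q x) zero_le_one
  have k2 : ‖fderiv ℝ (S.φ i) x‖ * ‖fderiv ℝ q x‖ ≤ σ * (σ / h) * (16 * m / (h / σ)) :=
    mul_le_mul h1 g1 (norm_nonneg _) (by positivity)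
  have k3 : |q x| * ‖hessian (S.φ i) x‖ ≤ m * (σ * (σ / h) ^ 2) :=
    mul_le_mul (hqm x hxi) h2 (norm_hessian_nonneg _ x) hm
  have e : 1 * (256 * m / (h / σ) ^ 2) + 2 * (σ * (σ / h) * (16 * m / (h / σ))) +
      m * (σ * (σ / h) ^ 2) = (256 * σ ^ 2 + 33 * σ ^ 3) * (m / h ^ 2) := by
    field_simp
    ring
  have e2 : 289 * σ ^ 3 * m / h ^ 2 = (289 * σ ^ 3) * (m / h ^ 2) := by ring
  have hσ3 : σ ^ 2 ≤ σ ^ 3 := pow_le_pow_right₀ hσ (by norm_num)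
  have h5 : (256 * σ ^ 2 + 33 * σ ^ 3) * (m / h ^ 2) ≤ (289 * σ ^ 3) * (m / h ^ 2) :=
    mul_le_mul_of_nonneg_right (by linarith) (by positivity)
  linarith

/-- If the local interpolants on all the patches around `x` are close to one affine function, then
the interpolant has small second derivatives at `x`. -/
theorem norm_hessian_interp_le (hΩ : IsOpen Ω) (hσ : 1 ≤ σ) (hh : 0 < h) {x : Plane} (hx : x ∈ Ω)
    (hreg : S.RegularPoint x) {ζ : Plane → ℝ} {a m : ℝ} {b : Plane} (hm : 0 ≤ m)
    (hq : ∀ i, x ∈ S.patch i → ∀ y ∈ S.patch i, |S.localInterp i ζ y - (a + inner ℝ b y)| ≤ m) :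
    ‖hessian (S.interp ζ) x‖ ≤ 289 * σ ^ 4 * m / h ^ 2 := by
  classical
  set ℓ : Plane → ℝ := fun y => a + inner ℝ b y with hℓ
  set r : Fin S.n → Plane → ℝ := fun i y => S.φ i y * (S.localInterp i ζ - ℓ) y with hr
  have hbq : ∀ i, S.localInterp i ζ - ℓ ∈ biquadratic (S.frame i) := fun i =>
    Submodule.sub_mem _ (S.V_biquadratic i (S.localInterp_mem i ζ)) (affine_mem_biquadratic _ a b)
  -- The partition of unity reproduces `ℓ`, whose Hessian is zero. Only the local deviations from
  -- `ℓ` contribute.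
  have heq : S.interp ζ =ᶠ[nhds x] ℓ + ∑ i, r i := by
    filter_upwards [hΩ.mem_nhds hx] with y hy
    rw [S.interp_apply_of_mem ζ hy, Pi.add_apply, Finset.sum_apply]
    simp only [hr, Pi.sub_apply, mul_sub, Finset.sum_sub_distrib]
    rw [← Finset.sum_mul, S.φ_sum y hy]
    ring
  have htw : ∀ i, TwiceDiffAt (r i) x := fun i =>
    (hreg i).1.mul (TwiceDiffAt.of_contDiff (contDiff_of_mem_biquadratic (hbq i)) x)
  have hs1 := (TwiceDiffAt.sum Finset.univ fun i _ => htw i).1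
  have hzero : ∀ i, x ∉ S.patch i → ‖hessian (r i) x‖ = 0 := by
    intro i hxi
    have hz : x ∉ tsupport (S.φ i) := fun h => hxi (S.φ_support i h)
    have : r i =ᶠ[nhds x] 0 := by
      filter_upwards [(isClosed_tsupport (S.φ i)).isOpen_compl.mem_nhds hz] with y hy
      simp only [hr, image_eq_zero_of_notMem_tsupport hy, zero_mul, Pi.zero_apply]
    rw [hessian_congr this, norm_hessian_zero]
  calc ‖hessian (S.interp ζ) x‖ = ‖hessian (ℓ + ∑ i, r i) x‖ := by rw [hessian_congr heq]
    _ ≤ ‖hessian ℓ x‖ + ‖hessian (∑ i, r i) x‖ :=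
        norm_hessian_add_le (TwiceDiffAt.of_contDiff (contDiff_affine a b) x) hs1
    _ ≤ 0 + ∑ i, ‖hessian (r i) x‖ :=
        add_le_add (norm_hessian_affine a b x).le (norm_hessian_sum_le _ fun i _ => htw i)
    _ = ∑ i with x ∈ S.patch i, ‖hessian (r i) x‖ := by
        rw [zero_add]
        exact (Finset.sum_filter_of_ne
          (fun i _ hne => by by_contra hxi; exact hne (hzero i hxi))).symm
    _ ≤ ∑ i with x ∈ S.patch i, 289 * σ ^ 3 * m / h ^ 2 :=
        Finset.sum_le_sum fun i hi => S.norm_hessian_mul_φ_le hσ hh hx hreg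
          (Finset.mem_filter.1 hi).2 (hbq i) (hq i (Finset.mem_filter.1 hi).2)
    _ ≤ σ * (289 * σ ^ 3 * m / h ^ 2) := by
        rw [Finset.sum_const, nsmul_eq_mul]
        exact mul_le_mul_of_nonneg_right (S.card_patches_le x) (by positivity)
    _ = _ := by ring

theorem volume_patch_le (hσ : 0 < σ) (hh : 0 < h) (i : Fin S.n) :
    volume.real (S.patch i) ≤ 16 * (σ * h) ^ 2 := by
  obtain ⟨c, hc⟩ := S.exists_ball_subset_patch hσ hh i
  have hcp : c ∈ S.patch i := hc (Metric.mem_ball_self (by positivity))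
  have hsub : S.patch i ⊆ Metric.ball c (2 * (σ * h)) := fun y hy => by
    rw [Metric.mem_ball]
    have := S.dist_le_of_mem_patch hy hcp
    have : 0 < σ * h := by positivity
    linarith
  refine (measureReal_mono hsub measure_ball_lt_top.ne).trans ?_
  rw [volume_ball_real c (by positivity)]
  nlinarith [Real.pi_le_four, sq_nonneg (σ * h)]

/-- The sum of the squares of all the nodal values. -/
noncomputable def nodalSq (ζ : Plane → ℝ) : ℝ := ∑ i, ∑ p ∈ S.nodes i, ζ p ^ 2

/-- The inverse estimate: the nodal values control the energy, at the cost of the mesh size. -/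
theorem energy_interp_le_nodalSq (hΩ : IsPolygonalDomain Ω) (hh : 0 < h) (ζ : Plane → ℝ) :
    ∫ x in Ω, hessSq (S.interp ζ) x ≤
      64 * (289 * σ ^ 4) ^ 2 * σ ^ 4 / h ^ 2 * S.nodalSq ζ := by
  classical
  have hσ := S.one_le_sigma hΩ.nonempty
  have hσ0 : 0 < σ := by linarith
  set K := 4 * (289 * σ ^ 4) ^ 2 * σ ^ 2 / h ^ 4 with hK
  have hK0 : 0 ≤ K := by positivity
  have hw : MemW2Inf (S.interp ζ) := S.memW2Inf_interp hΩ.isOpen ζ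
  have hN : ∀ i, 0 ≤ ∑ p ∈ S.nodes i, ζ p ^ 2 := fun i => Finset.sum_nonneg fun p _ => sq_nonneg _
  have hpt : ∀ x ∈ Ω, S.RegularPoint x → hessSq (S.interp ζ) x ≤
      ∑ i, (S.patch i).indicator (fun _ => K * ∑ p ∈ S.nodes i, ζ p ^ 2) x := by
    intro x hx hreg
    set Q := ∑ i with x ∈ S.patch i, ∑ p ∈ S.nodes i, ζ p ^ 2 with hQ
    have hQ0 : 0 ≤ Q := Finset.sum_nonneg fun i _ => hN i
    -- The comparison is with the zero function: `√Q` dominates every nodal value in the patches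
    -- that contain `x`.
    have h1 := S.norm_hessian_interp_le hΩ.isOpen hσ hh hx hreg (ζ := ζ) (a := 0) (b := 0)
      (m := σ * √Q) (by positivity) (fun i hi y hy => ?_)
    · have e : ∑ i, (S.patch i).indicator (fun _ => K * ∑ p ∈ S.nodes i, ζ p ^ 2) x = K * Q := by
        rw [hQ, Finset.mul_sum, Finset.sum_filter]
        refine Finset.sum_congr rfl fun i _ => ?_
        rw [indicator_apply]
      rw [e]
      refine (hessSq_le_norm_sq _ _).trans ?_
      have h2 := pow_le_pow_left₀ (norm_hessian_nonneg _ x) h1 2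
      have e2 : 4 * (289 * σ ^ 4 * (σ * √Q) / h ^ 2) ^ 2 = K * Q := by
        rw [hK, div_pow, mul_pow, mul_pow σ, Real.sq_sqrt hQ0]
        field_simp
      linarith
    · rw [inner_zero_left, add_zero, sub_zero]
      refine S.abs_le_of_abs_nodes_le (S.localInterp_mem i ζ) (Real.sqrt_nonneg _)
        (fun p hp => ?_) hy
      rw [S.localInterp_node i ζ hp]
      refine Real.abs_le_sqrt ?_
      have h3 := Finset.single_le_sum (f := fun p => ζ p ^ 2) (fun p _ => sq_nonneg _) hp
      have h4 := Finset.single_le_sum (f := fun i => ∑ p ∈ S.nodes i, ζ p ^ 2)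
        (fun i _ => hN i) (Finset.mem_filter.2 ⟨Finset.mem_univ i, hi⟩ :
          i ∈ Finset.univ.filter fun i => x ∈ S.patch i)
      exact h3.trans h4
  have hmeas : ∀ i, MeasurableSet (S.patch i) := fun i => (S.isOpen_patch i).measurableSet
  have hfin : ∀ i, volume (S.patch i) ≠ ⊤ := fun i =>
    (isBounded_openRect _ _ _).measure_lt_top.ne
  have hint : ∀ i, Integrable ((S.patch i).indicator fun _ => K * ∑ p ∈ S.nodes i, ζ p ^ 2) :=
    fun i => (integrable_indicator_iff (hmeas i)).2 (integrableOn_const (hfin i))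
  calc ∫ x in Ω, hessSq (S.interp ζ) x
      ≤ ∫ x in Ω, ∑ i, (S.patch i).indicator (fun _ => K * ∑ p ∈ S.nodes i, ζ p ^ 2) x := by
        refine integral_mono_ae (hw.integrableOn_hessSq hΩ.volume_lt_top)
          (integrable_finsetSum _ fun i _ => (hint i).integrableOn) ?_
        filter_upwards [ae_restrict_mem hΩ.isOpen.measurableSet,
          ae_restrict_of_ae (S.ae_regularPoint hσ0 hh)] with x hx hreg using hpt x hx hreg
    _ ≤ ∫ x, ∑ i, (S.patch i).indicator (fun _ => K * ∑ p ∈ S.nodes i, ζ p ^ 2) x :=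
        setIntegral_le_integral (integrable_finsetSum _ fun i _ => hint i)
          (Filter.Eventually.of_forall fun x => Finset.sum_nonneg fun i _ =>
            indicator_nonneg (fun _ _ => mul_nonneg hK0 (hN i)) x)
    _ = ∑ i, volume.real (S.patch i) * (K * ∑ p ∈ S.nodes i, ζ p ^ 2) := by
        rw [integral_finsetSum _ fun i _ => hint i]
        refine Finset.sum_congr rfl fun i _ => ?_
        rw [integral_indicator (hmeas i), setIntegral_const, smul_eq_mul]
    _ ≤ ∑ i, 16 * (σ * h) ^ 2 * (K * ∑ p ∈ S.nodes i, ζ p ^ 2) :=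
        Finset.sum_le_sum fun i _ => mul_le_mul_of_nonneg_right (S.volume_patch_le hσ0 hh i)
          (mul_nonneg hK0 (hN i))
    _ = _ := by
        rw [← Finset.mul_sum, ← Finset.mul_sum, nodalSq, hK]
        field_simp
        ring

end PUM

/-! ### Stability of the interpolation operator and the coarse approximation -/

theorem lintegral_lintegral_ball {G : Plane → ENNReal} (hG : Measurable G) (R : ℝ) :
    ∫⁻ x : Plane, ∫⁻ y in Metric.ball x R, G y = volume (Metric.ball (0 : Plane) R) * ∫⁻ y, G y := by
  have hm : MeasurableSet {p : Plane × Plane | p.2 ∈ Metric.ball p.1 R} :=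
    (isOpen_lt (f := fun p : Plane × Plane => dist p.2 p.1) (g := fun _ => R) (by fun_prop)
      continuous_const).measurableSet
  have hmeas : Measurable fun p : Plane × Plane =>
      {p : Plane × Plane | p.2 ∈ Metric.ball p.1 R}.indicator (fun p => G p.2) p :=
    (hG.comp measurable_snd).indicator hm
  have e1 : ∀ x : Plane, ∫⁻ y in Metric.ball x R, G y = ∫⁻ y,
      {p : Plane × Plane | p.2 ∈ Metric.ball p.1 R}.indicator (fun p => G p.2) (x, y) := by
    intro x
    rw [← lintegral_indicator measurableSet_ball]
    rfl
  have e2 : ∀ y : Plane, ∫⁻ x : Plane,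
      {p : Plane × Plane | p.2 ∈ Metric.ball p.1 R}.indicator (fun p => G p.2) (x, y) =
        volume (Metric.ball (0 : Plane) R) * G y := by
    intro y
    have e3 : ∀ x : Plane, {p : Plane × Plane | p.2 ∈ Metric.ball p.1 R}.indicator
        (fun p => G p.2) (x, y) = (Metric.ball y R).indicator (fun _ => G y) x := by
      intro x
      by_cases hx : x ∈ Metric.ball y R
      · rw [indicator_of_mem hx, indicator_of_mem]
        exact Metric.mem_ball_comm.1 hx
      · rw [indicator_of_notMem hx, indicator_of_notMem]
        exact fun h => hx (Metric.mem_ball_comm.1 h)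
    simp only [e3]
    rw [lintegral_indicator measurableSet_ball, setLIntegral_const, Measure.addHaar_ball_center,
      mul_comm]
  simp only [e1]
  rw [lintegral_lintegral_swap hmeas.aemeasurable]
  simp only [e2]
  rw [lintegral_const_mul _ hG]

/-- Tonelli: each `y` lies in the balls centred in a set of area `πR²`. This turns local pointwise
bounds into a global one. -/
theorem integral_le_of_le_integral_ball {U : Set Plane} {f g : Plane → ℝ}
    (hf : IntegrableOn f U) (hf0 : ∀ x, 0 ≤ f x) (hg : Integrable g) (hgm : Measurable g)
    (hg0 : ∀ x, 0 ≤ g x) {K R : ℝ} (hK : 0 ≤ K) (hR : 0 ≤ R)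
    (h : ∀ᵐ x ∂volume.restrict U, f x ≤ K * ∫ y in Metric.ball x R, g y) :
    ∫ x in U, f x ≤ K * (Real.pi * R ^ 2) * ∫ y, g y := by
  have hI : 0 ≤ ∫ y, g y := integral_nonneg hg0
  rw [← ENNReal.ofReal_le_ofReal_iff (by positivity),
    ofReal_integral_eq_lintegral_ofReal hf (Filter.Eventually.of_forall hf0)]
  calc ∫⁻ x in U, ENNReal.ofReal (f x)
      ≤ ∫⁻ x in U, ENNReal.ofReal K * ∫⁻ y in Metric.ball x R, ENNReal.ofReal (g y) := by
        refine lintegral_mono_ae (h.mono fun x hx => ?_)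
        rw [← ofReal_integral_eq_lintegral_ofReal hg.integrableOn
          (Filter.Eventually.of_forall hg0), ← ENNReal.ofReal_mul hK]
        exact ENNReal.ofReal_le_ofReal hx
    _ ≤ ∫⁻ x, ENNReal.ofReal K * ∫⁻ y in Metric.ball x R, ENNReal.ofReal (g y) :=
        setLIntegral_le_lintegral _ _
    _ = ENNReal.ofReal K * (volume (Metric.ball (0 : Plane) R) * ∫⁻ y, ENNReal.ofReal (g y)) := by
        rw [lintegral_const_mul' _ _ ENNReal.ofReal_ne_top,
          lintegral_lintegral_ball hgm.ennreal_ofReal]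
    _ = ENNReal.ofReal (K * (Real.pi * R ^ 2) * ∫ y, g y) := by
        rw [← ofReal_integral_eq_lintegral_ofReal hg (Filter.Eventually.of_forall hg0),
          ← ofReal_measureReal measure_ball_lt_top.ne, volume_ball_real 0 hR,
          ← ENNReal.ofReal_mul (by positivity), ← ENNReal.ofReal_mul hK]
        congr 1
        ring

theorem setIntegral_hessSq_mono {u : Plane → ℝ} (hu : MemW2Inf u) {x y : Plane} {r R : ℝ}
    (hsub : Metric.ball y r ⊆ Metric.ball x R) :
    ∫ z in Metric.ball y r, hessSq u z ≤ ∫ z in Metric.ball x R, hessSq u z :=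
  setIntegral_mono_set (hu.integrableOn_hessSq measure_ball_lt_top)
    (Filter.Eventually.of_forall fun z => hessSq_nonneg u z) hsub.eventuallyLE

namespace PUM

variable {Ω : Set Plane} {σ h : ℝ} (S : PUM Ω σ h)

theorem exists_frontier_mem_patch (hΩ : IsOpen Ω) {i : Fin S.n} {x : Plane} (hx : x ∈ Ω)
    (hxi : x ∈ S.patch i) (hi : ¬ S.patch i ⊆ Ω) : ∃ z ∈ S.patch i, z ∈ frontier Ω := by
  obtain ⟨y, hy, hyΩ⟩ := not_subset.1 hi
  obtain ⟨z, hz, hzf⟩ := exists_mem_segment_frontier hΩ hx hyΩ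
  exact ⟨z, (convex_openRect _ _ _).segment_subset hxi hy hz, hzf⟩

/-- Around each point the local interpolants are close to one affine function. -/
theorem exists_affine_near (hΩ : IsPolygonalDomain Ω) (hh : 0 < h) {C : ℝ} (hC : 16 ≤ C)
    (hfr : ∀ u, MemW2Inf u → (∀ x ∉ Ω, u x = 0) → ∀ x₀ ∈ frontier Ω, ∀ r, 0 < r →
      r ≤ 3 * (σ * h) → ∀ x ∈ Metric.ball x₀ r,
        u x ^ 2 ≤ C * r ^ 2 * ∫ z in Metric.ball x₀ r, hessSq u z)
    {u : Plane → ℝ} (hu : MemW2Inf u) (hu0 : ∀ x ∉ Ω, u x = 0) {x : Plane} (hx : x ∈ Ω) :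
    ∃ (a : ℝ) (b : Plane), ∀ i, x ∈ S.patch i → ∀ y ∈ S.patch i,
      |S.localInterp i u y - (a + inner ℝ b y)| ≤
        σ * √(9 * C * (σ * h) ^ 2 * ∫ z in Metric.ball x (4 * (σ * h)), hessSq u z) := by
  have hσ := S.one_le_sigma hΩ.nonempty
  have hσh : 0 < σ * h := by positivity
  set E := ∫ z in Metric.ball x (4 * (σ * h)), hessSq u z with hE
  have hE0 : 0 ≤ E := integral_nonneg fun z => hessSq_nonneg u z
  -- If all the patches at `x` are interior, affine functions belong to the local spaces and the
  -- interpolation error is controlled by nodal errors. Otherwise a boundary point is within `σh` of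
  -- `x`, and zero is the affine function to compare with, on all the patches at once.
  by_cases hall : ∀ i, x ∈ S.patch i → S.patch i ⊆ Ω
  · obtain ⟨a, b, hab⟩ := exists_affine_approx hu x (R := 2 * (σ * h)) (by positivity)
    refine ⟨a, b, fun i hi y hy => ?_⟩
    have hℓ : (fun y => a + inner ℝ b y) ∈ S.V i := S.V_interior i (hall i hi) a b
    refine S.abs_le_of_abs_nodes_le (q := S.localInterp i u - fun y => a + inner ℝ b y)
      ((S.V i).sub_mem (S.localInterp_mem i u) hℓ) (Real.sqrt_nonneg _) (fun p hp => ?_) hy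
    rw [Pi.sub_apply, S.localInterp_node i u hp]
    refine Real.abs_le_sqrt ?_
    have hpx := S.dist_le_of_mem_patch (S.node_mem_patch hp) hi
    refine (hab p (by rw [Metric.mem_ball]; linarith)).trans ?_
    have h1 : ∫ z in Metric.ball x (2 * (σ * h)), hessSq u z ≤ E :=
      setIntegral_hessSq_mono hu (Metric.ball_subset_ball (by linarith))
    calc 16 * (2 * (σ * h)) ^ 2 * ∫ z in Metric.ball x (2 * (σ * h)), hessSq u z
        ≤ 16 * (2 * (σ * h)) ^ 2 * E := by gcongr
      _ = 64 * ((σ * h) ^ 2 * E) := by ring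
      _ ≤ (9 * C) * ((σ * h) ^ 2 * E) := by gcongr; linarith
      _ = _ := by ring
  · push Not at hall
    obtain ⟨i₀, hi₀, hni₀⟩ := hall
    obtain ⟨x₀, hx₀, hx₀f⟩ := S.exists_frontier_mem_patch hΩ.isOpen hx hi₀ hni₀
    have hd := S.dist_le_of_mem_patch hx₀ hi₀
    refine ⟨0, 0, fun i hi y hy => ?_⟩
    rw [inner_zero_left, add_zero, sub_zero]
    refine S.abs_le_of_abs_nodes_le (S.localInterp_mem i u) (Real.sqrt_nonneg _)
      (fun p hp => ?_) hy
    rw [S.localInterp_node i u hp]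
    refine Real.abs_le_sqrt ?_
    have hpx := S.dist_le_of_mem_patch (S.node_mem_patch hp) hi
    have hpx₀ : p ∈ Metric.ball x₀ (3 * (σ * h)) := by
      rw [Metric.mem_ball]
      have := dist_triangle p x x₀
      rw [dist_comm x x₀] at this
      linarith
    refine (hfr u hu hu0 x₀ hx₀f _ (by positivity) le_rfl p hpx₀).trans ?_
    have h1 : ∫ z in Metric.ball x₀ (3 * (σ * h)), hessSq u z ≤ E :=
      setIntegral_hessSq_mono hu (Metric.ball_subset_ball' (by linarith))
    calc C * (3 * (σ * h)) ^ 2 * ∫ z in Metric.ball x₀ (3 * (σ * h)), hessSq u z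
        ≤ C * (3 * (σ * h)) ^ 2 * E := by gcongr
      _ = _ := by ring

/-- The interpolation operator is stable in the energy norm, uniformly in the mesh size. -/
theorem exists_energy_interp_le {Ω : Set Plane} (hΩ : IsPolygonalDomain Ω) (σ h₀ : ℝ) :
    ∃ C : ℝ, 0 < C ∧ ∀ (h : ℝ), 0 < h → h ≤ h₀ → ∀ (S : PUM Ω σ h) (u : Plane → ℝ), MemW2Inf u →
      (∀ x ∉ Ω, u x = 0) → ∫ x in Ω, hessSq (S.interp u) x ≤ C * ∫ x in Ω, hessSq u x := by
  obtain ⟨C₀, hC₀, hfr⟩ := hΩ.sq_le_near_frontier (3 * (σ * h₀))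
  set C₁ := max C₀ 16 with hC₁
  have hC₁0 : 0 < C₁ := hC₀.trans_le (le_max_left _ _)
  -- The maximum with `1` keeps the constant positive for `σ = 0`: the bound `σ ≥ 1` is known only
  -- once a discretization is given.
  refine ⟨max (36 * C₁ * (289 * σ ^ 4) ^ 2 * σ ^ 6 * (16 * Real.pi)) 1,
    lt_max_of_lt_right one_pos, fun h hh hh₀ S u hu hu0 => ?_⟩
  have hσ := S.one_le_sigma hΩ.nonempty
  have hσ0 : 0 < σ := by linarith
  have hfr' : ∀ u, MemW2Inf u → (∀ x ∉ Ω, u x = 0) → ∀ x₀ ∈ frontier Ω, ∀ r, 0 < r →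
      r ≤ 3 * (σ * h) → ∀ x ∈ Metric.ball x₀ r,
        u x ^ 2 ≤ C₁ * r ^ 2 * ∫ z in Metric.ball x₀ r, hessSq u z := by
    intro u hu hu0 x₀ hx₀ r hr hrh x hx
    refine (hfr u hu hu0 x₀ hx₀ r hr (hrh.trans (by gcongr)) x hx).trans ?_
    have : 0 ≤ ∫ z in Metric.ball x₀ r, hessSq u z := integral_nonneg fun z => hessSq_nonneg u z
    gcongr
    exact le_max_left _ _
  set K := 36 * C₁ * (289 * σ ^ 4) ^ 2 * σ ^ 4 / h ^ 2 with hK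
  have hpt : ∀ x ∈ Ω, S.RegularPoint x → hessSq (S.interp u) x ≤
      K * ∫ z in Metric.ball x (4 * (σ * h)), hessSq u z := by
    intro x hx hreg
    obtain ⟨a, b, hab⟩ := S.exists_affine_near hΩ hh (le_max_right _ _) hfr' hu hu0 hx
    have h1 := S.norm_hessian_interp_le hΩ.isOpen hσ hh hx hreg (by positivity) hab
    have hE0 : 0 ≤ ∫ z in Metric.ball x (4 * (σ * h)), hessSq u z :=
      integral_nonneg fun z => hessSq_nonneg u z
    refine (hessSq_le_norm_sq _ _).trans ?_
    have h2 := pow_le_pow_left₀ (norm_hessian_nonneg _ x) h1 2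
    refine (mul_le_mul_of_nonneg_left h2 (by norm_num)).trans_eq ?_
    rw [div_pow, mul_pow, mul_pow σ, Real.sq_sqrt (by positivity), hK]
    field_simp
    ring
  have hmain := integral_le_of_le_integral_ball (U := Ω) (K := K) (R := 4 * (σ * h))
    ((S.memW2Inf_interp hΩ.isOpen u).integrableOn_hessSq hΩ.volume_lt_top)
    (hessSq_nonneg _) (hΩ.integrable_hessSq hu hu0) (measurable_hessSq u) (hessSq_nonneg u)
    (by positivity) (by positivity) (by
      filter_upwards [ae_restrict_mem hΩ.isOpen.measurableSet,
        ae_restrict_of_ae (S.ae_regularPoint hσ0 hh)] with x hx hreg using hpt x hx hreg)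
  rw [hΩ.integral_hessSq hu0] at hmain
  refine hmain.trans (mul_le_mul_of_nonneg_right ?_ (integral_nonneg fun z => hessSq_nonneg u z))
  refine le_trans (le_of_eq ?_) (le_max_left _ _)
  rw [hK]
  field_simp
  ring

/-! The number of nodes -/

/-- Evaluation at the nodes maps the local space onto all the value vectors, and biquadratic
polynomials have dimension at most `9`. -/
theorem card_nodes_le (i : Fin S.n) : (S.nodes i).card ≤ 9 := by
  classical
  let ev : S.V i →ₗ[ℝ] ({p // p ∈ S.nodes i} → ℝ) :=
    (LinearMap.funLeft ℝ ℝ (Subtype.val : {p // p ∈ S.nodes i} → Plane)).comp (S.V i).subtype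
  have hsurj : Function.Surjective ev := by
    intro c
    refine ⟨⟨S.localInterp i fun p => if hp : p ∈ S.nodes i then c ⟨p, hp⟩ else 0,
      S.localInterp_mem i _⟩, funext fun p => ?_⟩
    have := S.localInterp_node i (fun p => if hp : p ∈ S.nodes i then c ⟨p, hp⟩ else 0) p.2
    refine this.trans ?_
    exact dif_pos p.2
  have hfin : FiniteDimensional ℝ (biquadratic (S.frame i)) := by
    unfold biquadratic
    exact FiniteDimensional.span_of_finite ℝ (Set.finite_range _)
  have hfinV : FiniteDimensional ℝ (S.V i) :=
    Submodule.finiteDimensional_of_le (S.V_biquadratic i)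
  have h1 := LinearMap.finrank_le_finrank_of_surjective hsurj
  rw [Module.finrank_fintype_fun_eq_card] at h1
  have h2 : Module.finrank ℝ (S.V i) ≤ Module.finrank ℝ (biquadratic (S.frame i)) :=
    Submodule.finrank_mono (S.V_biquadratic i)
  have h3 : Module.finrank ℝ (biquadratic (S.frame i)) ≤ 9 := by
    unfold biquadratic
    exact (finrank_range_le_card _).trans (by simp)
  have h4 : Fintype.card {p // p ∈ S.nodes i} = (S.nodes i).card := by simp
  omega

open Classical in
/-- The number of nodes in a ball. -/
theorem sum_card_nodes_ball_le (hσ : 0 < σ) (hh : 0 < h) (y : Plane) {R : ℝ} (hR : 0 ≤ R) :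
    (∑ i, ((S.nodes i).filter fun p => y ∈ Metric.ball p R).card : ℝ) ≤
      36 * σ ^ 3 * (R + σ * h) ^ 2 / h ^ 2 := by
  -- A packing argument: patches with a node in question lie in this ball, overlap at most `σ` times
  -- and have area at least `π (h/2σ)²`. Comparing areas bounds their number, and each has at most
  -- `9` nodes.
  set I := Finset.univ.filter fun i => S.patch i ⊆ Metric.closedBall y (R + σ * h) with hI
  have hsub : ∀ i, ((S.nodes i).filter fun p => y ∈ Metric.ball p R).card ≤
      if i ∈ I then 9 else 0 := by
    intro i
    split_ifs with hi
    · exact (Finset.card_filter_le _ _).trans (S.card_nodes_le i)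
    · rw [Nat.le_zero, Finset.card_eq_zero, Finset.filter_eq_empty_iff]
      intro p hp hyp
      refine hi (Finset.mem_filter.2 ⟨Finset.mem_univ i, fun z hz => ?_⟩)
      rw [Metric.mem_closedBall]
      have h1 := S.dist_le_of_mem_patch hz (S.node_mem_patch hp)
      have h2 := Metric.mem_ball'.1 hyp
      linarith [dist_triangle z p y]
  have hσh : 0 < σ * h := by positivity
  set B := Metric.closedBall y (R + σ * h) with hB
  have hBv : volume.real B = Real.pi * (R + σ * h) ^ 2 := by
    rw [hB, measureReal_def, Measure.addHaar_closedBall_eq_addHaar_ball, ← measureReal_def,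
      volume_ball_real y (by positivity)]
  have hmeas : ∀ i, MeasurableSet (S.patch i) := fun i => (S.isOpen_patch i).measurableSet
  have hfin : ∀ i, volume (S.patch i) ≠ ⊤ := fun i =>
    (isBounded_openRect _ _ _).measure_lt_top.ne
  have hBfin : volume B ≠ ⊤ := (isCompact_closedBall _ _).measure_lt_top.ne
  have hint : ∀ i, Integrable ((S.patch i).indicator fun _ => (1 : ℝ)) :=
    fun i => (integrable_indicator_iff (hmeas i)).2 (integrableOn_const (hfin i))
  have h1 : ∑ i ∈ I, volume.real (S.patch i) ≤ σ * volume.real B := by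
    calc ∑ i ∈ I, volume.real (S.patch i)
        = ∑ i ∈ I, ∫ x in B, (S.patch i).indicator (fun _ => (1 : ℝ)) x := by
          refine Finset.sum_congr rfl fun i hi => ?_
          rw [setIntegral_indicator (hmeas i), setIntegral_const, smul_eq_mul, mul_one,
            inter_eq_self_of_subset_right (Finset.mem_filter.1 hi).2]
      _ = ∫ x in B, ∑ i ∈ I, (S.patch i).indicator (fun _ => (1 : ℝ)) x :=
          (integral_finsetSum _ fun i _ => (hint i).integrableOn).symm
      _ ≤ ∫ x in B, σ := by
          refine integral_mono (integrable_finsetSum _ fun i _ => (hint i).integrableOn)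
            (integrableOn_const hBfin) fun x => ?_
          refine le_trans ?_ (S.card_patches_le x)
          rw [Finset.card_filter, Nat.cast_sum]
          refine (Finset.sum_le_sum_of_subset_of_nonneg (Finset.subset_univ I)
            (fun i _ _ => indicator_nonneg (fun _ _ => zero_le_one) x)).trans_eq ?_
          refine Finset.sum_congr rfl fun i _ => ?_
          rw [indicator_apply]
          split_ifs <;> simp
      _ = σ * volume.real B := by rw [setIntegral_const, smul_eq_mul, mul_comm]
  have h2 : ∀ i, Real.pi * (h / (2 * σ)) ^ 2 ≤ volume.real (S.patch i) := by
    intro i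
    obtain ⟨c, hc⟩ := S.exists_ball_subset_patch hσ hh i
    rw [← volume_ball_real c (by positivity)]
    exact measureReal_mono hc (hfin i)
  have h3 : (I.card : ℝ) * (Real.pi * (h / (2 * σ)) ^ 2) ≤ σ * (Real.pi * (R + σ * h) ^ 2) := by
    rw [← hBv, ← nsmul_eq_mul, ← Finset.sum_const]
    exact (Finset.sum_le_sum fun i _ => h2 i).trans h1
  have h4 : (I.card : ℝ) ≤ 4 * σ ^ 3 * (R + σ * h) ^ 2 / h ^ 2 := by
    rw [le_div_iff₀ (by positivity)]
    have e : (I.card : ℝ) * (Real.pi * (h / (2 * σ)) ^ 2) =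
        (I.card * h ^ 2) * (Real.pi / (4 * σ ^ 2)) := by field_simp; ring
    have e' : σ * (Real.pi * (R + σ * h) ^ 2) =
        (4 * σ ^ 3 * (R + σ * h) ^ 2) * (Real.pi / (4 * σ ^ 2)) := by field_simp
    rw [e, e'] at h3
    exact le_of_mul_le_mul_right h3 (by have := Real.pi_pos; positivity)
  calc (∑ i, ((S.nodes i).filter fun p => y ∈ Metric.ball p R).card : ℝ)
      ≤ ∑ i, ((if i ∈ I then 9 else 0 : ℕ) : ℝ) :=
        Finset.sum_le_sum fun i _ => by exact_mod_cast hsub i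
    _ = 9 * I.card := by
        rw [← Nat.cast_sum, Finset.sum_ite_mem, Finset.univ_inter, Finset.sum_const, smul_eq_mul]
        push_cast
        ring
    _ ≤ 9 * (4 * σ ^ 3 * (R + σ * h) ^ 2 / h ^ 2) := by gcongr
    _ = _ := by ring

end PUM

/-! ### Approximation of clamped functions at the fine nodes by the coarse space -/

namespace PUM

variable {Ω : Set Plane} {σ h : ℝ} (S : PUM Ω σ h)

/-- Sums over the nodes of integrals over balls are controlled by the number of nodes in a ball. -/
theorem sum_nodes_integral_ball_le (hσ : 0 < σ) (hh : 0 < h) {g : Plane → ℝ} (hg : Integrable g)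
    (hg0 : ∀ x, 0 ≤ g x) {R : ℝ} (hR : 0 ≤ R) :
    ∑ i, ∑ p ∈ S.nodes i, ∫ y in Metric.ball p R, g y ≤
      36 * σ ^ 3 * (R + σ * h) ^ 2 / h ^ 2 * ∫ y, g y := by
  classical
  have hi : ∀ p : Plane, Integrable ((Metric.ball p R).indicator g) := fun p =>
    hg.indicator measurableSet_ball
  calc ∑ i, ∑ p ∈ S.nodes i, ∫ y in Metric.ball p R, g y
      = ∫ y, ∑ i, ∑ p ∈ S.nodes i, (Metric.ball p R).indicator g y := by
        rw [integral_finsetSum _ fun i _ => integrable_finsetSum _ fun p _ => hi p]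
        refine Finset.sum_congr rfl fun i _ => ?_
        rw [integral_finsetSum _ fun p _ => hi p]
        exact Finset.sum_congr rfl fun p _ => (integral_indicator measurableSet_ball).symm
    _ ≤ ∫ y, 36 * σ ^ 3 * (R + σ * h) ^ 2 / h ^ 2 * g y := by
        refine integral_mono (integrable_finsetSum _ fun i _ => integrable_finsetSum _
          fun p _ => hi p) (hg.const_mul _) fun y => ?_
        refine le_trans (le_of_eq ?_) (mul_le_mul_of_nonneg_right
          (S.sum_card_nodes_ball_le hσ hh y hR) (hg0 y))
        rw [Finset.sum_mul]
        refine Finset.sum_congr rfl fun i _ => ?_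
        rw [Finset.card_filter, Nat.cast_sum, Finset.sum_mul]
        refine Finset.sum_congr rfl fun p _ => ?_
        rw [indicator_apply]
        split_ifs <;> simp
    _ = _ := integral_const_mul _ _

/-- Functions vanishing off the domain are approximated by the partition of unity space. -/
theorem exists_space_approx {Ω : Set Plane} (hΩ : IsPolygonalDomain Ω) (σ H₀ : ℝ) :
    ∃ C : ℝ, 0 < C ∧ ∀ (H : ℝ), 0 < H → H ≤ H₀ → ∀ (SH : PUM Ω σ H) (v : Plane → ℝ), MemW2Inf v →
      (∀ x ∉ Ω, v x = 0) → ∃ ζ ∈ SH.space, ∀ p ∈ Ω,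
        (v p - ζ p) ^ 2 ≤ C * H ^ 2 * ∫ y in Metric.ball p (4 * (σ * H)), hessSq v y := by
  classical
  obtain ⟨C₀, hC₀, hfr⟩ := hΩ.sq_le_near_frontier (2 * (σ * H₀))
  set C₁ := max C₀ 16 with hC₁
  have hC₁0 : 0 < C₁ := hC₀.trans_le (le_max_left _ _)
  refine ⟨max (4 * C₁ * σ ^ 2) 1, lt_max_of_lt_right one_pos, fun H hH hHH₀ SH v hv hv0 => ?_⟩
  have hσ := SH.one_le_sigma hΩ.nonempty
  have hσ0 : 0 < σ := by linarith
  have hσH : 0 < σ * H := by positivity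
  have hE0 : ∀ (p : Plane) (R : ℝ), 0 ≤ ∫ y in Metric.ball p R, hessSq v y := fun p R =>
    integral_nonneg fun z => hessSq_nonneg v z
  -- The local approximant is affine on interior patches. It is zero on patches that meet the
  -- boundary, where `v` itself is small.
  have hk : ∀ k : Fin SH.n, ∃ z ∈ SH.V k, ∀ p ∈ Ω, p ∈ SH.patch k →
      (v p - z p) ^ 2 ≤ 4 * C₁ * (σ * H) ^ 2 *
        ∫ y in Metric.ball p (4 * (σ * H)), hessSq v y := by
    intro k
    by_cases hin : SH.patch k ⊆ Ω
    · obtain ⟨c, hc⟩ := SH.exists_ball_subset_patch hσ0 hH k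
      have hck : c ∈ SH.patch k := hc (Metric.mem_ball_self (by positivity))
      obtain ⟨a, b, hab⟩ := exists_affine_approx hv c (R := 2 * (σ * H)) (by positivity)
      refine ⟨_, SH.V_interior k hin a b, fun p _ hpk => ?_⟩
      have hd := SH.dist_le_of_mem_patch hpk hck
      refine (hab p (by rw [Metric.mem_ball]; linarith)).trans ?_
      have h1 : ∫ y in Metric.ball c (2 * (σ * H)), hessSq v y ≤
          ∫ y in Metric.ball p (4 * (σ * H)), hessSq v y :=
        setIntegral_hessSq_mono hv (Metric.ball_subset_ball' (by rw [dist_comm]; linarith))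
      calc 16 * (2 * (σ * H)) ^ 2 * ∫ y in Metric.ball c (2 * (σ * H)), hessSq v y
          ≤ C₁ * (2 * (σ * H)) ^ 2 * ∫ y in Metric.ball p (4 * (σ * H)), hessSq v y := by
            gcongr
            · exact hE0 _ _
            · exact le_max_right _ _
        _ = _ := by ring
    · refine ⟨0, Submodule.zero_mem _, fun p hp hpk => ?_⟩
      obtain ⟨x₀, hx₀, hx₀f⟩ := SH.exists_frontier_mem_patch hΩ.isOpen hp hpk hin
      have hd := SH.dist_le_of_mem_patch hpk hx₀
      rw [Pi.zero_apply, sub_zero]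
      refine (hfr v hv hv0 x₀ hx₀f (2 * (σ * H)) (by positivity) (by gcongr) p
        (by rw [Metric.mem_ball]; linarith)).trans ?_
      have h1 : ∫ y in Metric.ball x₀ (2 * (σ * H)), hessSq v y ≤
          ∫ y in Metric.ball p (4 * (σ * H)), hessSq v y :=
        setIntegral_hessSq_mono hv (Metric.ball_subset_ball' (by rw [dist_comm]; linarith))
      calc C₀ * (2 * (σ * H)) ^ 2 * ∫ y in Metric.ball x₀ (2 * (σ * H)), hessSq v y
          ≤ C₁ * (2 * (σ * H)) ^ 2 * ∫ y in Metric.ball p (4 * (σ * H)), hessSq v y := by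
            gcongr
            · exact hE0 _ _
            · exact le_max_left _ _
        _ = _ := by ring
  choose z hzV hz using hk
  refine ⟨∑ k, SH.lift k (z k), Submodule.sum_mem _ fun k _ =>
    Submodule.mem_iSup_of_mem k (Submodule.mem_map_of_mem (hzV k)), fun p hp => ?_⟩
  set m := 4 * C₁ * (σ * H) ^ 2 * ∫ y in Metric.ball p (4 * (σ * H)), hessSq v y with hm
  have hm0 : 0 ≤ m := mul_nonneg (by positivity) (hE0 _ _)
  -- The global error is a convex combination of the local errors.
  have e : v p - (∑ k, SH.lift k (z k)) p = ∑ k, SH.φ k p * (v p - z k p) := by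
    simp only [mul_sub, Finset.sum_sub_distrib]
    rw [← Finset.sum_mul, SH.φ_sum p hp, one_mul, Finset.sum_apply]
    congr 1
    refine Finset.sum_congr rfl fun k _ => ?_
    change Ω.indicator (fun x => SH.φ k x * z k x) p = _
    exact indicator_of_mem hp _
  have habs : |v p - (∑ k, SH.lift k (z k)) p| ≤ √m := by
    rw [e]
    refine (Finset.abs_sum_le_sum_abs _ _).trans ?_
    calc ∑ k, |SH.φ k p * (v p - z k p)| ≤ ∑ k, SH.φ k p * √m := by
          refine Finset.sum_le_sum fun k _ => ?_
          rw [abs_mul, abs_of_nonneg (SH.φ_nonneg k p)]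
          by_cases hpk : p ∈ SH.patch k
          · exact mul_le_mul_of_nonneg_left (Real.abs_le_sqrt (hz k p hp hpk)) (SH.φ_nonneg k p)
          · rw [SH.φ_eq_zero_of_notMem hpk, zero_mul, zero_mul]
      _ = √m := by rw [← Finset.sum_mul, SH.φ_sum p hp, one_mul]
  calc (v p - (∑ k, SH.lift k (z k)) p) ^ 2 = |v p - (∑ k, SH.lift k (z k)) p| ^ 2 :=
        (sq_abs _).symm
    _ ≤ √m ^ 2 := by gcongr
    _ = m := Real.sq_sqrt hm0
    _ = 4 * C₁ * σ ^ 2 * H ^ 2 * ∫ y in Metric.ball p (4 * (σ * H)), hessSq v y := by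
        rw [hm]; ring
    _ ≤ _ := by
        gcongr
        · exact hE0 _ _
        · exact le_max_left _ _

/-- The pointwise error contributes `H²`. Summation over the nodes counts every point about `(H/h)²`
times. -/
theorem exists_nodalSq_sub_le {Ω : Set Plane} (hΩ : IsPolygonalDomain Ω) (σ H₀ : ℝ) :
    ∃ C : ℝ, 0 < C ∧ ∀ (h H : ℝ), 0 < h → h ≤ σ * H → H ≤ H₀ → ∀ (S : PUM Ω σ h) (SH : PUM Ω σ H)
      (v : Plane → ℝ), MemW2Inf v → (∀ x ∉ Ω, v x = 0) → ∃ ζ ∈ SH.space,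
        S.nodalSq (v - ζ) ≤ C * H ^ 4 / h ^ 2 * ∫ x in Ω, hessSq v x := by
  obtain ⟨C, hC, happ⟩ := exists_space_approx hΩ σ H₀
  refine ⟨max (C * (900 * σ ^ 7)) 1, lt_max_of_lt_right one_pos,
    fun h H hh hhH hHH₀ S SH v hv hv0 => ?_⟩
  have hσ := S.one_le_sigma hΩ.nonempty
  have hσ0 : 0 < σ := by linarith
  have hH : 0 < H := pos_of_mul_pos_right (hh.trans_le hhH) hσ0.le
  obtain ⟨ζ, hζ, hζp⟩ := happ H hH hHH₀ SH v hv hv0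
  refine ⟨ζ, hζ, ?_⟩
  have hE0 : 0 ≤ ∫ x in Ω, hessSq v x := integral_nonneg fun z => hessSq_nonneg v z
  calc S.nodalSq (v - ζ)
      ≤ ∑ i, ∑ p ∈ S.nodes i, C * H ^ 2 * ∫ y in Metric.ball p (4 * (σ * H)), hessSq v y :=
        Finset.sum_le_sum fun i _ => Finset.sum_le_sum fun p hp => hζp p (S.nodes_mem i p hp).1
    _ = C * H ^ 2 * ∑ i, ∑ p ∈ S.nodes i, ∫ y in Metric.ball p (4 * (σ * H)), hessSq v y := by
        simp only [Finset.mul_sum]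
    _ ≤ C * H ^ 2 * (36 * σ ^ 3 * (4 * (σ * H) + σ * h) ^ 2 / h ^ 2 * ∫ y, hessSq v y) := by
        gcongr
        exact S.sum_nodes_integral_ball_le hσ0 hh (hΩ.integrable_hessSq hv hv0) (hessSq_nonneg v)
          (by positivity)
    _ ≤ C * H ^ 2 * (36 * σ ^ 3 * (5 * (σ ^ 2 * H)) ^ 2 / h ^ 2 * ∫ x in Ω, hessSq v x) := by
        rw [hΩ.integral_hessSq hv0]
        gcongr
        have h1 : σ * h ≤ σ * (σ * H) := by gcongr
        have h2 : σ * H ≤ σ * (σ * H) := le_mul_of_one_le_left (by positivity) hσ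
        nlinarith
    _ = C * (900 * σ ^ 7) * H ^ 4 / h ^ 2 * ∫ x in Ω, hessSq v x := by ring
    _ ≤ _ := by
        gcongr
        exact le_max_left _ _

end PUM

/-! ### The abstract theory of additive Schwarz preconditioners -/

/-- `T` is self-adjoint for the inner product `B`, so the supremum of its Rayleigh quotient is an
eigenvalue. -/
theorem exists_hasEigenvalue_of_symm {V : Type*} [AddCommGroup V] [Module ℝ V]
    [FiniteDimensional ℝ V] [Nontrivial V] (B : V →ₗ[ℝ] V →ₗ[ℝ] ℝ) (hsymm : ∀ v w, B v w = B w v)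
    (hpos : ∀ v, v ≠ 0 → 0 < B v v) (T : Module.End ℝ V) (hT : ∀ v w, B (T v) w = B v (T w)) :
    ∃ μ : ℝ, Module.End.HasEigenvalue T μ := by
  let core : InnerProductSpace.Core ℝ V :=
    { inner := fun v w => B v w
      conj_inner_symm := fun v w => hsymm w v
      re_inner_nonneg := fun v => by
        by_cases hv : v = 0
        · simp [hv]
        · exact (hpos v hv).le
      add_left := fun u v w => by simp
      smul_left := fun u v r => by simp
      definite := fun v hv => by
        by_contra hne
        exact (hpos v hne).ne' hv }
  let _ : NormedAddCommGroup V := core.toNormedAddCommGroup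
  let _ : InnerProductSpace ℝ V := InnerProductSpace.ofCore core.toCore
  have hsa : LinearMap.IsSymmetric T := fun v w => hT v w
  exact ⟨_, hsa.hasEigenvalue_iSup_of_finiteDimensional⟩

section Schwarz

variable {ι : Type} [Fintype ι] {W : Submodule ℝ (Plane → ℝ)}
  {Wsub : ι → Submodule ℝ (Plane → ℝ)}

theorem additiveSchwarz_apply (hW : ∀ a, Wsub a ≤ W)
    (A : ∀ a, Wsub a ≃ₗ[ℝ] Module.Dual ℝ (Wsub a)) (f : Module.Dual ℝ W) :
    additiveSchwarz hW A f = ∑ a, Submodule.inclusion (hW a)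
      ((A a).symm (f.comp (Submodule.inclusion (hW a)))) := by
  simp only [additiveSchwarz, LinearMap.sum_apply, LinearMap.comp_apply]
  rfl

/-- Bounds for the spectrum of an additive Schwarz operator, in terms of the stability constant of
the decompositions and of the constant in the reverse inequality. -/
theorem additiveSchwarz_eigenvalue_bounds (hW : ∀ a, Wsub a ≤ W)
    (A : W →ₗ[ℝ] Module.Dual ℝ W) (Asub : ∀ a, Wsub a ≃ₗ[ℝ] Module.Dual ℝ (Wsub a))
    (hsymm : ∀ v w, A v w = A w v) (hpos : ∀ v, v ≠ 0 → 0 < A v v)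
    (hAsub : ∀ a (v w : Wsub a),
      Asub a v w = A (Submodule.inclusion (hW a) v) (Submodule.inclusion (hW a) w))
    {M K : ℝ} (hK0 : 0 < K)
    (hM : ∀ w : ∀ a, Wsub a, A (∑ a, Submodule.inclusion (hW a) (w a))
      (∑ a, Submodule.inclusion (hW a) (w a)) ≤
        M * ∑ a, A (Submodule.inclusion (hW a) (w a)) (Submodule.inclusion (hW a) (w a)))
    (hK : ∀ v, ∃ w : ∀ a, Wsub a, ∑ a, Submodule.inclusion (hW a) (w a) = v ∧
      ∑ a, A (Submodule.inclusion (hW a) (w a)) (Submodule.inclusion (hW a) (w a)) ≤ K * A v v) :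
    (∀ v w, A ((additiveSchwarz hW Asub ∘ₗ A) v) w = A v ((additiveSchwarz hW Asub ∘ₗ A) w)) ∧
    ∀ μ : ℝ, Module.End.HasEigenvalue (additiveSchwarz hW Asub ∘ₗ A) μ → 1 ≤ K * μ ∧ μ ≤ M := by
  set T : Module.End ℝ W := additiveSchwarz hW Asub ∘ₗ A with hT
  -- `P a` is the `A`-orthogonal projection onto `Wsub a`, and `T` is the sum of these projections.
  let P : ∀ a, W → Wsub a := fun a v =>
    (Asub a).symm ((A v).comp (Submodule.inclusion (hW a)))
  let ι' : ∀ a, Wsub a → W := fun a => Submodule.inclusion (hW a)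
  have hTP : ∀ v, T v = ∑ a, ι' a (P a v) := fun v => additiveSchwarz_apply hW Asub (A v)
  have hP : ∀ a v (w : Wsub a), A (ι' a (P a v)) (ι' a w) = A v (ι' a w) := by
    intro a v w
    rw [← hAsub a (P a v) w, LinearEquiv.apply_symm_apply]
    rfl
  have hTw : ∀ v w, A (T v) w = ∑ a, A (ι' a (P a v)) (ι' a (P a w)) := by
    intro v w
    rw [hTP, map_sum, LinearMap.sum_apply]
    refine Finset.sum_congr rfl fun a _ => ?_
    rw [hsymm, ← hP a w (P a v), hsymm]
  refine ⟨fun v w => ?_, fun μ hμ => ?_⟩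
  · rw [hsymm v, hTw, hTw]
    exact Finset.sum_congr rfl fun a _ => hsymm _ _
  obtain ⟨v, hv⟩ := hμ.exists_hasEigenvector
  have hTv : T v = μ • v := hv.apply_eq_smul
  have hE : 0 < A v v := hpos v hv.2
  set Q := ∑ a, A (ι' a (P a v)) (ι' a (P a v)) with hQ
  have hQμ : Q = μ * A v v := by
    rw [hQ, ← hTw v v, hTv, map_smul, LinearMap.smul_apply, smul_eq_mul]
  have hnn : ∀ w, 0 ≤ A w w := fun w => by
    by_cases hw : w = 0
    · simp [hw]
    · exact (hpos w hw).le
  -- For a stable splitting `w` of `v`, orthogonality gives `A v v = ∑ A (P v) w`. Young's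
  -- inequality with weight `K` bounds this by `K Q / 2 + A v v / 2`, where `Q = μ A v v`.
  have hlow : 1 ≤ K * μ := by
    obtain ⟨w, hwv, hwK⟩ := hK v
    have h1 : A v v = ∑ a, A (ι' a (P a v)) (ι' a (w a)) := by
      conv_lhs => arg 2; rw [← hwv]
      rw [map_sum]
      exact Finset.sum_congr rfl fun a _ => (hP a v (w a)).symm
    have h2 : ∀ a, A (ι' a (P a v)) (ι' a (w a)) ≤
        K / 2 * A (ι' a (P a v)) (ι' a (P a v)) + 1 / (2 * K) * A (ι' a (w a)) (ι' a (w a)) := by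
      intro a
      have h3 := hnn (K • ι' a (P a v) - ι' a (w a))
      simp only [map_sub, map_smul, LinearMap.sub_apply, LinearMap.smul_apply, smul_eq_mul] at h3
      rw [hsymm (ι' a (w a)) (ι' a (P a v))] at h3
      have h4 : K / 2 * A (ι' a (P a v)) (ι' a (P a v)) +
          1 / (2 * K) * A (ι' a (w a)) (ι' a (w a)) - A (ι' a (P a v)) (ι' a (w a)) =
          (1 / (2 * K)) * (K * (K * A (ι' a (P a v)) (ι' a (P a v)) -
            A (ι' a (P a v)) (ι' a (w a))) - (K * A (ι' a (P a v)) (ι' a (w a)) -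
              A (ι' a (w a)) (ι' a (w a)))) := by
        field_simp
        ring
      have h5 : 0 ≤ 1 / (2 * K) := by positivity
      nlinarith
    have h6 := Finset.sum_le_sum fun a (_ : a ∈ Finset.univ) => h2 a
    rw [← h1, Finset.sum_add_distrib, ← Finset.mul_sum, ← Finset.mul_sum, ← hQ] at h6
    have h7 : 1 / (2 * K) * ∑ a, A (ι' a (w a)) (ι' a (w a)) ≤ 1 / (2 * K) * (K * A v v) :=
      mul_le_mul_of_nonneg_left hwK (by positivity)
    have h8 : 1 / (2 * K) * (K * A v v) = A v v / 2 := by field_simp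
    have h9 : A v v ≤ (K * μ) * A v v := by
      rw [mul_assoc, ← hQμ]; linarith
    exact le_of_mul_le_mul_right (by linarith) hE
  refine ⟨hlow, ?_⟩
  have hμ0 : 0 < μ := pos_of_mul_pos_right (by linarith : 0 < K * μ) hK0.le
  -- The projections of an eigenvector add up to `μ v`, so this reads `μ² A v v ≤ M μ A v v`.
  have h1 := hM fun a => P a v
  have h2 : ∑ a, Submodule.inclusion (hW a) (P a v) = μ • v := by rw [← hTv, hTP]
  rw [h2] at h1
  change _ ≤ M * Q at h1
  simp only [map_smul, LinearMap.smul_apply, smul_eq_mul] at h1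
  rw [hQμ] at h1
  have h3 : μ * (μ * A v v) ≤ M * (μ * A v v) := h1
  exact le_of_mul_le_mul_right h3 (by positivity)

/-- The condition number estimate for additive Schwarz preconditioners. -/
theorem exists_additiveSchwarz_condition_le (hW : ∀ a, Wsub a ≤ W) [FiniteDimensional ℝ W]
    (hWne : W ≠ ⊥) (form : (Plane → ℝ) → (Plane → ℝ) → ℝ)
    (hsymm : ∀ v w, form v w = form w v)
    (hadd : ∀ u ∈ W, ∀ v ∈ W, ∀ w ∈ W, form (u + v) w = form u w + form v w)
    (hsmul : ∀ c : ℝ, ∀ u ∈ W, ∀ w ∈ W, form (c • u) w = c * form u w)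
    (hpos : ∀ v ∈ W, v ≠ 0 → 0 < form v v) {M K : ℝ} (hK0 : 0 < K)
    (hM : ∀ w : ι → Plane → ℝ, (∀ a, w a ∈ Wsub a) →
      form (∑ a, w a) (∑ a, w a) ≤ M * ∑ a, form (w a) (w a))
    (hK : ∀ v ∈ W, ∃ w : ι → Plane → ℝ, (∀ a, w a ∈ Wsub a) ∧ ∑ a, w a = v ∧
      ∑ a, form (w a) (w a) ≤ K * form v v) :
    ∃ (A : W →ₗ[ℝ] Module.Dual ℝ W) (Asub : ∀ a, Wsub a ≃ₗ[ℝ] Module.Dual ℝ (Wsub a)),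
      (∀ v w : W, A v w = form v w) ∧ (∀ a (v w : Wsub a), Asub a v w = form v w) ∧
      ∃ lmin lmax : ℝ,
        IsLeast {μ : ℝ | Module.End.HasEigenvalue (additiveSchwarz hW Asub ∘ₗ A) μ} lmin ∧
        IsGreatest {μ : ℝ | Module.End.HasEigenvalue (additiveSchwarz hW Asub ∘ₗ A) μ} lmax ∧
        0 < lmin ∧ lmax / lmin ≤ M * K := by
  have hadd' : ∀ u ∈ W, ∀ v ∈ W, ∀ w ∈ W, form w (u + v) = form w u + form w v :=
    fun u hu v hv w hw => by rw [hsymm, hadd u hu v hv w hw, hsymm u, hsymm v]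
  have hsmul' : ∀ c : ℝ, ∀ u ∈ W, ∀ w ∈ W, form w (c • u) = c * form w u :=
    fun c u hu w hw => by rw [hsymm, hsmul c u hu w hw, hsymm u]
  let mk : ∀ U : Submodule ℝ (Plane → ℝ), U ≤ W → (U →ₗ[ℝ] Module.Dual ℝ U) := fun U hU =>
    LinearMap.mk₂ ℝ (fun v w : U => form v w)
      (fun u v w => hadd u (hU u.2) v (hU v.2) w (hU w.2))
      (fun c u w => hsmul c u (hU u.2) w (hU w.2))
      (fun w u v => hadd' u (hU u.2) v (hU v.2) w (hU w.2))
      (fun c w u => hsmul' c u (hU u.2) w (hU w.2))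
  have hmk : ∀ (U : Submodule ℝ (Plane → ℝ)) (hU : U ≤ W) (v w : U), mk U hU v w = form v w :=
    fun U hU v w => rfl
  have hfd : ∀ a, FiniteDimensional ℝ (Wsub a) := fun a => Submodule.finiteDimensional_of_le (hW a)
  have hinj : ∀ a, Function.Injective (mk (Wsub a) (hW a)) := by
    intro a
    rw [← LinearMap.ker_eq_bot, LinearMap.ker_eq_bot']
    intro v hv
    by_contra hne
    have h1 := hpos v (hW a v.2) fun h => hne (Subtype.ext h)
    rw [← hmk _ (hW a) v v, hv] at h1
    simp at h1
  let Asub : ∀ a, Wsub a ≃ₗ[ℝ] Module.Dual ℝ (Wsub a) := fun a =>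
    LinearMap.linearEquivOfInjective (mk (Wsub a) (hW a)) (hinj a)
      (Subspace.dual_finrank_eq (K := ℝ) (V := Wsub a)).symm
  have hAs : ∀ a (v w : Wsub a), Asub a v w = form v w := fun a v w => rfl
  let A : W →ₗ[ℝ] Module.Dual ℝ W := mk W le_rfl
  have hA : ∀ v w : W, A v w = form v w := fun v w => rfl
  have hApos : ∀ v, v ≠ 0 → 0 < A v v := fun v hv =>
    hpos v v.2 fun h => hv (Subtype.ext h)
  have hcoe : ∀ w : ∀ a, Wsub a, ((∑ a, Submodule.inclusion (hW a) (w a) : W) : Plane → ℝ) =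
      ∑ a, (w a : Plane → ℝ) := fun w => by
    rw [Submodule.coe_sum]; rfl
  obtain ⟨hTs, hTb⟩ := additiveSchwarz_eigenvalue_bounds hW A Asub
    (fun v w => hsymm v w) hApos (fun a v w => rfl) (M := M) hK0
    (fun w => by
      rw [hA, hcoe]
      exact hM (fun a => w a) fun a => (w a).2)
    (fun v => by
      obtain ⟨w, hw1, hw2, hw3⟩ := hK v v.2
      refine ⟨fun a => ⟨w a, hw1 a⟩, Subtype.ext ?_, hw3⟩
      rw [hcoe]
      exact hw2)
  have hnt : Nontrivial W := Submodule.nontrivial_iff_ne_bot.2 hWne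
  set T : Module.End ℝ W := additiveSchwarz hW Asub ∘ₗ A with hT
  obtain ⟨μ₀, hμ₀⟩ := exists_hasEigenvalue_of_symm A (fun v w => hsymm v w) hApos T hTs
  have hfin : {μ : ℝ | Module.End.HasEigenvalue T μ}.Finite := Module.End.finite_hasEigenvalue T
  obtain ⟨lmin, hl1, hl2⟩ := Set.exists_min_image _ id hfin ⟨μ₀, hμ₀⟩
  obtain ⟨lmax, hx1, hx2⟩ := Set.exists_max_image _ id hfin ⟨μ₀, hμ₀⟩
  have hlmin := hTb lmin hl1
  have hlmax := hTb lmax hx1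
  have hl0 : 0 < lmin := pos_of_mul_pos_right (by linarith : 0 < K * lmin) hK0.le
  have hx0 : 0 < lmax := pos_of_mul_pos_right (by linarith : 0 < K * lmax) hK0.le
  refine ⟨A, Asub, hA, hAs, lmin, lmax, ⟨hl1, fun μ hμ => hl2 μ hμ⟩, ⟨hx1, fun μ hμ => hx2 μ hμ⟩,
    hl0, ?_⟩
  rw [div_le_iff₀ hl0]
  nlinarith

end Schwarz

/-! ### The upper bound for the spectrum -/

theorem hessian_sum_apply {ι : Type*} (s : Finset ι) {u : ι → Plane → ℝ} {x : Plane}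
    (hu : ∀ i ∈ s, TwiceDiffAt (u i) x) (e e' : Plane) :
    hessian (∑ i ∈ s, u i) x e e' = ∑ i ∈ s, hessian (u i) x e e' := by
  classical
  induction s using Finset.induction_on with
  | empty => simp
  | insert a s ha ih =>
    have hs : ∀ i ∈ s, TwiceDiffAt (u i) x := fun i hi => hu i (Finset.mem_insert_of_mem hi)
    rw [Finset.sum_insert ha, Finset.sum_insert ha, ← ih hs,
      hessian_add (hu a (Finset.mem_insert_self _ _)) (TwiceDiffAt.sum s hs).1]
    rfl

theorem hessSq_add_le {u w : Plane → ℝ} {x : Plane} (hu : TwiceDiffAt u x)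
    (hw : TwiceDiffAt w x) : hessSq (u + w) x ≤ 2 * hessSq u x + 2 * hessSq w x := by
  simp only [hessSq, Finset.mul_sum, ← Finset.sum_add_distrib]
  refine Finset.sum_le_sum fun i _ => Finset.sum_le_sum fun j _ => ?_
  rw [hessian_add hu hw]
  simp only [_root_.add_apply]
  nlinarith [sq_nonneg (hessian u x (dir i) (dir j) - hessian w x (dir i) (dir j))]

/-- Cauchy–Schwarz over the indices in `J` only, so the factor counts the terms active at `x` and
not all the subdomains. -/
theorem hessSq_sum_le {ι : Type*} (s J : Finset ι) {u : ι → Plane → ℝ} {x : Plane}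
    (hu : ∀ j ∈ s, TwiceDiffAt (u j) x) (hJ : J ⊆ s) (h0 : ∀ j ∈ s, j ∉ J → hessian (u j) x = 0) :
    hessSq (∑ j ∈ s, u j) x ≤ J.card * ∑ j ∈ s, hessSq (u j) x := by
  have e : ∑ j ∈ s, hessSq (u j) x =
      ∑ k : Fin 2, ∑ l : Fin 2, ∑ j ∈ s, hessian (u j) x (dir k) (dir l) ^ 2 := by
    simp only [hessSq]
    rw [Finset.sum_comm]
    exact Finset.sum_congr rfl fun k _ => Finset.sum_comm
  rw [e]
  simp only [hessSq, Finset.mul_sum]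
  simp only [← Finset.mul_sum]
  rw [Finset.mul_sum]
  refine Finset.sum_le_sum fun k _ => ?_
  rw [Finset.mul_sum]
  refine Finset.sum_le_sum fun l _ => ?_
  rw [hessian_sum_apply s hu]
  have h1 : ∑ j ∈ s, hessian (u j) x (dir k) (dir l) = ∑ j ∈ J, hessian (u j) x (dir k) (dir l) :=
    (Finset.sum_subset hJ fun j hj hjJ => by rw [h0 j hj hjJ]; rfl).symm
  rw [h1]
  refine sq_sum_le_card_mul_sum_sq.trans ?_
  gcongr

theorem energy_add_le {Ω : Set Plane} (hfin : volume Ω < ⊤) {u w : Plane → ℝ} (hu : MemW2Inf u)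
    (hw : MemW2Inf w) : ∫ x in Ω, hessSq (u + w) x ≤
      2 * (∫ x in Ω, hessSq u x) + 2 * ∫ x in Ω, hessSq w x := by
  have i1 := (hu.integrableOn_hessSq hfin).const_mul 2
  have i2 := (hw.integrableOn_hessSq hfin).const_mul 2
  rw [← integral_const_mul, ← integral_const_mul, ← integral_add i1 i2]
  refine integral_mono_ae ((hu.add hw).integrableOn_hessSq hfin) (i1.add i2) (ae_restrict_of_ae ?_)
  filter_upwards [hu.ae_twiceDiffAt, hw.ae_twiceDiffAt] with x hx hx'
  exact hessSq_add_le hx hx'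

namespace Decomposition

variable {Ω : Set Plane} {σ h : ℝ} {S : PUM Ω σ h} {Nc : ℕ} {Cdag H δ : ℝ}
  (𝒟 : Decomposition S Nc Cdag H δ)

open Classical in
/-- The subdomains with a node in a patch around `x`. -/
noncomputable def neighbours (x : Plane) : Finset (Fin 𝒟.J) :=
  (Finset.univ.filter fun i => x ∈ S.patch i).biUnion fun i =>
    (S.nodes i).biUnion fun p => Finset.univ.filter fun j => p ∈ 𝒟.D j

/-- At most `σ` patches contain `x`, each has at most `9` nodes, and each node is in at most `Nc`
subdomains. -/
theorem card_neighbours_le (x : Plane) : ((𝒟.neighbours x).card : ℝ) ≤ σ * (9 * Nc) := by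
  classical
  have h1 : ∀ i, ((S.nodes i).biUnion fun p => Finset.univ.filter fun j => p ∈ 𝒟.D j).card ≤
      9 * Nc := by
    intro i
    refine (Finset.card_biUnion_le_card_mul _ _ Nc fun p hp => ?_).trans
      (Nat.mul_le_mul_right _ (S.card_nodes_le i))
    have := 𝒟.overlap p (S.nodes_mem i p hp).1
    rwa [Set.ncard_eq_toFinset_card', Set.toFinset_ofPred] at this
  have h2 := Finset.card_biUnion_le_card_mul (Finset.univ.filter fun i => x ∈ S.patch i)
    (fun i => (S.nodes i).biUnion fun p => Finset.univ.filter fun j => p ∈ 𝒟.D j) (9 * Nc)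
    fun i _ => h1 i
  calc ((𝒟.neighbours x).card : ℝ)
      ≤ (((Finset.univ.filter fun i => x ∈ S.patch i).card * (9 * Nc) : ℕ) : ℝ) := by
        exact_mod_cast h2
    _ = ((Finset.univ.filter fun i => x ∈ S.patch i).card : ℝ) * (9 * Nc) := by push_cast; ring
    _ ≤ σ * (9 * Nc) := by gcongr; exact S.card_patches_le x

/-- All the nodal values of `w` in the patches at `x` are zero, so the local interpolants there
vanish, and with them `w` near `x`. -/
theorem hessian_eq_zero_of_notMem_neighbours (hΩ : IsOpen Ω) {N : Set Plane} {j : Fin 𝒟.J}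
    {w : Plane → ℝ} (hw : w ∈ S.subSpace N (𝒟.D j)) {x : Plane} (hx : x ∈ Ω)
    (hj : j ∉ 𝒟.neighbours x) : hessian w x = 0 := by
  classical
  have hwi : S.interp w = w := (S.mem_truncSpace_iff.1 hw.1).1
  have hloc : ∀ i, x ∈ S.patch i → S.localInterp i w = 0 := by
    intro i hi
    refine S.localInterp_eq_of (Submodule.zero_mem _) fun p hp => ?_
    refine (hw.2 p ⟨i, hp⟩ fun hpD => hj ?_).symm
    exact Finset.mem_biUnion.2 ⟨i, Finset.mem_filter.2 ⟨Finset.mem_univ i, hi⟩,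
      Finset.mem_biUnion.2 ⟨p, hp, Finset.mem_filter.2 ⟨Finset.mem_univ j, hpD⟩⟩⟩
  have hev : ∀ i, ∀ᶠ y in nhds x, S.φ i y * S.localInterp i w y = 0 := by
    intro i
    by_cases hi : x ∈ S.patch i
    · exact Filter.Eventually.of_forall fun y => by rw [hloc i hi, Pi.zero_apply, mul_zero]
    · have hz : x ∉ tsupport (S.φ i) := fun h => hi (S.φ_support i h)
      filter_upwards [(isClosed_tsupport (S.φ i)).isOpen_compl.mem_nhds hz] with y hy
      rw [image_eq_zero_of_notMem_tsupport hy, zero_mul]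
  have : w =ᶠ[nhds x] 0 := by
    filter_upwards [hΩ.mem_nhds hx, Filter.eventually_all.2 hev] with y hy hy'
    rw [← hwi, S.interp_apply_of_mem w hy, Finset.sum_eq_zero fun i _ => hy' i, Pi.zero_apply]
  rw [hessian_congr this, hessian_zero]

theorem memW2Inf_of_mem_levelSpace (hΩ : IsOpen Ω) {SH : PUM Ω σ H} {N : Set Plane}
    {a : Option (Fin 𝒟.J)} {w : Plane → ℝ} (hw : w ∈ 𝒟.levelSpace SH N a) : MemW2Inf w :=
  S.memW2Inf_of_mem_space hΩ (S.mem_space_iff.2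
    (S.mem_truncSpace_iff.1 (𝒟.levelSpace_le SH N a hw)).1)

/-- The coarse part is separated off at the price of a factor `2`. The subdomain parts have finite
overlap. -/
theorem energy_sum_le (hΩ : IsPolygonalDomain Ω) (SH : PUM Ω σ H) (N : Set Plane)
    (w : Option (Fin 𝒟.J) → Plane → ℝ) (hw : ∀ a, w a ∈ 𝒟.levelSpace SH N a) :
    ∫ x in Ω, hessSq (∑ a, w a) x ≤
      (2 + 2 * (σ * (9 * Nc))) * ∑ a, ∫ x in Ω, hessSq (w a) x := by
  classical
  have hσ0 : 0 < σ := by linarith [S.one_le_sigma hΩ.nonempty]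
  have hfin := hΩ.volume_lt_top
  have hmem : ∀ a, MemW2Inf (w a) := fun a => 𝒟.memW2Inf_of_mem_levelSpace hΩ.isOpen (hw a)
  have hnn : ∀ a, 0 ≤ ∫ x in Ω, hessSq (w a) x := fun a =>
    integral_nonneg fun x => hessSq_nonneg _ x
  have hsum : ∫ x in Ω, hessSq (∑ j, w (some j)) x ≤
      (σ * (9 * Nc)) * ∑ j, ∫ x in Ω, hessSq (w (some j)) x := by
    rw [← integral_finsetSum _ fun j _ => (hmem (some j)).integrableOn_hessSq hfin,
      ← integral_const_mul]
    refine integral_mono_ae ((MemW2Inf.sum _ fun j _ => hmem (some j)).integrableOn_hessSq hfin)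
      ((integrable_finsetSum _ fun j _ =>
        (hmem (some j)).integrableOn_hessSq hfin).const_mul _) ?_
    have hae : ∀ᵐ x, ∀ j, TwiceDiffAt (w (some j)) x :=
      ae_all_iff.2 fun j => (hmem (some j)).ae_twiceDiffAt
    filter_upwards [ae_restrict_mem hΩ.isOpen.measurableSet, ae_restrict_of_ae hae] with x hx hd
    refine (hessSq_sum_le Finset.univ (𝒟.neighbours x) (fun j _ => hd j) (Finset.subset_univ _)
      fun j _ hj => 𝒟.hessian_eq_zero_of_notMem_neighbours hΩ.isOpen (hw (some j)) hx hj).trans ?_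
    exact mul_le_mul_of_nonneg_right (𝒟.card_neighbours_le x)
      (Finset.sum_nonneg fun j _ => hessSq_nonneg _ x)
  rw [Fintype.sum_option, Fintype.sum_option]
  refine (energy_add_le hfin (hmem none) (MemW2Inf.sum _ fun j _ => hmem (some j))).trans ?_
  have h1 : 0 ≤ σ * (9 * (Nc : ℝ)) := by positivity
  have h2 : 0 ≤ ∑ j, ∫ x in Ω, hessSq (w (some j)) x := Finset.sum_nonneg fun j _ => hnn _
  nlinarith [hnn none]

/-! ### Decompositions subordinate to the subdomains -/

theorem D_subset (j : Fin 𝒟.J) : 𝒟.D j ⊆ Ω :=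
  (subset_iUnion 𝒟.D j).trans 𝒟.cover.subset

/-- The support condition speaks of the closure only, while nodes may lie on the boundary of `D j`.
The open set of points of `Ω` with `ψ j ≠ 0` lies in the interior of that closure, hence in `D j`
since there are no slits. -/
theorem ψ_eq_zero (hΩ : IsOpen Ω) (j : Fin 𝒟.J) {x : Plane} (hx : x ∈ Ω) (hxD : x ∉ 𝒟.D j) :
    𝒟.ψ j x = 0 := by
  by_contra hne
  have hU : IsOpen ({y | 𝒟.ψ j y ≠ 0} ∩ Ω) :=
    (isOpen_ne_fun (𝒟.ψ_mem j).continuous continuous_const).inter hΩ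
  have hsub : {y | 𝒟.ψ j y ≠ 0} ∩ Ω ⊆ closure (𝒟.D j) := fun y hy => by
    by_contra hyc
    exact hy.1 (𝒟.ψ_support j y ⟨hy.2, hyc⟩)
  exact hxD (𝒟.no_slit j ⟨interior_maximal hsub hU ⟨hne, hx⟩, hx⟩)

/-- The component of `w` in the subdomain `j`. -/
noncomputable def component (w : Plane → ℝ) (j : Fin 𝒟.J) : Plane → ℝ :=
  S.interp fun x => 𝒟.ψ j x * w x

theorem component_mem (hΩ : IsOpen Ω) {N : Set Plane} {w : Plane → ℝ} (hw : w ∈ S.truncSpace N)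
    (j : Fin 𝒟.J) : 𝒟.component w j ∈ S.subSpace N (𝒟.D j) := by
  refine ⟨S.mem_truncSpace_iff.2 ⟨S.interp_interp _, fun p hp hpN => ?_⟩, fun p hp hpD => ?_⟩
  · rw [component, S.interp_node _ hp, (S.mem_truncSpace_iff.1 hw).2 p hp hpN, mul_zero]
  · obtain ⟨i, hi⟩ := hp
    rw [component, S.interp_node _ ⟨i, hi⟩, 𝒟.ψ_eq_zero hΩ j (S.nodes_mem i p hi).1 hpD, zero_mul]

theorem sum_component {N : Set Plane} {w : Plane → ℝ} (hw : w ∈ S.truncSpace N) :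
    ∑ j, 𝒟.component w j = w := by
  simp only [component]
  rw [← map_sum]
  refine (S.interp_congr fun p hp => ?_).trans (S.mem_truncSpace_iff.1 hw).1
  obtain ⟨i, hi⟩ := hp
  rw [Finset.sum_apply, ← Finset.sum_mul, 𝒟.ψ_sum p (subset_closure (S.nodes_mem i p hi).1),
    one_mul]

theorem ψ_le_one (j : Fin 𝒟.J) {x : Plane} (hx : x ∈ Ω) : 𝒟.ψ j x ≤ 1 := by
  rw [← 𝒟.ψ_sum x (subset_closure hx)]
  exact Finset.single_le_sum (fun j _ => 𝒟.ψ_nonneg j x) (Finset.mem_univ j)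

/-- Since `0 ≤ ψ j ≤ 1`, the squares of the `ψ j` add up to at most one at every node. No overlap
constant enters. -/
theorem sum_nodalSq_le (w : Plane → ℝ) :
    ∑ j, S.nodalSq (fun x => 𝒟.ψ j x * w x) ≤ S.nodalSq w := by
  simp only [PUM.nodalSq]
  rw [Finset.sum_comm]
  refine Finset.sum_le_sum fun i _ => ?_
  rw [Finset.sum_comm]
  refine Finset.sum_le_sum fun p hp => ?_
  have hpΩ := (S.nodes_mem i p hp).1
  calc ∑ j, (𝒟.ψ j p * w p) ^ 2 ≤ ∑ j, 𝒟.ψ j p * w p ^ 2 := by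
        refine Finset.sum_le_sum fun j _ => ?_
        rw [mul_pow]
        refine mul_le_mul_of_nonneg_right ?_ (sq_nonneg _)
        nlinarith [𝒟.ψ_nonneg j p, 𝒟.ψ_le_one j hpΩ]
    _ = w p ^ 2 := by
        rw [← Finset.sum_mul, 𝒟.ψ_sum p (subset_closure hpΩ), one_mul]

/-! ### The energy of the products of `v` with the partition of unity -/

/-- Alignment puts this boundary into the null boundaries of the domain and of the patches. -/
theorem volume_frontier_D (hΩ : IsPolygonalDomain Ω) (j : Fin 𝒟.J) :
    volume (frontier (𝒟.D j)) = 0 := by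
  refine measure_mono_null (𝒟.aligned j) (measure_union_null hΩ.volume_frontier
    (measure_iUnion_null fun i => ?_))
  exact (convex_openRect _ _ _).addHaar_frontier volume

/-- The product rule on `D j`. The factor `12` is `4` from the Frobenius norm times `3` from the
square of a sum of three terms. The indicator lets the overlap bound `Nc` act after summation over
`j`. -/
theorem ae_hessSq_mul_le (hΩ : IsPolygonalDomain Ω) {v : Plane → ℝ} (hv : MemW2Inf v)
    (j : Fin 𝒟.J) : ∀ᵐ x ∂volume.restrict Ω, hessSq (fun y => 𝒟.ψ j y * v y) x ≤
      (𝒟.D j).indicator (fun x => 12 * (hessSq v x + 4 * (Cdag / δ) ^ 2 * ‖fderiv ℝ v x‖ ^ 2 +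
        (Cdag / δ ^ 2) ^ 2 * v x ^ 2)) x := by
  have hfr : ∀ᵐ x : Plane, x ∉ frontier (𝒟.D j) :=
    measure_eq_zero_iff_ae_notMem.1 (𝒟.volume_frontier_D hΩ j)
  filter_upwards [ae_restrict_mem hΩ.isOpen.measurableSet, ae_restrict_of_ae hfr,
    ae_restrict_of_ae hv.ae_twiceDiffAt, ae_restrict_of_ae (𝒟.ψ_mem j).ae_twiceDiffAt,
    𝒟.ψ_bound j 1 (by norm_num), 𝒟.ψ_bound j 2 le_rfl] with x hx hxf hv2 hψ2 b1 b2
  rw [norm_iteratedFDeriv_one, pow_one] at b1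
  rw [PUM.norm_hessian_eq] at b2
  by_cases hxD : x ∈ 𝒟.D j
  · rw [indicator_of_mem hxD]
    refine (hessSq_le_norm_sq _ _).trans ?_
    have h1 := norm_hessian_mul_le hψ2 hv2
    have hψ1 : |𝒟.ψ j x| ≤ 1 := abs_le.2 ⟨by linarith [𝒟.ψ_nonneg j x], 𝒟.ψ_le_one j hx⟩
    have k1 : |𝒟.ψ j x| * ‖hessian v x‖ ≤ ‖hessian v x‖ :=
      mul_le_of_le_one_left (norm_hessian_nonneg v x) hψ1
    have k2 : ‖fderiv ℝ (𝒟.ψ j) x‖ * ‖fderiv ℝ v x‖ ≤ Cdag / δ * ‖fderiv ℝ v x‖ :=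
      mul_le_mul_of_nonneg_right b1 (norm_nonneg _)
    have k3 : |v x| * ‖hessian (𝒟.ψ j) x‖ ≤ |v x| * (Cdag / δ ^ 2) :=
      mul_le_mul_of_nonneg_left b2 (abs_nonneg _)
    have k4 : ‖hessian (fun y => 𝒟.ψ j y * v y) x‖ ≤
        ‖hessian v x‖ + 2 * (Cdag / δ * ‖fderiv ℝ v x‖) + |v x| * (Cdag / δ ^ 2) := by linarith
    have k5 := pow_le_pow_left₀ (norm_hessian_nonneg _ x) k4 2
    have k6 := norm_hessian_sq_le v x
    have k7 : v x ^ 2 = |v x| ^ 2 := (sq_abs _).symm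
    rw [k7]
    set A := ‖hessian v x‖
    set B := Cdag / δ * ‖fderiv ℝ v x‖ with hB
    set D := |v x| * (Cdag / δ ^ 2) with hD
    have e1 : 4 * (Cdag / δ) ^ 2 * ‖fderiv ℝ v x‖ ^ 2 = (2 * B) ^ 2 := by rw [hB]; ring
    have e2 : (Cdag / δ ^ 2) ^ 2 * |v x| ^ 2 = D ^ 2 := by rw [hD]; ring
    rw [e1, e2]
    nlinarith [sq_nonneg (A - 2 * B), sq_nonneg (A - D), sq_nonneg (2 * B - D)]
  · rw [indicator_of_notMem hxD]
    have hxc : x ∉ closure (𝒟.D j) := fun hc =>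
      hxf ⟨hc, by rwa [(𝒟.isOpen j).interior_eq]⟩
    have : (fun y => 𝒟.ψ j y * v y) =ᶠ[nhds x] 0 := by
      filter_upwards [isClosed_closure.isOpen_compl.mem_nhds hxc, hΩ.isOpen.mem_nhds hx] with y hy hy'
      rw [𝒟.ψ_support j y ⟨hy', hy⟩, zero_mul, Pi.zero_apply]
    rw [hessSq_congr this, hessSq_zero]

theorem sum_energy_mul_le (hΩ : IsPolygonalDomain Ω) {v : Plane → ℝ} (hv : MemW2Inf v) :
    ∑ j, ∫ x in Ω, hessSq (fun y => 𝒟.ψ j y * v y) x ≤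
      12 * Nc * ((∫ x in Ω, hessSq v x) + 4 * (Cdag / δ) ^ 2 * (∫ x in Ω, ‖fderiv ℝ v x‖ ^ 2) +
        (Cdag / δ ^ 2) ^ 2 * ∫ x in Ω, v x ^ 2) := by
  classical
  have hfin := hΩ.volume_lt_top
  have hfm : IsFiniteMeasure (volume.restrict Ω) := ⟨by simpa using hfin⟩
  obtain ⟨M₁, hM₁⟩ := hv.2.1
  obtain ⟨M₂, hM₂⟩ := hv.2.2.1
  have hcd : Continuous (fderiv ℝ v) := hv.1.continuous_fderiv (by simp)
  have i1 : IntegrableOn (hessSq v) Ω := hv.integrableOn_hessSq hfin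
  have i2 : IntegrableOn (fun x => ‖fderiv ℝ v x‖ ^ 2) Ω :=
    Integrable.of_bound (by fun_prop) (M₂ ^ 2) (Filter.Eventually.of_forall fun x => by
      rw [Real.norm_of_nonneg (by positivity)]
      exact pow_le_pow_left₀ (norm_nonneg _) (hM₂ x) 2)
  have i3 : IntegrableOn (fun x => v x ^ 2) Ω :=
    Integrable.of_bound (hv.continuous.pow 2).aestronglyMeasurable (M₁ ^ 2)
      (Filter.Eventually.of_forall fun x => by
        rw [Real.norm_of_nonneg (by positivity), ← sq_abs]
        exact pow_le_pow_left₀ (abs_nonneg _) (hM₁ x) 2)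
  set F : Plane → ℝ := fun x => 12 * (hessSq v x + 4 * (Cdag / δ) ^ 2 * ‖fderiv ℝ v x‖ ^ 2 +
        (Cdag / δ ^ 2) ^ 2 * v x ^ 2) with hF
  have iF : IntegrableOn F Ω := ((i1.add (i2.const_mul _)).add (i3.const_mul _)).const_mul _
  have hF0 : ∀ x, 0 ≤ F x := fun x => by
    have := hessSq_nonneg v x
    simp only [hF]
    positivity
  have iFj : ∀ j, IntegrableOn ((𝒟.D j).indicator F) Ω := fun j =>
    iF.indicator (𝒟.isOpen j).measurableSet
  calc ∑ j, ∫ x in Ω, hessSq (fun y => 𝒟.ψ j y * v y) x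
      ≤ ∑ j, ∫ x in Ω, (𝒟.D j).indicator F x :=
        Finset.sum_le_sum fun j _ => integral_mono_ae
          (((𝒟.ψ_mem j).mul hv).integrableOn_hessSq hfin) (iFj j) (𝒟.ae_hessSq_mul_le hΩ hv j)
    _ = ∫ x in Ω, ∑ j, (𝒟.D j).indicator F x := (integral_finsetSum _ fun j _ => iFj j).symm
    _ ≤ ∫ x in Ω, Nc * F x := by
        refine integral_mono_ae (integrable_finsetSum _ fun j _ => iFj j) (iF.const_mul _) ?_
        filter_upwards [ae_restrict_mem hΩ.isOpen.measurableSet] with x hx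
        have h1 := 𝒟.overlap x hx
        rw [Set.ncard_eq_toFinset_card', Set.toFinset_ofPred] at h1
        have e : ∑ j, (𝒟.D j).indicator F x =
            ((Finset.univ.filter fun j => x ∈ 𝒟.D j).card : ℝ) * F x := by
          rw [Finset.card_filter, Nat.cast_sum, Finset.sum_mul]
          refine Finset.sum_congr rfl fun j _ => ?_
          rw [indicator_apply]
          split_ifs <;> simp
        rw [e]
        exact mul_le_mul_of_nonneg_right (by exact_mod_cast h1) (hF0 x)
    _ = _ := by
        have i4 : IntegrableOn (fun x => 4 * (Cdag / δ) ^ 2 * ‖fderiv ℝ v x‖ ^ 2) Ω :=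
          i2.const_mul _
        have i5 : IntegrableOn (fun x => (Cdag / δ ^ 2) ^ 2 * v x ^ 2) Ω := i3.const_mul _
        have i6 : IntegrableOn (fun x => hessSq v x +
          4 * (Cdag / δ) ^ 2 * ‖fderiv ℝ v x‖ ^ 2) Ω := i1.add i4
        rw [integral_const_mul, hF, integral_const_mul, integral_add i6 i5, integral_add i1 i4,
          integral_const_mul, integral_const_mul]
        ring

end Decomposition

/-! ### The stable decompositions and the condition number -/

namespace PUM

variable {Ω : Set Plane} {σ h : ℝ} (S : PUM Ω σ h)

theorem finiteDimensional_space : FiniteDimensional ℝ S.space := by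
  have hV : ∀ i, FiniteDimensional ℝ (S.V i) := fun i => by
    have : FiniteDimensional ℝ (biquadratic (S.frame i)) :=
      FiniteDimensional.span_of_finite ℝ (Set.finite_range _)
    exact Submodule.finiteDimensional_of_le (S.V_biquadratic i)
  unfold space
  infer_instance

theorem finiteDimensional_truncSpace (N : Set Plane) : FiniteDimensional ℝ (S.truncSpace N) := by
  have := S.finiteDimensional_space
  unfold truncSpace
  infer_instance

/-- The nodal basis function of a retained node is a nonzero member. -/
theorem truncSpace_ne_bot {N : Set Plane} (hN : N ⊆ S.allNodes) (hne : N.Nonempty) :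
    S.truncSpace N ≠ ⊥ := by
  obtain ⟨p, hp⟩ := hne
  intro h0
  have hmem : S.interp (({p} : Set Plane).indicator 1) ∈ S.truncSpace N := by
    refine S.mem_truncSpace_iff.2 ⟨S.interp_interp _, fun q hq hqN => ?_⟩
    rw [S.interp_node _ hq, indicator_of_notMem]
    rintro rfl
    exact hqN hp
  rw [h0, Submodule.mem_bot] at hmem
  have h1 := congrFun hmem p
  rw [S.interp_node _ (hN hp)] at h1
  simp at h1

theorem truncSpace_le_space (N : Set Plane) : S.truncSpace N ≤ S.space := fun _ hv =>
  S.mem_space_iff.2 (S.mem_truncSpace_iff.1 hv).1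

end PUM

namespace Decomposition

variable {Ω : Set Plane} {σ h : ℝ} {S : PUM Ω σ h} {Nc : ℕ} {Cdag H δ : ℝ}

/-- Some subdomain has diameter at least `H / σ` and lies in `Ω`. Hence `H`, `δ` and `h` have upper
bounds that depend on `Ω` and `σ` only. -/
theorem mesh_le (𝒟 : Decomposition S Nc Cdag H δ) (hΩ : IsPolygonalDomain Ω) : H ≤ σ * Metric.diam Ω := by
  obtain ⟨x, hx⟩ := hΩ.nonempty
  obtain ⟨j, -⟩ := mem_iUnion.1 (𝒟.cover.superset hx)
  have hσ := S.one_le_sigma hΩ.nonempty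
  have h1 := (𝒟.diam_ge j).trans (Metric.diam_mono (𝒟.D_subset j) hΩ.isBounded)
  rwa [div_le_iff₀' (by linarith)] at h1

/-- The `δ⁻⁴` bound: stability of interpolation, the product rule, and the Poincaré inequalities for
`v` and its gradient. As `δ ≤ δ₀`, the lower powers of `δ⁻¹` are absorbed. -/
theorem exists_sum_component_le (hΩ : IsPolygonalDomain Ω) (σ : ℝ) (Nc : ℕ) (Cdag : ℝ) :
    ∃ C : ℝ, 0 < C ∧ ∀ h H δ : ℝ, 0 < h → h ≤ δ → δ ≤ σ * H →
      ∀ (S : PUM Ω σ h) (𝒟 : Decomposition S Nc Cdag H δ) (N : Set Plane),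
        ∀ v ∈ S.truncSpace N, ∑ j, ∫ x in Ω, hessSq (𝒟.component v j) x ≤
          C * δ ^ (-4 : ℤ) * ∫ x in Ω, hessSq v x := by
  set δ₀ := σ * (σ * Metric.diam Ω) with hδ₀
  obtain ⟨C₁, hC₁, h₁⟩ := PUM.exists_energy_interp_le hΩ σ δ₀
  obtain ⟨C₂, hC₂, h₂⟩ := hΩ.integral_fderiv_sq_le
  obtain ⟨C₃, hC₃, h₃⟩ := hΩ.sq_le_energy
  set V := volume.real Ω with hV
  have hV0 : 0 ≤ V := measureReal_nonneg
  refine ⟨C₁ * (12 * Nc * (δ₀ ^ 4 + 4 * Cdag ^ 2 * C₂ * δ₀ ^ 2 + Cdag ^ 2 * (V * C₃))) + 1,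
    by positivity, fun h H δ hh hhδ hδH S 𝒟 N v hv => ?_⟩
  have hσ := S.one_le_sigma hΩ.nonempty
  have hδ : 0 < δ := hh.trans_le hhδ
  have hδδ : δ ≤ δ₀ := hδH.trans (mul_le_mul_of_nonneg_left (𝒟.mesh_le hΩ) (by linarith))
  have hvs := S.truncSpace_le_space N hv
  have hvW := S.memW2Inf_of_mem_space hΩ.isOpen hvs
  have hv0 : ∀ x, x ∉ Ω → v x = 0 := fun x hx => S.eq_zero_of_mem_space hvs hx
  set E := ∫ x in Ω, hessSq v x with hE
  have hE0 : 0 ≤ E := integral_nonneg fun x => hessSq_nonneg _ x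
  have hfm : IsFiniteMeasure (volume.restrict Ω) := ⟨by simpa using hΩ.volume_lt_top⟩
  have b3 : ∫ x in Ω, v x ^ 2 ≤ V * (C₃ * E) := by
    calc ∫ x in Ω, v x ^ 2 ≤ ∫ x in Ω, C₃ * E := by
          refine integral_mono_of_nonneg (Filter.Eventually.of_forall fun x => sq_nonneg _)
            (integrable_const _) (Filter.Eventually.of_forall fun x => h₃ v hvW hv0 x)
      _ = V * (C₃ * E) := by simp [hV, Measure.real]
  have b2 := h₂ v hvW hv0
  have b1 : ∑ j, ∫ x in Ω, hessSq (𝒟.component v j) x ≤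
      C₁ * ∑ j, ∫ x in Ω, hessSq (fun y => 𝒟.ψ j y * v y) x := by
    rw [Finset.mul_sum]
    refine Finset.sum_le_sum fun j _ => h₁ h hh (hhδ.trans hδδ) S _ ((𝒟.ψ_mem j).mul hvW) ?_
    intro x hx
    rw [hv0 x hx, mul_zero]
  have b4 := 𝒟.sum_energy_mul_le hΩ hvW
  have hz : δ ^ (-4 : ℤ) = 1 / δ ^ 4 := by
    rw [zpow_neg, one_div]; norm_cast
  have hq4 : 1 ≤ δ₀ ^ 4 / δ ^ 4 := by
    rw [one_le_div (by positivity)]; gcongr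
  have hq2 : 1 / δ ^ 2 ≤ δ₀ ^ 2 / δ ^ 4 := by
    rw [div_le_div_iff₀ (by positivity) (by positivity)]
    have : δ ^ 2 ≤ δ₀ ^ 2 := by gcongr
    nlinarith [sq_nonneg δ]
  have b5 : E + 4 * (Cdag / δ) ^ 2 * (∫ x in Ω, ‖fderiv ℝ v x‖ ^ 2) +
      (Cdag / δ ^ 2) ^ 2 * ∫ x in Ω, v x ^ 2 ≤
      (δ₀ ^ 4 + 4 * Cdag ^ 2 * C₂ * δ₀ ^ 2 + Cdag ^ 2 * (V * C₃)) * (1 / δ ^ 4) * E := by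
    have c1 : E ≤ δ₀ ^ 4 / δ ^ 4 * E := le_mul_of_one_le_left hE0 hq4
    have c2 : 4 * (Cdag / δ) ^ 2 * (∫ x in Ω, ‖fderiv ℝ v x‖ ^ 2) ≤
        4 * Cdag ^ 2 * C₂ * (δ₀ ^ 2 / δ ^ 4) * E := by
      calc 4 * (Cdag / δ) ^ 2 * (∫ x in Ω, ‖fderiv ℝ v x‖ ^ 2)
          ≤ 4 * (Cdag / δ) ^ 2 * (C₂ * E) := by gcongr
        _ = 4 * Cdag ^ 2 * C₂ * (1 / δ ^ 2) * E := by ring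
        _ ≤ _ := by gcongr
    have c3 : (Cdag / δ ^ 2) ^ 2 * ∫ x in Ω, v x ^ 2 ≤ (Cdag / δ ^ 2) ^ 2 * (V * (C₃ * E)) := by
      gcongr
    calc _ ≤ δ₀ ^ 4 / δ ^ 4 * E + 4 * Cdag ^ 2 * C₂ * (δ₀ ^ 2 / δ ^ 4) * E +
          (Cdag / δ ^ 2) ^ 2 * (V * (C₃ * E)) := add_le_add (add_le_add c1 c2) c3
      _ = _ := by ring
  rw [hz]
  calc _ ≤ C₁ * (12 * Nc *
        ((δ₀ ^ 4 + 4 * Cdag ^ 2 * C₂ * δ₀ ^ 2 + Cdag ^ 2 * (V * C₃)) * (1 / δ ^ 4) * E)) :=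
        b1.trans (mul_le_mul_of_nonneg_left (b4.trans (by gcongr)) hC₁.le)
    _ = C₁ * (12 * Nc * (δ₀ ^ 4 + 4 * Cdag ^ 2 * C₂ * δ₀ ^ 2 + Cdag ^ 2 * (V * C₃))) *
        (1 / δ ^ 4) * E := by ring
    _ ≤ _ := by gcongr; linarith

/-- At retained nodes truncation does not change the error. At discarded nodes both functions vanish
and there is no error. This makes the estimates independent of the choice of nodes. -/
theorem nodalSq_sub_trunc_le {N : Set Plane} {v : Plane → ℝ} (S : PUM Ω σ h)
    (hv : v ∈ S.truncSpace N) (ζ : Plane → ℝ) :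
    S.nodalSq (v - S.trunc N (S.interp ζ)) ≤ S.nodalSq (v - ζ) := by
  simp only [PUM.nodalSq]
  refine Finset.sum_le_sum fun i _ => Finset.sum_le_sum fun p hp => ?_
  have hpa : p ∈ S.allNodes := ⟨i, hp⟩
  have e : S.trunc N (S.interp ζ) p = N.indicator (S.interp ζ) p := S.interp_node _ hpa
  rw [Pi.sub_apply, e]
  by_cases hpN : p ∈ N
  · rw [indicator_of_mem hpN, S.interp_node _ hpa, Pi.sub_apply]
  · rw [indicator_of_notMem hpN, (S.mem_truncSpace_iff.1 hv).2 p hpa hpN]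
    simpa using sq_nonneg _

/-- The `(H/h)⁴` bound: the inverse estimate `h⁻²` meets the nodal approximation error `H⁴/h²`. Both
`v₀ - v` and the components of `v - v₀` are controlled through nodal values alone. -/
theorem exists_coarse_decomposition (hΩ : IsPolygonalDomain Ω) (σ : ℝ) :
    ∃ C : ℝ, 0 < C ∧ ∀ (Nc : ℕ) (Cdag h H δ : ℝ), 0 < h → h ≤ δ → δ ≤ σ * H →
      ∀ (S : PUM Ω σ h) (SH : PUM Ω σ H) (𝒟 : Decomposition S Nc Cdag H δ) (N : Set Plane),
        ∀ v ∈ S.truncSpace N, ∃ v₀ ∈ S.coarseSpace SH N,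
          (∫ x in Ω, hessSq v₀ x) + ∑ j, ∫ x in Ω, hessSq (𝒟.component (v - v₀) j) x ≤
            C * (H / h) ^ 4 * ∫ x in Ω, hessSq v x := by
  obtain ⟨C₁, hC₁, h₁⟩ := PUM.exists_nodalSq_sub_le hΩ σ (σ * Metric.diam Ω)
  set C₂ := 64 * (289 * σ ^ 4) ^ 2 * σ ^ 4 with hC₂
  have hC₂0 : 0 ≤ C₂ := by positivity
  refine ⟨2 * σ ^ 4 + 3 * (C₂ * C₁) + 1, by positivity,
    fun Nc Cdag h H δ hh hhδ hδH S SH 𝒟 N v hv => ?_⟩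
  have hσ := S.one_le_sigma hΩ.nonempty
  have hfin := hΩ.volume_lt_top
  have hvs := S.truncSpace_le_space N hv
  have hvW := S.memW2Inf_of_mem_space hΩ.isOpen hvs
  have hH : 0 < H := by
    by_contra hc
    nlinarith
  obtain ⟨ζ, hζ, hζle⟩ := h₁ h H hh (hhδ.trans hδH) (𝒟.mesh_le hΩ) S SH v hvW
    fun x hx => S.eq_zero_of_mem_space hvs hx
  set E := ∫ x in Ω, hessSq v x with hE
  have hE0 : 0 ≤ E := integral_nonneg fun x => hessSq_nonneg _ x
  set v₀ := S.trunc N (S.interp ζ) with hv₀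
  have hv₀m : v₀ ∈ S.coarseSpace SH N :=
    Submodule.mem_map_of_mem (Submodule.mem_map_of_mem hζ)
  have hwm : v - v₀ ∈ S.truncSpace N := sub_mem hv (S.coarseSpace_le SH N hv₀m)
  have hwW := S.memW2Inf_of_mem_space hΩ.isOpen (S.truncSpace_le_space N hwm)
  have hvW' : MemW2Inf (v₀ - v) :=
    S.memW2Inf_of_mem_space hΩ.isOpen (S.truncSpace_le_space N
      (sub_mem (S.coarseSpace_le SH N hv₀m) hv))
  have hn : S.nodalSq (v - v₀) ≤ C₁ * H ^ 4 / h ^ 2 * E :=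
    (nodalSq_sub_trunc_le S hv ζ).trans hζle
  have hnn : C₂ / h ^ 2 * S.nodalSq (v - v₀) ≤ C₂ * C₁ * (H / h) ^ 4 * E := by
    calc C₂ / h ^ 2 * S.nodalSq (v - v₀) ≤ C₂ / h ^ 2 * (C₁ * H ^ 4 / h ^ 2 * E) := by gcongr
      _ = _ := by rw [div_pow]; field_simp
  have hen : ∀ ξ, ∫ x in Ω, hessSq (S.interp ξ) x ≤ C₂ / h ^ 2 * S.nodalSq ξ :=
    S.energy_interp_le_nodalSq hΩ hh
  have b1 : ∑ j, ∫ x in Ω, hessSq (𝒟.component (v - v₀) j) x ≤ C₂ * C₁ * (H / h) ^ 4 * E := by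
    refine le_trans ?_ hnn
    refine (Finset.sum_le_sum fun j _ => hen _).trans ?_
    rw [← Finset.mul_sum]
    exact mul_le_mul_of_nonneg_left (𝒟.sum_nodalSq_le _) (by positivity)
  have hneg : (v₀ - v) = S.interp (v₀ - v) :=
    (S.mem_truncSpace_iff.1 (sub_mem (S.coarseSpace_le SH N hv₀m) hv)).1.symm
  have b2 : ∫ x in Ω, hessSq (v₀ - v) x ≤ C₂ * C₁ * (H / h) ^ 4 * E := by
    rw [hneg]
    refine (hen _).trans (le_trans (le_of_eq ?_) hnn)
    congr 1
    simp only [PUM.nodalSq, Pi.sub_apply]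
    refine Finset.sum_congr rfl fun i _ => Finset.sum_congr rfl fun p _ => ?_
    ring
  have b3 := energy_add_le hfin hvW hvW'
  rw [add_sub_cancel] at b3
  -- From `h ≤ δ ≤ σH`. This absorbs the energy of `v` itself in `v₀ = v + (v₀ - v)`.
  have hratio : 1 ≤ σ ^ 4 * (H / h) ^ 4 := by
    rw [← mul_pow]
    refine one_le_pow₀ ?_
    rw [← mul_div_assoc, one_le_div hh]
    exact hhδ.trans hδH
  have b4 : E ≤ σ ^ 4 * (H / h) ^ 4 * E := le_mul_of_one_le_left hE0 hratio
  refine ⟨v₀, hv₀m, ?_⟩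
  have b5 : 0 ≤ (H / h) ^ 4 * E := by positivity
  calc _ ≤ (2 * E + 2 * (C₂ * C₁ * (H / h) ^ 4 * E)) + C₂ * C₁ * (H / h) ^ 4 * E := by
        linarith
    _ ≤ _ := by nlinarith

/-- Every function of the truncated space is a sum of members of the coarse space and the subdomain
spaces, with control of the energies. -/
theorem exists_stable_decomposition (hΩ : IsPolygonalDomain Ω) (σ : ℝ) (Nc : ℕ) (Cdag : ℝ) :
    ∃ C : ℝ, 0 < C ∧ ∀ h H δ : ℝ, 0 < h → h ≤ δ → δ ≤ σ * H →
      ∀ (S : PUM Ω σ h) (SH : PUM Ω σ H) (𝒟 : Decomposition S Nc Cdag H δ) (N : Set Plane),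
        ∀ v ∈ S.truncSpace N, ∃ w : Option (Fin 𝒟.J) → Plane → ℝ,
          (∀ a, w a ∈ 𝒟.levelSpace SH N a) ∧ ∑ a, w a = v ∧
          ∑ a, ∫ x in Ω, hessSq (w a) x ≤
            C * min ((H / h) ^ 4) (δ ^ (-4 : ℤ)) * ∫ x in Ω, hessSq v x := by
  obtain ⟨C₁, hC₁, h₁⟩ := exists_coarse_decomposition hΩ σ
  obtain ⟨C₂, hC₂, h₂⟩ := exists_sum_component_le hΩ σ Nc Cdag
  refine ⟨max C₁ C₂, lt_max_of_lt_left hC₁, fun h H δ hh hhδ hδH S SH 𝒟 N v hv => ?_⟩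
  have hδ : 0 < δ := hh.trans_le hhδ
  have hE0 : 0 ≤ ∫ x in Ω, hessSq v x := integral_nonneg fun x => hessSq_nonneg _ x
  obtain ⟨v₀, hv₀, hle⟩ : ∃ v₀ ∈ S.coarseSpace SH N,
      (∫ x in Ω, hessSq v₀ x) + ∑ j, ∫ x in Ω, hessSq (𝒟.component (v - v₀) j) x ≤
        max C₁ C₂ * min ((H / h) ^ 4) (δ ^ (-4 : ℤ)) * ∫ x in Ω, hessSq v x := by
    -- The smaller bound selects the splitting: the coarse approximant for `(H/h)⁴`, and `v₀ = 0`
    -- for `δ⁻⁴`.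
    rcases min_choice ((H / h) ^ 4) (δ ^ (-4 : ℤ)) with hm | hm <;> rw [hm]
    · obtain ⟨v₀, hv₀, hle⟩ := h₁ Nc Cdag h H δ hh hhδ hδH S SH 𝒟 N v hv
      refine ⟨v₀, hv₀, hle.trans ?_⟩
      gcongr
      exact le_max_left _ _
    · refine ⟨0, Submodule.zero_mem _, ?_⟩
      have h0 : ∫ x in Ω, hessSq 0 x = 0 := by simp [hessSq_zero]
      rw [h0, zero_add, sub_zero]
      refine (h₂ h H δ hh hhδ hδH S 𝒟 N v hv).trans ?_
      gcongr
      exact le_max_right _ _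
  have hwm : v - v₀ ∈ S.truncSpace N := sub_mem hv (S.coarseSpace_le SH N hv₀)
  refine ⟨fun a => a.elim v₀ (𝒟.component (v - v₀)), ?_, ?_, ?_⟩
  · rintro (_ | j)
    · exact hv₀
    · exact 𝒟.component_mem hΩ.isOpen hwm j
  · rw [Fintype.sum_option]
    simp only [Option.elim]
    rw [𝒟.sum_component hwm, add_sub_cancel]
  · rw [Fintype.sum_option]
    exact hle

end Decomposition

/-! ### The condition number estimate -/

theorem mainTheorem2 (Ω : Set Plane) (hΩ : IsPolygonalDomain Ω) (σ : ℝ) (Nc : ℕ) (Cdag : ℝ) :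
    ∃ C : ℝ, 0 < C ∧
      ∀ (h H δ : ℝ), 0 < h → h ≤ δ → δ ≤ σ * H →
      ∀ (S : PUM Ω σ h) (SH : PUM Ω σ H) (𝒟 : Decomposition S Nc Cdag H δ)
        (N : Set Plane), N ⊆ S.allNodes → N.Nonempty →
      ∃ (A : S.truncSpace N →ₗ[ℝ] Module.Dual ℝ (S.truncSpace N))
        (Asub : ∀ a, 𝒟.levelSpace SH N a ≃ₗ[ℝ] Module.Dual ℝ (𝒟.levelSpace SH N a)),
        (∀ v w, A v w = plateForm Ω v w) ∧
        (∀ a v w, Asub a v w = plateForm Ω v w) ∧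
        ∃ lmin lmax : ℝ,
          IsLeast {μ : ℝ | Module.End.HasEigenvalue
            (additiveSchwarz (𝒟.levelSpace_le SH N) Asub ∘ₗ A) μ} lmin ∧
          IsGreatest {μ : ℝ | Module.End.HasEigenvalue
            (additiveSchwarz (𝒟.levelSpace_le SH N) Asub ∘ₗ A) μ} lmax ∧
          0 < lmin ∧
          lmax / lmin ≤ C * min ((H / h) ^ 4) (δ ^ (-4 : ℤ)) := by
  obtain ⟨C₁, hC₁, h₁⟩ := Decomposition.exists_stable_decomposition hΩ σ Nc Cdag
  obtain ⟨C₂, hC₂, h₂⟩ := hΩ.sq_le_energy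
  refine ⟨max ((2 + 2 * (σ * (9 * Nc))) * C₁) 1, by positivity,
    fun h H δ hh hhδ hδH S SH 𝒟 N hN hNne => ?_⟩
  have hσ := S.one_le_sigma hΩ.nonempty
  have hδ : 0 < δ := hh.trans_le hhδ
  have hH : 0 < H := by
    by_contra hc
    nlinarith
  have hfin := hΩ.volume_lt_top
  have hW : ∀ v ∈ S.truncSpace N, MemW2Inf v := fun v hv =>
    S.memW2Inf_of_mem_space hΩ.isOpen (S.truncSpace_le_space N hv)
  have hm : 0 < min ((H / h) ^ 4) (δ ^ (-4 : ℤ)) := lt_min (by positivity) (by positivity)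
  have := S.finiteDimensional_truncSpace N
  have hself : ∀ v ∈ S.truncSpace N, plateForm Ω v v = ∫ x in Ω, hessSq v x := fun v hv =>
    plateForm_self hΩ.isOpen (hW v hv)
  have hle := 𝒟.levelSpace_le SH N
  obtain ⟨A, Asub, hA, hAs, lmin, lmax, hl, hg, hpos, hq⟩ :=
    exists_additiveSchwarz_condition_le (𝒟.levelSpace_le SH N)
      (S.truncSpace_ne_bot hN hNne) (plateForm Ω) (plateForm_comm Ω)
      (fun u hu v hv w hw => plateForm_add_left hΩ.isOpen hfin (hW u hu) (hW v hv) (hW w hw))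
      (fun c u hu w hw => plateForm_smul_left hΩ.isOpen c (hW u hu) (hW w hw))
      -- Definiteness of the form: a nonzero value of `v` at some point forces positive energy by
      -- the sup bound.
      (fun v hv hv0 => by
        rw [hself v hv]
        obtain ⟨x, hx⟩ := Function.ne_iff.1 hv0
        have h3 := h₂ v (hW v hv) (fun x hx => S.eq_zero_of_mem_space
          (S.truncSpace_le_space N hv) hx) x
        have h4 : 0 < v x ^ 2 := by
          have : v x ≠ 0 := hx
          positivity
        exact pos_of_mul_pos_right (h4.trans_le h3) hC₂.le)
      (M := 2 + 2 * (σ * (9 * Nc))) (K := C₁ * min ((H / h) ^ 4) (δ ^ (-4 : ℤ)))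
      (by positivity)
      (fun w hw => by
        rw [hself _ (sum_mem fun a _ => hle a (hw a)),
          Finset.sum_congr rfl fun a _ => hself _ (hle a (hw a))]
        exact 𝒟.energy_sum_le hΩ SH N w hw)
      (fun v hv => by
        obtain ⟨w, hw, hs, hb⟩ := h₁ h H δ hh hhδ hδH S SH 𝒟 N v hv
        refine ⟨w, hw, hs, ?_⟩
        rw [hself v hv, Finset.sum_congr rfl fun a _ => hself _ (hle a (hw a))]
        exact hb)
  refine ⟨A, Asub, hA, hAs, lmin, lmax, hl, hg, hpos, hq.trans ?_⟩
  rw [← mul_assoc]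
  exact mul_le_mul_of_nonneg_right (le_max_left _ _) hm.le
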